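/- **Processes.** Expressions are $e ::= v \mid 0 \mid s(e)$ and annotated processes are $$P,Q ::= 0 \mid (P\,|\,Q) \mid\, !a(\tilde v).P \mid a(\tilde v).P \mid \overline a\langle\tilde e\rangle.P \mid (\nu a)P \mid \mathsf{tick}.P \mid \mathsf{match}\ e\ \{0\mapsto P;\ s(x)\mapsto Q\} \mid m:P \qquad (m\in\mathbb N),$$ where $a$ ranges over channel names, $x$ over integer variables, $v$ over both; processes are taken up to $\alpha$-renaming. Congruence $\equiv$ is the least congruence such that $|$ is commutative and associative with neutral element $0$, $(\nu a)(\nu b)P\equiv(\nu b)(\nu a)P$, $(\nu a)(P|Q)\equiv(\nu a)P\,|\,Q$ if $a$ is not free in $Q$, $0:P\equiv P$, $m:(P|Q)\equiv m:P\,|\,m:Q$, $m:(\nu a)P\equiv(\nu a)(m:P)$ and $m:(n:P)\equiv(m+n):P$. Reduction $\Rightarrow$ is the least relation that contains - $(n:a(\tilde v).P)\,|\,(m:\overline a\langle\tilde e\rangle.Q)\Rightarrow\max(m,n):(P[\tilde e/\tilde v]\,|\,Q)$, - $(n:{!a}(\tilde v).P)\,|\,(m:\overline a\langle\tilde e\rangle.Q)\Rightarrow(n:{!a}(\tilde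 v).P)\,|\,\max(m,n):(P[\tilde e/\tilde v]\,|\,Q)$, - $\mathsf{tick}.P\Rightarrow 1:P$, $\ \mathsf{match}\ 0\ \{0\mapsto P;s(x)\mapsto Q\}\Rightarrow P$, $\ \mathsf{match}\ s(e)\ \{0\mapsto P;s(x)\mapsto Q\}\Rightarrow Q[e/x]$ (when these substitutions are well defined) and is closed under $|$, $(\nu a)$, $n:$ and $\equiv$. The local complexity is $\mathcal C(n:P)=n+\mathcal C(P)$, $\mathcal C(P|Q)=\max(\mathcal C(P),\mathcal C(Q))$, $\mathcal C((\nu a)P)=\mathcal C(P)$, and $0$ in all other cases. The *global parallel complexity* (span) of $P$ is $\sup\{\mathcal C(Q)\mid P\Rightarrow^*Q\}\in\mathbb N\cup\{\infty\}$ (the maximum, if there is one). **Indices.** Fix a set of function symbols on $\mathbb N$ that contains the integer constants, $+$, $\times$, truncated subtraction, $\max$ and $\min$. Finite indices $\mathtt I$ are the terms over these symbols and index variables; an index is a finite index or $\infty$; in $+$ and $\max$ the value $\infty$ is absorbing, and $\infty-1=\infty$. For a finite set $\varphi$ of index variables and a finite set $\Phi$ of constraints $I\bowtie J$ between indices over $\varphi$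 ($\bowtie$ a binary relation on $\mathbb N\cup\{\infty\}$), $\varphi;\Phi\models C$ means that every valuation $\varphi\to\mathbb N$ satisfying $\Phi$ satisfies $C$. An interval $[I,J]$ is required to satisfy $\varphi;\Phi\models I\le J$, throughout. $A_o,B_o$ (obligations) and $K$ (complexities) denote intervals; a capacity $I_c,J_c$ is an index $J$, understood as $[-\infty,J]$, or an interval; capacities are ordered by inclusion, $I_c\le J_c$. Put $[I,J]\sqcup[I',J']=[\max(I,I'),\max(J,J')]$, $[I,J]+[I',J']=[I+I',J+J']$, $[I,J]+J'=[I,J+J']$; $[L,R]\oplus J=[0,L+J]$, $[L,R]\oplus[I,J]=[R+I,L+J]$; $J;[K_1,K_2]=[0,J+K_2]$, $[\infty,\infty];[K_1,K_2]=[0,0]$, $[\mathtt I,J];[K_1,K_2]=[0,J+K_2]$. **Usages.** $U,V::=0\mid(U|V)\mid \mathrm{In}^{A_o}_{J_c}.U\mid\mathrm{Out}^{A_o}_{J_c}.U\mid{!U}\mid U+V$; $\alpha$ stands for $\mathrm{In}$ or $\mathrm{Out}$. The usage $\uparrow^{A_o}U$ (resp. $\uparrow^{J_c}U$) adds $A_o$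 (resp. $J_c$) to the obligations of the outermost actions of $U$ and commutes with $|$, $!$, $+$. Congruence $\equiv$ is the least congruence such that $|$ is commutative and associative with neutral element $0$, $!0\equiv0$, $!U\equiv{!U}|U$, $!(U|V)\equiv{!U}|{!V}$, $!!U\equiv{!U}$. Under $\varphi;\Phi$, the usage $\mathrm{In}^{A_o}_{I_c}.U\,|\,\mathrm{Out}^{B_o}_{J_c}.V$ reduces to $\uparrow^{A_o\sqcup B_o}(U|V)$ if $\varphi;\Phi\models B_o\subseteq A_o\oplus I_c$ and $\varphi;\Phi\models A_o\subseteq B_o\oplus J_c$, and to $\mathsf{err}$ if not; $U+V$ reduces to $U$ and to $V$; reduction is closed under $\equiv$ and under $\cdot\,|\,V$ (with $\mathsf{err}|V$ read as $\mathsf{err}$). $U$ is *reliable* under $\varphi;\Phi$ if no reduction sequence from it leads to $\mathsf{err}$. Subusage $\varphi;\Phi\vdash U\sqsubseteq V$ is the least transitive relation closed under $\equiv$ on both sides and under all usage constructors, with $U\sqsubseteq0$; $U_1+U_2\sqsubseteq U_i$; $\alpha^{A_o}_{I_c}.U\sqsubseteq\alpha^{B_o}_{J_c}.U$ if $\varphi;\Phi\models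 B_o\subseteq A_o$ and $\varphi;\Phi\models I_c\le J_c$; and $\alpha^{A_o}_{J_c}.U\,|\,\uparrow^{A_o+J_c}V\sqsubseteq\alpha^{A_o}_{J_c}.(U|V)$. **Types.** $T::=\mathsf{Nat}[I,J]\mid\mathsf{ch}(\tilde T)/U\mid\forall\tilde\imath.\mathsf{serv}^K(\tilde T)/U$, the index variables $\tilde\imath$ being bound in $K$ and $\tilde T$. Subtyping: $\mathsf{Nat}[I,J]\sqsubseteq\mathsf{Nat}[I',J']$ if $\varphi;\Phi\models I'\le I$ and $\varphi;\Phi\models J\le J'$; $\mathsf{ch}(\tilde T)/U\sqsubseteq\mathsf{ch}(\tilde T')/V$ if $\tilde T\sqsubseteq\tilde T'$, $\tilde T'\sqsubseteq\tilde T$ and $U\sqsubseteq V$; $\forall\tilde\imath.\mathsf{serv}^K(\tilde T)/U\sqsubseteq\forall\tilde\imath.\mathsf{serv}^{K'}(\tilde T')/V$ if $\tilde T\sqsubseteq\tilde T'$, $\tilde T'\sqsubseteq\tilde T$ and $K=K'$ under $\varphi,\tilde\imath;\Phi$, and $\varphi;\Phi\vdash U\sqsubseteq V$. Delaying and $!$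 act on the usage of a type and leave integer types unchanged. $T|T'$ is defined when $T,T'$ are the same up to the usage (the same, for integer types), and composes the usages by $|$. A type is reliable if it is an integer type or its usage is reliable. All operations and relations extend pointwise to contexts $\Gamma=v_1:T_1,\dots,v_n:T_n$. **Typing.** Expressions: $\Gamma\vdash v:T$ if $v:T\in\Gamma$; $\Gamma\vdash0:\mathsf{Nat}[0,0]$; if $\Gamma\vdash e:\mathsf{Nat}[I,J]$ then $\Gamma\vdash s(e):\mathsf{Nat}[I+1,J+1]$; if $\Delta\vdash e:T'$, $\Gamma\sqsubseteq\Delta$, $T'\sqsubseteq T$ then $\Gamma\vdash e:T$. Tuples: $\Gamma\vdash():()$, and if $\Gamma\vdash e:T$ and $\Delta\vdash\tilde e:\tilde T$ then $\Gamma|\Delta\vdash e,\tilde e:T,\tilde T$. The judgement $\varphi;\Phi;\Gamma\vdash P\triangleleft K$ is generated by (with $\varphi;\Phi$ omitted when it does not change): - $\Gamma\vdash0\triangleleft[0,0]$; - if $\Gamma\vdash P\triangleleft K_1$ and $\Delta\vdash Q\triangleleft K_2$, then $\Gamma|\Delta\vdash P|Q\triangleleft K_1\sqcup K_2$; - if $\Gamma\vdash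 P\triangleleft K$, then $\uparrow^{[1,1]}\Gamma\vdash\mathsf{tick}.P\triangleleft K+[1,1]$ and $\uparrow^{[m,m]}\Gamma\vdash m:P\triangleleft K+[m,m]$; - if $\Gamma,a:\mathsf{ch}(\tilde T)/U,\tilde v:\tilde T\vdash P\triangleleft K$, then $\uparrow^{J_c}\Gamma,a:\mathsf{ch}(\tilde T)/\mathrm{In}^{[0,0]}_{J_c}.U\vdash a(\tilde v).P\triangleleft J_c;K$; - if $\varphi,\tilde\imath;\Phi;\Gamma,a:\forall\tilde\imath.\mathsf{serv}^K(\tilde T)/U,\tilde v:\tilde T\vdash P\triangleleft K$, then $\varphi;\Phi;\uparrow^{J_c}{!\Gamma},a:\forall\tilde\imath.\mathsf{serv}^K(\tilde T)/{!\mathrm{In}^{[0,0]}_{J_c}.U}\vdash{!a}(\tilde v).P\triangleleft[0,0]$ (where $\varphi;\Phi$, $\Gamma$, $U$ and $J_c$ do not involve $\tilde\imath$); - if $\Gamma',a:\mathsf{ch}(\tilde T)/V\vdash\tilde e:\tilde T$ and $\Gamma,a:\mathsf{ch}(\tilde T)/U\vdash P\triangleleft K$, then $\uparrow^{J_c}(\Gamma|\Gamma'),a:\mathsf{ch}(\tilde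 T)/\mathrm{Out}^{[0,0]}_{J_c}.(V|U)\vdash\overline a\langle\tilde e\rangle.P\triangleleft J_c;K$; - if $\Gamma',a:\forall\tilde\imath.\mathsf{serv}^K(\tilde T)/V\vdash\tilde e:\tilde T\{\tilde{\mathtt I}/\tilde\imath\}$ for finite indices $\tilde{\mathtt I}$ and $\Gamma,a:\forall\tilde\imath.\mathsf{serv}^K(\tilde T)/U\vdash P\triangleleft K'$, then $\uparrow^{J_c}(\Gamma|\Gamma'),a:\forall\tilde\imath.\mathsf{serv}^K(\tilde T)/\mathrm{Out}^{[0,0]}_{J_c}.(V|U)\vdash\overline a\langle\tilde e\rangle.P\triangleleft J_c;(K'\sqcup K\{\tilde{\mathtt I}/\tilde\imath\})$; - if $\Gamma\vdash e:\mathsf{Nat}[I,J]$, $\varphi;(\Phi,I\le0);\Gamma\vdash P\triangleleft K$ and $\varphi;(\Phi,J\ge1);\Gamma,x:\mathsf{Nat}[I-1,J-1]\vdash Q\triangleleft K$, then $\varphi;\Phi;\Gamma\vdash\mathsf{match}\ e\ \{0\mapsto P;s(x)\mapsto Q\}\triangleleft K$; - if $\Gamma,a:T\vdash P\triangleleft K$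 with $T$ a reliable channel or server type, then $\Gamma\vdash(\nu a)P\triangleleft K$; - if $\Delta\vdash P\triangleleft K$, $\Gamma\sqsubseteq\Delta$ and $\varphi;\Phi\models K\subseteq K'$, then $\Gamma\vdash P\triangleleft K'$. **Theorem.** Let $P$ be an annotated process and let $n\in\mathbb N\cup\{\infty\}$ be its global parallel complexity. If $\varphi;\Phi;\Gamma\vdash P\triangleleft[I,J]$ is derivable and all types in $\Gamma$ are reliable under $\varphi;\Phi$, then $\varphi;\Phi\models J\ge n$. If, moreover, no variable of $\Gamma$ has an integer type $\mathsf{Nat}[I',J']$, then $\varphi;\Phi\models I\le n$. -/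

import Mathlib

namespace PiUsage

/-! ## Expressions and annotated processes

Processes are considered up to renaming of bound names, so binders are represented by
de Bruijn indices: an input binds `k` variables (the first component of the tuple being the
variable `0`), a restriction and the second branch of a pattern matching bind one variable. -/

/-- Expressions `e ::= v | 0 | s(e)`. -/
inductive Expr : Type
  | var (x : ℕ)
  | zero
  | succ (e : Expr)

/-- Annotated processes. -/
inductive Proc : Type
  /-- the inert term `0` -/
  | nil
  /-- `P | Q` -/
  | par (P Q : Proc)
  /-- `!a(v₁,…,vₖ).P` -/
  | rep (a k : ℕ) (P : Proc)
  /-- `a(v₁,…,vₖ).P` -/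
  | inp (a k : ℕ) (P : Proc)
  /-- `a⟨e₁,…,eₖ⟩.P` -/
  | out (a : ℕ) (es : List Expr) (P : Proc)
  /-- `(ν a) P` -/
  | nu (P : Proc)
  /-- `tick.P` -/
  | tick (P : Proc)
  /-- `match e {0 ↦ P; s(x) ↦ Q}` -/
  | case (e : Expr) (P Q : Proc)
  /-- `m : P` -/
  | ann (m : ℕ) (P : Proc)

/-- Renaming of variables in an expression. -/
def Expr.rename (f : ℕ → ℕ) : Expr → Expr
  | .var x => .var (f x)
  | .zero => .zero
  | .succ e => .succ (e.rename f)

/-- Substitution in an expression. -/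
def Expr.subst (σ : ℕ → Expr) : Expr → Expr
  | .var x => σ x
  | .zero => .zero
  | .succ e => .succ (e.subst σ)

/-- The renaming under `k` binders. -/
def liftRen (k : ℕ) (f : ℕ → ℕ) : ℕ → ℕ :=
  fun i => if i < k then i else f (i - k) + k

/-- The substitution under `k` binders. -/
def liftSub (k : ℕ) (σ : ℕ → Expr) : ℕ → Expr :=
  fun i => if i < k then .var i else (σ (i - k)).rename (· + k)

/-- The substitution of the tuple `es` for the variables bound by the outermost binder. -/
def instSub (es : List Expr) : ℕ → Expr :=
  fun i => (es[i]?).getD (.var (i - es.length))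

/-- Capture-avoiding renaming. -/
def Proc.rename : (ℕ → ℕ) → Proc → Proc
  | _, .nil => .nil
  | f, .par P Q => .par (P.rename f) (Q.rename f)
  | f, .rep a k P => .rep (f a) k (P.rename (liftRen k f))
  | f, .inp a k P => .inp (f a) k (P.rename (liftRen k f))
  | f, .out a es P => .out (f a) (es.map (Expr.rename f)) (P.rename f)
  | f, .nu P => .nu (P.rename (liftRen 1 f))
  | f, .tick P => .tick (P.rename f)
  | f, .case e P Q => .case (e.rename f) (P.rename f) (Q.rename (liftRen 1 f))
  | f, .ann m P => .ann m (P.rename f)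

/-- The name denoted by an expression that is a variable (the value on other expressions is
irrelevant: see `Proc.SubstDefined`). -/
def Expr.name : Expr → ℕ
  | .var x => x
  | _ => 0

/-- Capture-avoiding substitution `P[σ]`; meaningful when `P.SubstDefined σ` holds. -/
def Proc.subst : (ℕ → Expr) → Proc → Proc
  | _, .nil => .nil
  | σ, .par P Q => .par (P.subst σ) (Q.subst σ)
  | σ, .rep a k P => .rep (σ a).name k (P.subst (liftSub k σ))
  | σ, .inp a k P => .inp (σ a).name k (P.subst (liftSub k σ))
  | σ, .out a es P => .out (σ a).name (es.map (Expr.subst σ)) (P.subst σ)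
  | σ, .nu P => .nu (P.subst (liftSub 1 σ))
  | σ, .tick P => .tick (P.subst σ)
  | σ, .case e P Q => .case (e.subst σ) (P.subst σ) (Q.subst (liftSub 1 σ))
  | σ, .ann m P => .ann m (P.subst σ)

/-- The substitution `P[σ]` is well defined: a name on which `P` communicates is replaced by a
name, not by an integer expression. -/
def Proc.SubstDefined : (ℕ → Expr) → Proc → Prop
  | _, .nil => True
  | σ, .par P Q => P.SubstDefined σ ∧ Q.SubstDefined σ
  | σ, .rep a k P => (∃ b, σ a = .var b) ∧ P.SubstDefined (liftSub k σ)
  | σ, .inp a k P => (∃ b, σ a = .var b) ∧ P.SubstDefined (liftSub k σ)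
  | σ, .out a _ P => (∃ b, σ a = .var b) ∧ P.SubstDefined σ
  | σ, .nu P => P.SubstDefined (liftSub 1 σ)
  | σ, .tick P => P.SubstDefined σ
  | σ, .case _ P Q => P.SubstDefined σ ∧ Q.SubstDefined (liftSub 1 σ)
  | σ, .ann _ P => P.SubstDefined σ

/-- The exchange of the two innermost names. -/
def swapRen : ℕ → ℕ
  | 0 => 1
  | 1 => 0
  | i + 2 => i + 2

/-- Congruence `P ≡ Q` of annotated processes: the least congruence containing the axioms.
In `nu_par`, that the restricted name is not free in `Q` is expressed by `Q.rename (· + 1)`. -/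
inductive Proc.Congr : Proc → Proc → Prop
  | refl (P) : Congr P P
  | symm {P Q} : Congr P Q → Congr Q P
  | trans {P Q R} : Congr P Q → Congr Q R → Congr P R
  -- compatibility with the constructors
  | par_congr {P P' Q Q'} : Congr P P' → Congr Q Q' → Congr (.par P Q) (.par P' Q')
  | rep_congr (a k) {P P'} : Congr P P' → Congr (.rep a k P) (.rep a k P')
  | inp_congr (a k) {P P'} : Congr P P' → Congr (.inp a k P) (.inp a k P')
  | out_congr (a es) {P P'} : Congr P P' → Congr (.out a es P) (.out a es P')
  | nu_congr {P P'} : Congr P P' → Congr (.nu P) (.nu P')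
  | tick_congr {P P'} : Congr P P' → Congr (.tick P) (.tick P')
  | case_congr (e) {P P' Q Q'} :
      Congr P P' → Congr Q Q' → Congr (.case e P Q) (.case e P' Q')
  | ann_congr (m) {P P'} : Congr P P' → Congr (.ann m P) (.ann m P')
  -- axioms
  | par_nil (P) : Congr (.par P .nil) P
  | par_comm (P Q) : Congr (.par P Q) (.par Q P)
  | par_assoc (P Q R) : Congr (.par P (.par Q R)) (.par (.par P Q) R)
  | nu_swap (P) : Congr (.nu (.nu P)) (.nu (.nu (P.rename swapRen)))
  | nu_par (P Q) : Congr (.nu (.par P (Q.rename (· + 1)))) (.par (.nu P) Q)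
  | ann_zero (P) : Congr (.ann 0 P) P
  | ann_par (m P Q) : Congr (.ann m (.par P Q)) (.par (.ann m P) (.ann m Q))
  | ann_nu (m P) : Congr (.ann m (.nu P)) (.nu (.ann m P))
  | ann_ann (m n P) : Congr (.ann m (.ann n P)) (.ann (m + n) P)

/-- Parallel reduction of annotated processes. -/
inductive Proc.Red : Proc → Proc → Prop
  | comm (n m a k : ℕ) (P : Proc) (es : List Expr) (Q : Proc) :
      es.length = k → P.SubstDefined (instSub es) →
      Red (.par (.ann n (.inp a k P)) (.ann m (.out a es Q)))
        (.ann (max m n) (.par (P.subst (instSub es)) Q))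
  | comm_rep (n m a k : ℕ) (P : Proc) (es : List Expr) (Q : Proc) :
      es.length = k → P.SubstDefined (instSub es) →
      Red (.par (.ann n (.rep a k P)) (.ann m (.out a es Q)))
        (.par (.ann n (.rep a k P)) (.ann (max m n) (.par (P.subst (instSub es)) Q)))
  | tick (P : Proc) : Red (.tick P) (.ann 1 P)
  | case_zero (P Q : Proc) : Red (.case .zero P Q) P
  | case_succ (e : Expr) (P Q : Proc) :
      Q.SubstDefined (instSub [e]) → Red (.case (.succ e) P Q) (Q.subst (instSub [e]))
  | par {P Q : Proc} (R : Proc) : Red P Q → Red (.par P R) (.par Q R)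
  | nu {P Q : Proc} : Red P Q → Red (.nu P) (.nu Q)
  | ann (n : ℕ) {P Q : Proc} : Red P Q → Red (.ann n P) (.ann n Q)
  | congr {P P' Q' Q : Proc} : Proc.Congr P P' → Red P' Q' → Proc.Congr Q' Q → Red P Q

/-- Local complexity. -/
def Proc.localComplexity : Proc → ℕ
  | .ann n P => n + P.localComplexity
  | .par P Q => max P.localComplexity Q.localComplexity
  | .nu P => P.localComplexity
  | _ => 0

/-- Global parallel complexity (span): the maximal local complexity of a reduct, which is `∞`
when the local complexities of the reducts are unbounded. -/
noncomputable def Proc.span (P : Proc) : ℕ∞ :=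
  sSup {c : ℕ∞ | ∃ Q, Relation.ReflTransGen Proc.Red P Q ∧ c = (Q.localComplexity : ℕ∞)}

/-! ## Indices and constraints

A finite set `φ` of `n` index variables is represented by `Fin n`; adding `k` fresh index
variables leads to `Fin (n + k)`. -/

/-- The function symbols of the language of indices that come in addition to the integer
constants and to `+`, `*`, `-`, `max`, `min`, with their interpretation. -/
structure IndexSig where
  Sym : Type
  arity : Sym → ℕ
  interp : (f : Sym) → (Fin (arity f) → ℕ) → ℕ

/-- The binary function symbols that are always available. -/
inductive BinOp : Type
  | add | mul | sub | max | min

/-- Interpretation of the binary function symbols (subtraction is truncated). -/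
def BinOp.eval : BinOp → ℕ → ℕ → ℕ
  | .add, a, b => a + b
  | .mul, a, b => a * b
  | .sub, a, b => a - b
  | .max, a, b => Max.max a b
  | .min, a, b => Min.min a b

/-- Finite indices over `n` index variables. -/
inductive FinIdx (S : IndexSig) (n : ℕ) : Type
  | var (i : Fin n)
  | const (c : ℕ)
  | op (o : BinOp) (I J : FinIdx S n)
  | app (f : S.Sym) (args : Fin (S.arity f) → FinIdx S n)

/-- Indices: finite indices and `∞`. -/
inductive Idx (S : IndexSig) (n : ℕ) : Type
  | fin (I : FinIdx S n)
  | top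

/-- Interpretation of finite indices under a valuation. -/
def FinIdx.eval {S : IndexSig} {n : ℕ} (ρ : Fin n → ℕ) : FinIdx S n → ℕ
  | .var i => ρ i
  | .const c => c
  | .op o I J => o.eval (I.eval ρ) (J.eval ρ)
  | .app f args => S.interp f (fun j => (args j).eval ρ)

/-- Interpretation of indices in `ℕ ∪ {∞}`. -/
def Idx.eval {S : IndexSig} {n : ℕ} (ρ : Fin n → ℕ) : Idx S n → ℕ∞
  | .fin I => (I.eval ρ : ℕ∞)
  | .top => ⊤

/-- Simultaneous substitution of finite indices for index variables. -/
def FinIdx.subst {S : IndexSig} {n m : ℕ} (σ : Fin n → FinIdx S m) : FinIdx S n → FinIdx S m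
  | .var i => σ i
  | .const c => .const c
  | .op o I J => .op o (I.subst σ) (J.subst σ)
  | .app f args => .app f (fun j => (args j).subst σ)

def Idx.subst {S : IndexSig} {n m : ℕ} (σ : Fin n → FinIdx S m) : Idx S n → Idx S m
  | .fin I => .fin (I.subst σ)
  | .top => .top

/-- The inclusion of `n` index variables into `n + k` index variables. -/
def wk {S : IndexSig} {n : ℕ} (k : ℕ) : Fin n → FinIdx S (n + k) :=
  fun i => .var (Fin.castAdd k i)

/-- The substitution of `Is` for the last `k` index variables. -/
def inst {S : IndexSig} {n k : ℕ} (Is : Fin k → FinIdx S n) : Fin (n + k) → FinIdx S n :=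
  Fin.addCases FinIdx.var Is

/-- The substitution under a binder of `k` index variables. -/
def liftIdx {S : IndexSig} {n m : ℕ} (k : ℕ) (σ : Fin n → FinIdx S m) :
    Fin (n + k) → FinIdx S (m + k) :=
  Fin.addCases (fun i => (σ i).subst (wk k)) (fun j => .var (Fin.natAdd m j))

/-- The index of an integer constant. -/
def Idx.const {S : IndexSig} {n : ℕ} (c : ℕ) : Idx S n := .fin (.const c)

/-- Addition of indices, `∞` being absorbing. -/
def Idx.add {S : IndexSig} {n : ℕ} : Idx S n → Idx S n → Idx S n
  | .fin I, .fin J => .fin (.op .add I J)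
  | _, _ => .top

/-- Maximum of indices, `∞` being absorbing. -/
def Idx.max {S : IndexSig} {n : ℕ} : Idx S n → Idx S n → Idx S n
  | .fin I, .fin J => .fin (.op .max I J)
  | _, _ => .top

/-- `I - 1`, with `∞ - 1 = ∞`. -/
def Idx.pred {S : IndexSig} {n : ℕ} : Idx S n → Idx S n
  | .fin I => .fin (.op .sub I (.const 1))
  | .top => .top

/-- A constraint `I ⋈ J`, where `⋈` is a binary relation on `ℕ ∪ {∞}`. -/
structure Constraint (S : IndexSig) (n : ℕ) where
  lhs : Idx S n
  rel : ℕ∞ → ℕ∞ → Prop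
  rhs : Idx S n

/-- Finite sets of constraints (their order and multiplicity play no role). -/
abbrev Constraints (S : IndexSig) (n : ℕ) := List (Constraint S n)

/-- The valuation `ρ` satisfies `Φ`. -/
def Constraints.Sat {S : IndexSig} {n : ℕ} (Φ : Constraints S n) (ρ : Fin n → ℕ) : Prop :=
  ∀ C ∈ Φ, C.rel (C.lhs.eval ρ) (C.rhs.eval ρ)

/-- `φ;Φ ⊨ p`: every valuation of the index variables that satisfies `Φ` satisfies `p`. -/
def Entails {S : IndexSig} {n : ℕ} (Φ : Constraints S n) (p : (Fin n → ℕ) → Prop) : Prop :=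
  ∀ ρ, Φ.Sat ρ → p ρ

/-- `Φ` over `k` additional index variables. -/
def Constraints.weaken {S : IndexSig} {n : ℕ} (k : ℕ) (Φ : Constraints S n) :
    Constraints S (n + k) :=
  Φ.map fun C => ⟨C.lhs.subst (wk k), C.rel, C.rhs.subst (wk k)⟩

/-! ## Intervals and capacities -/

/-- Intervals `[I, J]`: obligations and complexities. -/
structure Itv (S : IndexSig) (n : ℕ) where
  lo : Idx S n
  hi : Idx S n

/-- Capacities: a single index `J`, understood as `[-∞, J]`, or an interval. -/
inductive Cap (S : IndexSig) (n : ℕ) : Type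
  | upTo (J : Idx S n)
  | itv (A : Itv S n)

/-- The interval `[c, c]`. -/
def Itv.point {S : IndexSig} {n : ℕ} (c : ℕ) : Itv S n := ⟨.const c, .const c⟩

def Itv.subst {S : IndexSig} {n m : ℕ} (σ : Fin n → FinIdx S m) (A : Itv S n) : Itv S m :=
  ⟨A.lo.subst σ, A.hi.subst σ⟩

def Cap.subst {S : IndexSig} {n m : ℕ} (σ : Fin n → FinIdx S m) : Cap S n → Cap S m
  | .upTo J => .upTo (J.subst σ)
  | .itv A => .itv (A.subst σ)

/-- Well-formed intervals: `φ;Φ ⊨ I ≤ J`. -/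
def Itv.WF {S : IndexSig} {n : ℕ} (Φ : Constraints S n) (A : Itv S n) : Prop :=
  Entails Φ fun ρ => A.lo.eval ρ ≤ A.hi.eval ρ

def Cap.WF {S : IndexSig} {n : ℕ} (Φ : Constraints S n) : Cap S n → Prop
  | .upTo _ => True
  | .itv A => A.WF Φ

/-- Inclusion of intervals under a valuation. -/
def Itv.Subset {S : IndexSig} {n : ℕ} (ρ : Fin n → ℕ) (A B : Itv S n) : Prop :=
  B.lo.eval ρ ≤ A.lo.eval ρ ∧ A.hi.eval ρ ≤ B.hi.eval ρ

/-- The relation `I_c ≤ J_c` on capacities under a valuation: inclusion, where a single index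
`J` stands for `[-∞, J]`. -/
def Cap.Le {S : IndexSig} {n : ℕ} (ρ : Fin n → ℕ) : Cap S n → Cap S n → Prop
  | .upTo I, .upTo J => I.eval ρ ≤ J.eval ρ
  | .itv A, .upTo J => A.hi.eval ρ ≤ J.eval ρ
  | .upTo _, .itv _ => False
  | .itv A, .itv B => A.Subset ρ B

/-- `[I,J] + [I',J'] = [I+I', J+J']`. -/
def Itv.add {S : IndexSig} {n : ℕ} (A B : Itv S n) : Itv S n :=
  ⟨A.lo.add B.lo, A.hi.add B.hi⟩

/-- `[I,J] ⊔ [I',J'] = [max(I,I'), max(J,J')]`. -/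
def Itv.sup {S : IndexSig} {n : ℕ} (A B : Itv S n) : Itv S n :=
  ⟨A.lo.max B.lo, A.hi.max B.hi⟩

/-- `A_o + J_c`. -/
def Itv.addCap {S : IndexSig} {n : ℕ} (A : Itv S n) : Cap S n → Itv S n
  | .upTo J => ⟨A.lo, A.hi.add J⟩
  | .itv B => A.add B

/-- `A_o ⊕ J_c`. -/
def Itv.oplus {S : IndexSig} {n : ℕ} (A : Itv S n) : Cap S n → Itv S n
  | .upTo J => ⟨.const 0, A.lo.add J⟩
  | .itv B => ⟨A.hi.add B.lo, A.lo.add B.hi⟩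

/-- `J_c ; K`. On a well-formed capacity an infinite lower bound means `J_c = [∞,∞]`. -/
def Cap.seq {S : IndexSig} {n : ℕ} (K : Itv S n) : Cap S n → Itv S n
  | .upTo J => ⟨.const 0, J.add K.hi⟩
  | .itv ⟨.top, _⟩ => .point 0
  | .itv ⟨.fin _, J⟩ => ⟨.const 0, J.add K.hi⟩

/-! ## Usages -/

/-- Input or output. -/
inductive Pol : Type
  | inp | out

inductive Usage (S : IndexSig) (n : ℕ) : Type
  | zero
  | par (U V : Usage S n)
  /-- `α^{A}_{J}.U` -/
  | act (α : Pol) (A : Itv S n) (J : Cap S n) (U : Usage S n)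
  | bang (U : Usage S n)
  | choice (U V : Usage S n)

def Usage.subst {S : IndexSig} {n m : ℕ} (σ : Fin n → FinIdx S m) : Usage S n → Usage S m
  | .zero => .zero
  | .par U V => .par (U.subst σ) (V.subst σ)
  | .act α A J U => .act α (A.subst σ) (J.subst σ) (U.subst σ)
  | .bang U => .bang (U.subst σ)
  | .choice U V => .choice (U.subst σ) (V.subst σ)

/-- All intervals of the usage are well formed. -/
def Usage.WF {S : IndexSig} {n : ℕ} (Φ : Constraints S n) : Usage S n → Prop
  | .zero => True
  | .par U V => U.WF Φ ∧ V.WF Φ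
  | .act _ A J U => A.WF Φ ∧ J.WF Φ ∧ U.WF Φ
  | .bang U => U.WF Φ
  | .choice U V => U.WF Φ ∧ V.WF Φ

/-- Application of `f` to the obligations of the outermost actions. -/
def Usage.mapObligation {S : IndexSig} {n : ℕ} (f : Itv S n → Itv S n) :
    Usage S n → Usage S n
  | .zero => .zero
  | .par U V => .par (U.mapObligation f) (V.mapObligation f)
  | .act α A J U => .act α (f A) J U
  | .bang U => .bang (U.mapObligation f)
  | .choice U V => .choice (U.mapObligation f) (V.mapObligation f)

/-- The delaying `↑^A U`. -/
def Usage.delay {S : IndexSig} {n : ℕ} (A : Itv S n) (U : Usage S n) : Usage S n :=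
  U.mapObligation fun B => A.add B

/-- The delaying `↑^{J_c} U`. -/
def Usage.delayCap {S : IndexSig} {n : ℕ} (J : Cap S n) (U : Usage S n) : Usage S n :=
  U.mapObligation fun B => B.addCap J

/-- Congruence `U ≡ V` of usages. -/
inductive Usage.Congr {S : IndexSig} {n : ℕ} : Usage S n → Usage S n → Prop
  | refl (U) : Congr U U
  | symm {U V} : Congr U V → Congr V U
  | trans {U V W} : Congr U V → Congr V W → Congr U W
  -- compatibility with the constructors
  | par_congr {U U' V V'} : Congr U U' → Congr V V' → Congr (.par U V) (.par U' V')
  | act_congr (α A J) {U U'} : Congr U U' → Congr (.act α A J U) (.act α A J U')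
  | bang_congr {U U'} : Congr U U' → Congr (.bang U) (.bang U')
  | choice_congr {U U' V V'} : Congr U U' → Congr V V' → Congr (.choice U V) (.choice U' V')
  -- axioms
  | par_zero (U) : Congr (.par U .zero) U
  | par_comm (U V) : Congr (.par U V) (.par V U)
  | par_assoc (U V W) : Congr (.par U (.par V W)) (.par (.par U V) W)
  | bang_zero : Congr (.bang .zero) .zero
  | bang_unfold (U) : Congr (.bang U) (.par (.bang U) U)
  | bang_par (U V) : Congr (.bang (.par U V)) (.par (.bang U) (.bang V))
  | bang_bang (U) : Congr (.bang (.bang U)) (.bang U)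

/-- Reduction of usages under `φ;Φ`. The result `none` is the error. -/
inductive Usage.Red {S : IndexSig} {n : ℕ} (Φ : Constraints S n) :
    Usage S n → Option (Usage S n) → Prop
  | comm (A B : Itv S n) (I J : Cap S n) (U V : Usage S n) :
      (Entails Φ fun ρ => B.Subset ρ (A.oplus I)) →
      (Entails Φ fun ρ => A.Subset ρ (B.oplus J)) →
      Red Φ (.par (.act .inp A I U) (.act .out B J V))
        (some ((Usage.par U V).delay (A.sup B)))
  | comm_error (A B : Itv S n) (I J : Cap S n) (U V : Usage S n) :
      (¬ Entails Φ fun ρ => B.Subset ρ (A.oplus I) ∧ A.Subset ρ (B.oplus J)) →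
      Red Φ (.par (.act .inp A I U) (.act .out B J V)) none
  | choice_left (U V : Usage S n) : Red Φ (.choice U V) (some U)
  | choice_right (U V : Usage S n) : Red Φ (.choice U V) (some V)
  | par {U U' : Usage S n} (V : Usage S n) :
      Red Φ U (some U') → Red Φ (.par U V) (some (.par U' V))
  | par_error {U : Usage S n} (V : Usage S n) : Red Φ U none → Red Φ (.par U V) none
  | congr {U U' V' V : Usage S n} :
      Usage.Congr U U' → Red Φ U' (some V') → Usage.Congr V' V → Red Φ U (some V)
  | congr_error {U U' : Usage S n} : Usage.Congr U U' → Red Φ U' none → Red Φ U none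

/-- A usage is reliable under `φ;Φ` when no reduction from it leads to an error. -/
def Usage.Reliable {S : IndexSig} {n : ℕ} (Φ : Constraints S n) (U : Usage S n) : Prop :=
  ∀ V, Relation.ReflTransGen (fun U₁ U₂ => Usage.Red Φ U₁ (some U₂)) U V →
    ¬ Usage.Red Φ V none

/-- Subusage `φ;Φ ⊢ U ⊑ V`. The premises about `WF` reflect that only usages with well-formed
intervals are considered: with them, `V` is well formed whenever `U` is. -/
inductive SubUsage {S : IndexSig} {n : ℕ} (Φ : Constraints S n) :
    Usage S n → Usage S n → Prop
  | zero (U) : SubUsage Φ U .zero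
  | choice_left (U V) : SubUsage Φ (.choice U V) U
  | choice_right (U V) : SubUsage Φ (.choice U V) V
  | choice_congr_left {U U'} (V) : SubUsage Φ U U' → SubUsage Φ (.choice U V) (.choice U' V)
  | choice_congr_right (U) {V V'} : SubUsage Φ V V' → SubUsage Φ (.choice U V) (.choice U V')
  | par_congr {U U'} (V) : SubUsage Φ U U' → SubUsage Φ (.par U V) (.par U' V)
  | bang_congr {U U'} : SubUsage Φ U U' → SubUsage Φ (.bang U) (.bang U')
  | congr {U U' V' V} :
      Usage.Congr U U' → SubUsage Φ U' V' → Usage.Congr V V' → SubUsage Φ U V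
  | trans {U U' U''} : SubUsage Φ U U' → SubUsage Φ U' U'' → SubUsage Φ U U''
  | act_congr (α A J) {U U'} : SubUsage Φ U U' → SubUsage Φ (.act α A J U) (.act α A J U')
  | act (α : Pol) (A B : Itv S n) (I J : Cap S n) (U : Usage S n) :
      B.WF Φ → J.WF Φ →
      (Entails Φ fun ρ => B.Subset ρ A) → (Entails Φ fun ρ => I.Le ρ J) →
      SubUsage Φ (.act α A I U) (.act α B J U)
  | guard (α : Pol) (A : Itv S n) (J : Cap S n) (U V : Usage S n) :
      V.WF Φ →
      SubUsage Φ (.par (.act α A J U) (V.delay (A.addCap J))) (.act α A J (.par U V))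

/-! ## Types and contexts -/

/-- Types over `n` index variables. -/
inductive Ty (S : IndexSig) : ℕ → Type
  /-- `Nat[I,J]` -/
  | nat {n : ℕ} (I J : Idx S n) : Ty S n
  /-- the channel type `ch(T₁,…,Tₘ)/U` -/
  | chan {n : ℕ} (m : ℕ) (T : Fin m → Ty S n) (U : Usage S n) : Ty S n
  /-- the server type `∀ i₁,…,iₖ. serv^K(T₁,…,Tₘ)/U`, where `i₁,…,iₖ` are bound in `K` and
  in the `Tⱼ` -/
  | serv {n : ℕ} (k m : ℕ) (K : Itv S (n + k)) (T : Fin m → Ty S (n + k)) (U : Usage S n) :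
      Ty S n

def Ty.subst {S : IndexSig} : {n : ℕ} → Ty S n → {m : ℕ} → (Fin n → FinIdx S m) → Ty S m
  | _, .nat I J, _, σ => .nat (I.subst σ) (J.subst σ)
  | _, .chan r T U, _, σ => .chan r (fun j => (T j).subst σ) (U.subst σ)
  | _, .serv k r K T U, _, σ =>
      .serv k r (K.subst (liftIdx k σ)) (fun j => (T j).subst (liftIdx k σ)) (U.subst σ)

/-- All intervals of the type are well formed. -/
def Ty.WF {S : IndexSig} : {n : ℕ} → Constraints S n → Ty S n → Prop
  | _, Φ, .nat I J => (Itv.mk I J).WF Φ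
  | _, Φ, .chan _ T U => (∀ j, (T j).WF Φ) ∧ U.WF Φ
  | _, Φ, .serv k _ K T U =>
      K.WF (Φ.weaken k) ∧ (∀ j, (T j).WF (Φ.weaken k)) ∧ U.WF Φ

/-- Subtyping. -/
inductive SubTy {S : IndexSig} : {n : ℕ} → Constraints S n → Ty S n → Ty S n → Prop
  | nat {n : ℕ} {Φ : Constraints S n} {I J I' J' : Idx S n} :
      (Entails Φ fun ρ => I'.eval ρ ≤ I.eval ρ) →
      (Entails Φ fun ρ => J.eval ρ ≤ J'.eval ρ) →
      SubTy Φ (.nat I J) (.nat I' J')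
  | chan {n m : ℕ} {Φ : Constraints S n} {T T' : Fin m → Ty S n} {U V : Usage S n} :
      (∀ j, SubTy Φ (T j) (T' j)) → (∀ j, SubTy Φ (T' j) (T j)) → SubUsage Φ U V →
      SubTy Φ (.chan m T U) (.chan m T' V)
  | serv {n k m : ℕ} {Φ : Constraints S n} {K K' : Itv S (n + k)}
      {T T' : Fin m → Ty S (n + k)} {U V : Usage S n} :
      (∀ j, SubTy (Φ.weaken k) (T j) (T' j)) → (∀ j, SubTy (Φ.weaken k) (T' j) (T j)) →
      (Entails (Φ.weaken k) fun ρ =>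
        K.lo.eval ρ = K'.lo.eval ρ ∧ K.hi.eval ρ = K'.hi.eval ρ) →
      SubUsage Φ U V →
      SubTy Φ (.serv k m K T U) (.serv k m K' T' V)

/-- Application of `f` to the usage of a channel or server type. -/
def Ty.mapUsage {S : IndexSig} {n : ℕ} (f : Usage S n → Usage S n) : Ty S n → Ty S n
  | .nat I J => .nat I J
  | .chan m T U => .chan m T (f U)
  | .serv k m K T U => .serv k m K T (f U)

/-- `↑^A T` -/
def Ty.delay {S : IndexSig} {n : ℕ} (A : Itv S n) (T : Ty S n) : Ty S n :=
  T.mapUsage (Usage.delay A)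

/-- `↑^{J_c} T` -/
def Ty.delayCap {S : IndexSig} {n : ℕ} (J : Cap S n) (T : Ty S n) : Ty S n :=
  T.mapUsage (Usage.delayCap J)

/-- `!T` -/
def Ty.bang {S : IndexSig} {n : ℕ} (T : Ty S n) : Ty S n :=
  T.mapUsage Usage.bang

/-- The partial operation `T | T'`, as its graph: `T | T'` is defined and equal to `T''`. -/
inductive Ty.Par {S : IndexSig} : {n : ℕ} → Ty S n → Ty S n → Ty S n → Prop
  | nat {n : ℕ} (I J : Idx S n) : Ty.Par (.nat I J) (.nat I J) (.nat I J)
  | chan {n : ℕ} (m : ℕ) (T : Fin m → Ty S n) (U V : Usage S n) :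
      Ty.Par (.chan m T U) (.chan m T V) (.chan m T (.par U V))
  | serv {n : ℕ} (k m : ℕ) (K : Itv S (n + k)) (T : Fin m → Ty S (n + k)) (U V : Usage S n) :
      Ty.Par (.serv k m K T U) (.serv k m K T V) (.serv k m K T (.par U V))

/-- Integer types. -/
def Ty.IsNat {S : IndexSig} {n : ℕ} : Ty S n → Prop
  | .nat _ _ => True
  | _ => False

/-- Reliable types. -/
def Ty.Reliable {S : IndexSig} {n : ℕ} (Φ : Constraints S n) : Ty S n → Prop
  | .nat _ _ => True
  | .chan _ _ U => U.Reliable Φ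
  | .serv _ _ _ _ U => U.Reliable Φ

/-- Typing contexts: the type of the variable `x` is the entry number `x`. -/
abbrev Ctx (S : IndexSig) (n : ℕ) := List (Ty S n)

def Ctx.WF {S : IndexSig} {n : ℕ} (Φ : Constraints S n) (Γ : Ctx S n) : Prop :=
  ∀ T ∈ Γ, T.WF Φ

/-- Pointwise subtyping of contexts with the same variables. -/
def SubCtx {S : IndexSig} {n : ℕ} (Φ : Constraints S n) (Γ Δ : Ctx S n) : Prop :=
  List.Forall₂ (SubTy Φ) Γ Δ

/-- The partial operation `Γ | Δ`, as its graph. -/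
inductive Ctx.Par {S : IndexSig} {n : ℕ} : Ctx S n → Ctx S n → Ctx S n → Prop
  | nil : Ctx.Par [] [] []
  | cons {T T' T'' : Ty S n} {Γ Δ Θ : Ctx S n} :
      T.Par T' T'' → Ctx.Par Γ Δ Θ → Ctx.Par (T :: Γ) (T' :: Δ) (T'' :: Θ)

/-! ## Typing

Only judgements all of whose intervals are well formed are considered; the premises about `WF`
guarantee this. -/

/-- `φ;Φ;Γ ⊢ e : T` -/
inductive ExprTyped {S : IndexSig} {n : ℕ} (Φ : Constraints S n) :
    Ctx S n → Expr → Ty S n → Prop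
  | var {Γ : Ctx S n} {x : ℕ} {T : Ty S n} :
      Γ.WF Φ → Γ[x]? = some T → ExprTyped Φ Γ (.var x) T
  | zero {Γ : Ctx S n} : Γ.WF Φ → ExprTyped Φ Γ .zero (.nat (.const 0) (.const 0))
  | succ {Γ : Ctx S n} {e : Expr} {I J : Idx S n} :
      ExprTyped Φ Γ e (.nat I J) →
      ExprTyped Φ Γ (.succ e) (.nat (I.add (.const 1)) (J.add (.const 1)))
  | sub {Γ Δ : Ctx S n} {e : Expr} {T T' : Ty S n} :
      Γ.WF Φ → ExprTyped Φ Δ e T' → SubCtx Φ Γ Δ → SubTy Φ T' T → ExprTyped Φ Γ e T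

/-- `φ;Φ;Γ ⊢ e₁,…,eₘ : T₁,…,Tₘ`: the context is split among the components of the tuple. -/
inductive TupleTyped {S : IndexSig} {n : ℕ} (Φ : Constraints S n) :
    Ctx S n → List Expr → List (Ty S n) → Prop
  | nil {Γ : Ctx S n} : Γ.WF Φ → TupleTyped Φ Γ [] []
  | cons {Γ Δ Θ : Ctx S n} {e : Expr} {T : Ty S n} {es : List Expr} {Ts : List (Ty S n)} :
      ExprTyped Φ Γ e T → TupleTyped Φ Δ es Ts → Ctx.Par Γ Δ Θ →
      TupleTyped Φ Θ (e :: es) (T :: Ts)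

/-- `φ;Φ;Γ ⊢ P ◁ K`. A context written `Γ, a : T` on paper is here a context whose entry
number `a` is `T`. -/
inductive Typed {S : IndexSig} : {n : ℕ} → Constraints S n → Ctx S n → Proc → Itv S n → Prop
  | nil {n : ℕ} {Φ : Constraints S n} {Γ : Ctx S n} :
      Γ.WF Φ → Typed Φ Γ .nil (.point 0)
  | par {n : ℕ} {Φ : Constraints S n} {Γ Δ Θ : Ctx S n} {P Q : Proc} {K₁ K₂ : Itv S n} :
      Typed Φ Γ P K₁ → Typed Φ Δ Q K₂ → Ctx.Par Γ Δ Θ →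
      Typed Φ Θ (.par P Q) (K₁.sup K₂)
  | tick {n : ℕ} {Φ : Constraints S n} {Γ : Ctx S n} {P : Proc} {K : Itv S n} :
      Typed Φ Γ P K → Typed Φ (Γ.map (Ty.delay (.point 1))) (.tick P) (K.add (.point 1))
  | ann {n : ℕ} {Φ : Constraints S n} {Γ : Ctx S n} {P : Proc} {K : Itv S n} (m : ℕ) :
      Typed Φ Γ P K → Typed Φ (Γ.map (Ty.delay (.point m))) (.ann m P) (K.add (.point m))
  | ich {n : ℕ} {Φ : Constraints S n} {Γ : Ctx S n} {a m : ℕ} {T : Fin m → Ty S n}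
      {U : Usage S n} {J : Cap S n} {P : Proc} {K : Itv S n} :
      J.WF Φ → Γ[a]? = some (.chan m T U) →
      Typed Φ (List.ofFn T ++ Γ) P K →
      Typed Φ ((Γ.map (Ty.delayCap J)).set a (.chan m T (.act .inp (.point 0) J U)))
        (.inp a m P) (J.seq K)
  | iserv {n : ℕ} {Φ : Constraints S n} {Γ : Ctx S n} {a k m : ℕ} {K : Itv S (n + k)}
      {T : Fin m → Ty S (n + k)} {U : Usage S n} {J : Cap S n} {P : Proc} :
      J.WF Φ → Γ[a]? = some (.serv k m K T U) →
      Typed (Φ.weaken k) (List.ofFn T ++ Γ.map (fun T' => T'.subst (wk k))) P K →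
      Typed Φ ((Γ.map (fun T' => T'.bang.delayCap J)).set a
          (.serv k m K T (.bang (.act .inp (.point 0) J U))))
        (.rep a m P) (.point 0)
  | och {n : ℕ} {Φ : Constraints S n} {Γ Γ' Θ : Ctx S n} {a m : ℕ} {T : Fin m → Ty S n}
      {U V : Usage S n} {J : Cap S n} {es : List Expr} {P : Proc} {K : Itv S n} :
      J.WF Φ → Γ'[a]? = some (.chan m T V) → TupleTyped Φ Γ' es (List.ofFn T) →
      Γ[a]? = some (.chan m T U) → Typed Φ Γ P K → Ctx.Par Γ Γ' Θ →
      Typed Φ ((Θ.map (Ty.delayCap J)).set a (.chan m T (.act .out (.point 0) J (.par V U))))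
        (.out a es P) (J.seq K)
  | oserv {n : ℕ} {Φ : Constraints S n} {Γ Γ' Θ : Ctx S n} {a k m : ℕ} {K : Itv S (n + k)}
      {T : Fin m → Ty S (n + k)} {U V : Usage S n} {J : Cap S n} {es : List Expr} {P : Proc}
      {K' : Itv S n} (Is : Fin k → FinIdx S n) :
      J.WF Φ → Γ'[a]? = some (.serv k m K T V) →
      TupleTyped Φ Γ' es (List.ofFn fun j => (T j).subst (inst Is)) →
      Γ[a]? = some (.serv k m K T U) → Typed Φ Γ P K' → Ctx.Par Γ Γ' Θ →
      Typed Φ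
        ((Θ.map (Ty.delayCap J)).set a (.serv k m K T (.act .out (.point 0) J (.par V U))))
        (.out a es P) (J.seq (K'.sup (K.subst (inst Is))))
  | case {n : ℕ} {Φ : Constraints S n} {Γ : Ctx S n} {e : Expr} {I J : Idx S n}
      {P Q : Proc} {K : Itv S n} :
      ExprTyped Φ Γ e (.nat I J) →
      Typed (⟨I, fun x y => x ≤ y, .const 0⟩ :: Φ) Γ P K →
      Typed (⟨J, fun x y => x ≥ y, .const 1⟩ :: Φ) (.nat I.pred J.pred :: Γ) Q K →
      Typed Φ Γ (.case e P Q) K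
  | nu {n : ℕ} {Φ : Constraints S n} {Γ : Ctx S n} {T : Ty S n} {P : Proc} {K : Itv S n} :
      ¬ T.IsNat → T.Reliable Φ → Typed Φ (T :: Γ) P K → Typed Φ Γ (.nu P) K
  | sub {n : ℕ} {Φ : Constraints S n} {Γ Δ : Ctx S n} {P : Proc} {K K' : Itv S n} :
      Γ.WF Φ → Typed Φ Δ P K → SubCtx Φ Γ Δ → (Entails Φ fun ρ => K.Subset ρ K') →
      Typed Φ Γ P K'

end PiUsage

open PiUsage

/-! Both bounds are proved at a fixed valuation `ρ` of the index variables that satisfies `Φ`.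

Upper bound. A usage is replaced by its behaviour: the finite multisets of actions that it can offer
(`RU.offers`). Such a multiset is `Bad` when communications inside it can reach two complementary
actions that disagree on their timing. The order `U ≤ V` says that whenever `V`, after some delay
and beside some other actions, can go wrong, so can `U` in the same situation. All subusage axioms
hold for this order (`RU.act_par_delay_le` is the one that moves a delayed usage under an action),
and so does communication itself (`RU.comm_le`). Modulo the induced equivalence, usages form an
ordered commutative monoid `SU` with greatest element `0`.

The consequence is a subject reduction in which the context stays fixed: the usage before a
communication is already below the usage after it, so the context that types a process also types
its reducts. The predicate `Sem` is a typing over `SU` that records only the upper end of the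
complexity and has subsumption built in. It is invariant under congruence (`Proc.Congr.sem_eq`),
stable under substitution (`Sem.subst`) and preserved by reduction when all usages are safe
(`Proc.Red.sem`). Safety makes the two ends of a communication agree; agreement places the time
`max(m,n)` within each end's own time plus its capacity, so the bound of the prefix covers the
delayed continuation. The bound of `Sem` dominates the local complexity of every reduct, hence the
span. Syntactic derivations are interpreted by `Typed.sound`, and reliable usages are safe because a
derivation of `Bad` can be replayed by usage reductions (`Bad.not_reliable`).

Lower bound. The interval `J_c;K` always starts at `0`, so only ticks, annotations and pattern
matchings outside prefixes count. After replacing integer variables by numerals of their intervals,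
every such matching is decided, and executing ticks and matchings reaches the lower bound
(`Typed.exists_lo_le`). In a context without integer types the identity substitution is admissible.
-/

namespace PiUsage

/-! ## Semantic usages

The syntax of usages is interpreted at a fixed valuation of the index variables. -/

/-- Intervals of `ℕ∞`. -/
@[ext] structure SItv where
  lo : ℕ∞
  hi : ℕ∞
  le : lo ≤ hi

namespace SItv

instance : Zero SItv := ⟨⟨0, 0, le_rfl⟩⟩
instance : Add SItv := ⟨fun A B => ⟨A.lo + B.lo, A.hi + B.hi, add_le_add A.le B.le⟩⟩

@[simp] lemma zero_lo : (0 : SItv).lo = 0 := rfl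
@[simp] lemma zero_hi : (0 : SItv).hi = 0 := rfl
@[simp] lemma add_lo (A B : SItv) : (A + B).lo = A.lo + B.lo := rfl
@[simp] lemma add_hi (A B : SItv) : (A + B).hi = A.hi + B.hi := rfl

instance : AddCommMonoid SItv where
  add_assoc A B C := by ext <;> simp [add_assoc]
  zero_add A := by ext <;> simp
  add_zero A := by ext <;> simp
  add_comm A B := by ext <;> simp [add_comm]
  nsmul := nsmulRec

/-- `[max(I,I'), max(J,J')]` -/
noncomputable def sup (A B : SItv) : SItv := ⟨max A.lo B.lo, max A.hi B.hi, max_le_max A.le B.le⟩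

lemma add_sup (D A B : SItv) : D + A.sup B = (D + A).sup (D + B) := by
  ext <;> simp [sup, max_add_add_left]

/-- Inclusion. -/
def Sub (A B : SItv) : Prop := B.lo ≤ A.lo ∧ A.hi ≤ B.hi

lemma Sub.refl (A : SItv) : A.Sub A := ⟨le_rfl, le_rfl⟩

lemma Sub.add {A A' B B' : SItv} (h : A.Sub A') (h' : B.Sub B') : (A + B).Sub (A' + B') :=
  ⟨add_le_add h.1 h'.1, add_le_add h.2 h'.2⟩

lemma Sub.sup {A A' B B' : SItv} (h : A.Sub A') (h' : B.Sub B') : (A.sup B).Sub (A'.sup B') :=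
  ⟨max_le_max h.1 h'.1, max_le_max h.2 h'.2⟩

/-- `[c, c]` -/
def pt (c : ℕ) : SItv := ⟨c, c, le_rfl⟩

@[simp] lemma pt_zero : pt 0 = 0 := by ext <;> simp [pt]

lemma pt_add (m n : ℕ) : pt m + pt n = pt (m + n) := by ext <;> simp [pt]

lemma pt_sup (m n : ℕ) : (pt m).sup (pt n) = pt (max m n) := by
  ext <;> exact ((Nat.mono_cast (α := ℕ∞)).map_max).symm

end SItv

/-- Capacities with values in `ℕ∞`. -/
inductive SCap
  | upTo (J : ℕ∞)
  | itv (A : SItv)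

namespace SCap

/-- Inclusion. -/
def Le : SCap → SCap → Prop
  | .upTo I, .upTo J => I ≤ J
  | .itv A, .upTo J => A.hi ≤ J
  | .upTo _, .itv _ => False
  | .itv A, .itv B => A.Sub B

lemma Le.refl : ∀ I : SCap, I.Le I
  | .upTo _ => le_refl _
  | .itv A => SItv.Sub.refl A

/-- The interval that delays by the capacity. -/
def toItv : SCap → SItv
  -- A bare index delays only the upper end, as in `[I,J] + J' = [I,J+J']`.
  | .upTo J => ⟨0, J, zero_le⟩
  | .itv A => A

/-- Upper bound of `J_c ; K`. -/
noncomputable def seq : SCap → ℕ∞ → ℕ∞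
  | .upTo J, K => J + K
  -- An infinite lower end forces the capacity `[∞,∞]`, whose sequencing is `[0,0]`.
  | .itv A, K => open Classical in if A.lo = ⊤ then 0 else A.hi + K

/-- `B ⊆ A ⊕ J_c` -/
def Compat (A B : SItv) : SCap → Prop
  | .upTo J => B.hi ≤ A.lo + J
  | .itv C => A.hi + C.lo ≤ B.lo ∧ B.hi ≤ A.lo + C.hi

/-- Shrinking `A` and enlarging the capacity widen `A ⊕ J_c`, and shrinking `B` helps as well. Read
contrapositively: a disagreement survives wider obligations and smaller capacities. -/
lemma Compat.mono {A A' B B' : SItv} {I I' : SCap} (hA : A.Sub A') (hB : B.Sub B')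
    (hI : I'.Le I) (h : I'.Compat A' B') : I.Compat A B := by
  cases I with
  | upTo J =>
    cases I' with
    | upTo J' => exact hB.2.trans (h.trans (add_le_add hA.1 hI))
    | itv C => exact hB.2.trans (h.2.trans (add_le_add hA.1 hI))
  | itv C =>
    cases I' with
    | upTo J' => exact hI.elim
    | itv C' =>
      exact ⟨(add_le_add hA.2 hI.1).trans (h.1.trans hB.1),
        hB.2.trans (h.2.trans (add_le_add hA.1 hI.2))⟩

/-- The time of a communication stays within the delay `A + J_c` that an action imposes on whatever
it guards. This inequality supports the guard axiom, the typing of the reduct and the complexity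
bound. -/
lemma Compat.sup_sub {A B : SItv} {I : SCap} (h : I.Compat A B) :
    (A.sup B).Sub (A + I.toItv) := by
  cases I with
  | upTo J =>
    refine ⟨?_, max_le ?_ ?_⟩
    · simp [toItv, SItv.sup]
    · exact le_self_add
    · exact h.trans (add_le_add A.le le_rfl)
  | itv C =>
    refine ⟨?_, max_le ?_ ?_⟩
    · exact ((add_le_add A.le le_rfl).trans h.1).trans (le_max_right _ _)
    · exact le_self_add
    · exact h.2.trans (add_le_add A.le le_rfl)

/-- A finite constant cancels on both sides of every inequality in `ℕ∞`. -/
lemma compat_pt_add (p : ℕ) (A B : SItv) (I : SCap) :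
    I.Compat (SItv.pt p + A) (SItv.pt p + B) ↔ I.Compat A B := by
  have hp : (p : ℕ∞) ≠ ⊤ := ENat.natCast_ne_top p
  cases I <;> simp [Compat, SItv.pt, add_assoc, ENat.add_le_add_iff_left hp]

end SCap

/-! ### Usages at a valuation and the actions they offer. -/

/-- Usages with values in `ℕ∞`. -/
inductive RU : Type
  | zero
  | par (U V : RU)
  | act (α : Pol) (A : SItv) (J : SCap) (U : RU)
  | bang (U : RU)
  | choice (U V : RU)

/-- An outermost action of a usage. -/
@[ext] structure Atom where
  pol : Pol
  ob : SItv
  cap : SCap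
  cont : RU

/-- Delaying of actions. -/
def Atom.delay (D : SItv) (a : Atom) : Atom := { a with ob := D + a.ob }

/-- Delaying of finite collections of actions. -/
def delayM (D : SItv) : Multiset Atom →+ Multiset Atom := Multiset.mapAddMonoidHom (Atom.delay D)

lemma delayM_cons (D : SItv) (a : Atom) (m : Multiset Atom) :
    delayM D (a ::ₘ m) = a.delay D ::ₘ delayM D m := Multiset.map_cons _ _ _

lemma delayM_singleton (D : SItv) (a : Atom) :
    delayM D {a} = {a.delay D} := Multiset.map_singleton _ _

lemma delayM_delayM (D E : SItv) (m : Multiset Atom) :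
    delayM D (delayM E m) = delayM (D + E) m := by
  simp only [delayM, Multiset.mapAddMonoidHom_apply, Multiset.map_map]
  exact Multiset.map_congr rfl fun a _ => by simp [Atom.delay, add_assoc]

lemma delayM_zero (m : Multiset Atom) : delayM 0 m = m :=
  (Multiset.map_congr rfl fun a _ => by simp [Atom.delay]).trans (Multiset.map_id m)

namespace RU

/-- The collections of outermost actions offered by a usage, once the choices are resolved and the
replications are unfolded. -/
def offers : RU → Set (Multiset Atom)
  | .zero => {0}
  | .par U V => {w | ∃ u ∈ U.offers, ∃ v ∈ V.offers, u + v = w}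
  -- An action may be withheld, so `0` is always among the offers.
  | .act α A J U => {0, {⟨α, A, J, U⟩}}
  -- Finite sums: finitely many copies, each resolving its choices on its own.
  | .bang U => (AddSubmonoid.closure U.offers : Set (Multiset Atom))
  | .choice U V => U.offers ∪ V.offers

/-- The delaying `↑^D U`. -/
def delay (D : SItv) : RU → RU
  | .zero => .zero
  | .par U V => .par (U.delay D) (V.delay D)
  | .act α A J U => .act α (D + A) J U
  | .bang U => .bang (U.delay D)
  | .choice U V => .choice (U.delay D) (V.delay D)

lemma zero_mem_offers : ∀ U : RU, 0 ∈ U.offers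
  | .zero => rfl
  | .par U V => ⟨0, U.zero_mem_offers, 0, V.zero_mem_offers, rfl⟩
  | .act _ _ _ _ => Or.inl rfl
  | .bang U => (AddSubmonoid.closure U.offers).zero_mem
  | .choice U _ => Or.inl U.zero_mem_offers

lemma offers_delay (D : SItv) : ∀ U : RU, (U.delay D).offers = delayM D '' U.offers
  | .zero => by simp [delay, offers]
  | .par U V => by
    ext w
    simp only [delay, offers, offers_delay D U, offers_delay D V, Set.mem_ofPred_eq, Set.mem_image]
    constructor
    · rintro ⟨_, ⟨u, hu, rfl⟩, _, ⟨v, hv, rfl⟩, rfl⟩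
      exact ⟨_, ⟨u, hu, v, hv, rfl⟩, map_add _ _ _⟩
    · rintro ⟨_, ⟨u, hu, v, hv, rfl⟩, rfl⟩
      exact ⟨_, ⟨u, hu, rfl⟩, _, ⟨v, hv, rfl⟩, (map_add _ _ _).symm⟩
  | .act α A J U => by
    simp [delay, offers, Set.image_insert_eq, delayM_singleton, Atom.delay]
  | .bang U => by
    simp only [delay, offers, offers_delay D U]
    rw [← AddMonoidHom.map_mclosure]
    rfl
  | .choice U V => by
    simp only [delay, offers, offers_delay D U, offers_delay D V, Set.image_union]

end RU

/-! ### Reachable timing errors. -/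

/-- Two complementary actions agree on the time of their communication. -/
def Agree (A B : SItv) (I J : SCap) : Prop := I.Compat A B ∧ J.Compat B A

/-- An error is reachable from the given collection of actions. -/
inductive Bad : Multiset Atom → Prop
  | error (A B : SItv) (I J : SCap) (U V : RU) (m : Multiset Atom) :
      ¬ Agree A B I J → Bad (⟨.inp, A, I, U⟩ ::ₘ ⟨.out, B, J, V⟩ ::ₘ m)
  -- No agreement is asked of the two actions: if they disagree, the conclusion already holds by
  -- `error`. Any communication may thus be taken, which makes `RU.comm_le` unconditional.
  | comm (A B : SItv) (I J : SCap) (U V : RU) (x y m : Multiset Atom) :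
      x ∈ U.offers → y ∈ V.offers →
      Bad (delayM (A.sup B) x + delayM (A.sup B) y + m) →
      Bad (⟨.inp, A, I, U⟩ ::ₘ ⟨.out, B, J, V⟩ ::ₘ m)

lemma not_bad_zero : ¬ Bad 0 := by
  intro h
  generalize hm : (0 : Multiset Atom) = m at h
  cases h <;> exact Multiset.zero_ne_cons hm

/-- `b` has a wider obligation and a smaller capacity than `a`. -/
def Atom.Wider (a b : Atom) : Prop :=
  b.pol = a.pol ∧ b.cont = a.cont ∧ a.ob.Sub b.ob ∧ b.cap.Le a.cap

lemma Atom.Wider.refl (a : Atom) : a.Wider a := ⟨rfl, rfl, SItv.Sub.refl _, SCap.Le.refl _⟩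

lemma Atom.Wider.exists_eq {α : Pol} {A : SItv} {I : SCap} {U : RU} {b : Atom}
    (h : Atom.Wider ⟨α, A, I, U⟩ b) : ∃ A' I', b = ⟨α, A', I', U⟩ ∧ A.Sub A' ∧ I'.Le I := by
  obtain ⟨h1, h2, h3, h4⟩ := h
  exact ⟨b.ob, b.cap, by ext1 <;> first | exact h1 | exact h2 | rfl, h3, h4⟩

lemma rel_wider_refl (m : Multiset Atom) : Multiset.Rel Atom.Wider m m :=
  Multiset.rel_refl_of_refl_on fun a _ => Atom.Wider.refl a

lemma rel_wider_delayM {D E : SItv} (h : D.Sub E) (m : Multiset Atom) :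
    Multiset.Rel Atom.Wider (delayM D m) (delayM E m) := by
  refine Multiset.rel_map.2 (Multiset.rel_refl_of_refl_on fun a _ => ?_)
  exact ⟨rfl, rfl, h.add (SItv.Sub.refl _), SCap.Le.refl _⟩

/-- A disagreement persists by `SCap.Compat.mono`. A communication delays both continuations by a
wider interval, so the residues are again related and the induction continues. -/
lemma Bad.wider {m m' : Multiset Atom} (h : Bad m) (hm : Multiset.Rel Atom.Wider m m') :
    Bad m' := by
  induction h generalizing m' with
  | error A B I J U V m h =>
    obtain ⟨_, _, hi, hm1, rfl⟩ := Multiset.rel_cons_left.1 hm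
    obtain ⟨_, _, ho, hm2, rfl⟩ := Multiset.rel_cons_left.1 hm1
    obtain ⟨A', I', rfl, hA, hI⟩ := hi.exists_eq
    obtain ⟨B', J', rfl, hB, hJ⟩ := ho.exists_eq
    exact .error _ _ _ _ _ _ _ fun h' => h ⟨h'.1.mono hA hB hI, h'.2.mono hB hA hJ⟩
  | comm A B I J U V x y m hx hy _ ih =>
    obtain ⟨_, _, hi, hm1, rfl⟩ := Multiset.rel_cons_left.1 hm
    obtain ⟨_, _, ho, hm2, rfl⟩ := Multiset.rel_cons_left.1 hm1
    obtain ⟨A', I', rfl, hA, hI⟩ := hi.exists_eq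
    obtain ⟨B', J', rfl, hB, hJ⟩ := ho.exists_eq
    exact .comm _ _ _ _ _ _ _ _ _ hx hy (ih (((rel_wider_delayM (hA.sup hB) x).add
      (rel_wider_delayM (hA.sup hB) y)).add hm2))

/-- An action `a` followed through a communication step is its input, its output or a bystander. -/
lemma cons_cons_eq_cons {i o a : Atom} {m₀ m : Multiset Atom} (h : i ::ₘ o ::ₘ m₀ = a ::ₘ m) :
    (i = a ∧ m = o ::ₘ m₀) ∨ (o = a ∧ m = i ::ₘ m₀) ∨
      ∃ m₁, m₀ = a ::ₘ m₁ ∧ m = i ::ₘ o ::ₘ m₁ := by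
  rcases Multiset.cons_eq_cons.1 h with ⟨h1, h2⟩ | ⟨_, c, h1, h2⟩
  · exact Or.inl ⟨h1, h2.symm⟩
  · rcases Multiset.cons_eq_cons.1 h1 with ⟨h3, h4⟩ | ⟨_, d, h3, h4⟩
    · exact Or.inr (Or.inl ⟨h3, by rw [h2, h4]⟩)
    · exact Or.inr (Or.inr ⟨d, h3, by rw [h2, h4]⟩)

/-- Replacement of an action whose continuation can be simulated. -/
lemma Bad.replace {α : Pol} {A : SItv} {J : SCap} {U U' : RU} {R : Set (Multiset Atom)}
    (hR : 0 ∈ R)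
    (H : ∀ B, J.Compat A B → ∀ u ∈ U.offers, ∀ n, Bad (delayM (A.sup B) u + n) →
      ∃ u' ∈ U'.offers, ∃ r ∈ R, Bad (delayM (A.sup B) u' + (r + n)))
    {m : Multiset Atom} (h : Bad (⟨α, A, J, U⟩ ::ₘ m)) :
    ∃ r ∈ R, Bad (⟨α, A, J, U'⟩ ::ₘ (r + m)) := by
  -- The replaced action is followed along the derivation of `Bad`. The set `R` holds what may have
  -- to stand beside it; the choice in `R` is known only when the action fires, and `0` suffices if
  -- it never does.
  generalize hM : (⟨α, A, J, U⟩ ::ₘ m : Multiset Atom) = M at h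
  induction h generalizing m with
  | error A' B I' J' U V m₀ h =>
    rcases cons_cons_eq_cons hM.symm with ⟨h1, h2⟩ | ⟨h1, h2⟩ | ⟨m₁, h1, h2⟩
    · cases h1
      exact ⟨0, hR, by rw [h2, zero_add]; exact .error _ _ _ _ _ _ _ h⟩
    · cases h1
      exact ⟨0, hR, by rw [h2, zero_add, Multiset.cons_swap]; exact .error _ _ _ _ _ _ _ h⟩
    · refine ⟨0, hR, ?_⟩
      rw [h2, zero_add, Multiset.cons_swap, Multiset.cons_swap _ (Atom.mk .out _ _ _)]
      exact .error _ _ _ _ _ _ _ h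
  | comm A' B I' J' C V x y m₀ hx hy hb ih =>
    rcases cons_cons_eq_cons hM.symm with ⟨h1, h2⟩ | ⟨h1, h2⟩ | ⟨m₁, h1, h2⟩
    · cases h1
      by_cases hc : Agree A B J J'
      · rw [add_assoc] at hb
        obtain ⟨u', hu', r, hr, hb'⟩ := H B hc.1 x hx _ hb
        refine ⟨r, hr, ?_⟩
        rw [h2, Multiset.add_cons]
        refine .comm _ _ _ _ _ _ _ _ _ hu' hy ?_
        convert hb' using 1
        abel
      · exact ⟨0, hR, by rw [h2, zero_add]; exact .error _ _ _ _ _ _ _ hc⟩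
    · cases h1
      by_cases hc : Agree A' A I' J
      · have hs : A'.sup A = A.sup A' := by ext <;> simp [SItv.sup, max_comm]
        rw [hs, add_comm (delayM _ x), add_assoc] at hb
        obtain ⟨u', hu', r, hr, hb'⟩ := H A' hc.2 y hy _ hb
        refine ⟨r, hr, ?_⟩
        rw [h2, Multiset.add_cons, Multiset.cons_swap]
        refine .comm _ _ _ _ _ _ _ _ _ hx hu' ?_
        rw [hs]
        convert hb' using 1
        abel
      · exact ⟨0, hR, by rw [h2, zero_add, Multiset.cons_swap]; exact .error _ _ _ _ _ _ _ hc⟩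
    -- A bystander: the same communication is performed after the replacement, and the induction
    -- hypothesis treats the residue.
    · obtain ⟨r, hr, hb'⟩ := ih (m := delayM (A'.sup B) x + delayM (A'.sup B) y + m₁)
        (by rw [h1, Multiset.add_cons])
      refine ⟨r, hr, ?_⟩
      have : (⟨α, A, J, U'⟩ ::ₘ (r + m) : Multiset Atom) =
          ⟨.inp, A', I', C⟩ ::ₘ ⟨.out, B, J', V⟩ ::ₘ (⟨α, A, J, U'⟩ ::ₘ (r + m₁)) := by
        rw [h2, Multiset.add_cons, Multiset.add_cons, Multiset.cons_swap,
          Multiset.cons_swap _ (Atom.mk .out _ _ _)]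
      rw [this]
      refine .comm _ _ _ _ _ _ _ _ _ hx hy ?_
      convert hb' using 1
      rw [Multiset.add_cons]
      congr 1
      abel

lemma delayM_eq_cons {D A : SItv} {α : Pol} {I : SCap} {U : RU} {m t : Multiset Atom}
    (h : delayM D m = ⟨α, A, I, U⟩ ::ₘ t) :
    ∃ A' m', m = ⟨α, A', I, U⟩ ::ₘ m' ∧ A = D + A' ∧ t = delayM D m' := by
  classical
  obtain ⟨a, ha, h1, h2⟩ := (Multiset.map_eq_cons (Atom.delay D) m t _).2 h
  refine ⟨a.ob, m.erase a, ?_, (congrArg Atom.ob h1).symm, h2.symm⟩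
  conv_lhs => rw [← Multiset.cons_erase ha]
  congr 1
  have h3 := congrArg Atom.pol h1
  have h4 := congrArg Atom.cap h1
  have h5 := congrArg Atom.cont h1
  ext1 <;> first | exact h3 | exact h4 | exact h5 | rfl

/-- A common finite shift cancels in `Agree` and distributes over the maxima, so it neither creates
nor removes errors. This is what lets `m : P` cross a restriction. -/
lemma bad_delayM_pt (p : ℕ) {m : Multiset Atom} : Bad (delayM (SItv.pt p) m) ↔ Bad m := by
  constructor
  · intro h
    generalize hM : delayM (SItv.pt p) m = M at h
    induction h generalizing m with
    | error A B I J U V m₀ h =>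
      obtain ⟨A', m₁, rfl, rfl, h1⟩ := delayM_eq_cons hM
      obtain ⟨B', m₂, rfl, rfl, rfl⟩ := delayM_eq_cons h1.symm
      refine .error _ _ _ _ _ _ _ ?_
      simpa only [Agree, SCap.compat_pt_add] using h
    | comm A B I J U V x y m₀ hx hy hb ih =>
      obtain ⟨A', m₁, rfl, rfl, h1⟩ := delayM_eq_cons hM
      obtain ⟨B', m₂, rfl, rfl, rfl⟩ := delayM_eq_cons h1.symm
      refine .comm _ _ _ _ _ _ _ _ _ hx hy (ih ?_)
      rw [← SItv.add_sup]
      simp only [map_add, delayM_delayM]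
  · intro h
    induction h with
    | error A B I J U V m₀ h =>
      rw [delayM_cons, delayM_cons]
      refine .error _ _ _ _ _ _ _ ?_
      simpa only [Agree, SCap.compat_pt_add] using h
    | comm A B I J U V x y m₀ hx hy hb ih =>
      rw [delayM_cons, delayM_cons]
      refine .comm _ _ _ _ _ _ _ _ _ hx hy ?_
      rw [← SItv.add_sup]
      simpa only [map_add, delayM_delayM] using ih

end PiUsage

namespace PiUsage

/-! ### The order on semantic usages -/

namespace RU

/-- `U ≤ V` when `V` can be used in place of `U`, after any delay and along with any other
actions, without causing new errors. -/
instance : Preorder RU where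
  le U V := ∀ D m, ∀ v ∈ V.offers, Bad (delayM D v + m) → ∃ u ∈ U.offers, Bad (delayM D u + m)
  le_refl U D m v hv h := ⟨v, hv, h⟩
  le_trans U V W h1 h2 D m w hw h := by
    obtain ⟨v, hv, h⟩ := h2 D m w hw h
    exact h1 D m v hv h

lemma le_of_offers {U V : RU} (h : V.offers ⊆ U.offers) : U ≤ V :=
  fun _ _ v hv hb => ⟨v, h hv, hb⟩

lemma delayM_mem_offers {D : SItv} {U : RU} {u : Multiset Atom} (hu : u ∈ U.offers) :
    delayM D u ∈ (U.delay D).offers := by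
  rw [offers_delay]
  exact ⟨u, hu, rfl⟩

lemma le_zero (U : RU) : U ≤ .zero :=
  le_of_offers fun _ hu => hu ▸ U.zero_mem_offers

lemma par_le_par_left {U U' : RU} (h : U ≤ U') (V : RU) : U.par V ≤ U'.par V := by
  rintro D m _ ⟨u', hu', v, hv, rfl⟩ hb
  rw [map_add, add_assoc] at hb
  obtain ⟨u, hu, hb⟩ := h D _ u' hu' hb
  exact ⟨_, ⟨u, hu, v, hv, rfl⟩, by rwa [map_add, add_assoc]⟩

lemma le_par_comm (U V : RU) : U.par V ≤ V.par U :=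
  le_of_offers <| by
    rintro _ ⟨u, hu, v, hv, rfl⟩
    exact ⟨v, hv, u, hu, add_comm _ _⟩

lemma par_le_par {U U' V V' : RU} (h : U ≤ U') (h' : V ≤ V') : U.par V ≤ U'.par V' :=
  (par_le_par_left h V).trans <| (le_par_comm _ _).trans <|
    (par_le_par_left h' U').trans (le_par_comm _ _)

/-- An offer of `!V` is a finite sum of offers of `V`. They are traded for offers of `U` one by one,
the remaining ones being counted in the environment `m`. -/
lemma bang_le_bang {U V : RU} (h : U ≤ V) : U.bang ≤ V.bang := by
  intro D m v hv
  change v ∈ AddSubmonoid.closure V.offers at hv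
  induction hv using AddSubmonoid.closure_induction generalizing m with
  | mem v hv =>
    intro hb
    obtain ⟨u, hu, hb⟩ := h D m v hv hb
    exact ⟨u, AddSubmonoid.subset_closure hu, hb⟩
  | zero => exact fun hb => ⟨0, zero_mem_offers _, hb⟩
  | add v w _ _ hv hw =>
    intro hb
    rw [map_add, add_assoc] at hb
    obtain ⟨u, hu, hb⟩ := hv _ hb
    rw [add_left_comm] at hb
    obtain ⟨u', hu', hb⟩ := hw _ hb
    refine ⟨u + u', (AddSubmonoid.closure U.offers).add_mem hu hu', ?_⟩
    rwa [map_add, add_assoc, add_left_comm]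

lemma choice_le_choice {U U' V V' : RU} (h : U ≤ U') (h' : V ≤ V') :
    U.choice V ≤ U'.choice V' := by
  rintro D m v (hv | hv) hb
  · obtain ⟨u, hu, hb⟩ := h D m v hv hb
    exact ⟨u, Or.inl hu, hb⟩
  · obtain ⟨u, hu, hb⟩ := h' D m v hv hb
    exact ⟨u, Or.inr hu, hb⟩

lemma delay_le_delay (E : SItv) {U V : RU} (h : U ≤ V) : U.delay E ≤ V.delay E := by
  intro D m v hv hb
  rw [offers_delay] at hv
  obtain ⟨v, hv, rfl⟩ := hv
  rw [delayM_delayM] at hb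
  obtain ⟨u, hu, hb⟩ := h _ m v hv hb
  exact ⟨_, delayM_mem_offers hu, by rwa [delayM_delayM]⟩

/-- Delaying is contravariant in the interval: a wider delay gives wider obligations, where errors
persist by `Bad.wider`. -/
lemma delay_le_of_sub {D E : SItv} (h : D.Sub E) (U : RU) : U.delay E ≤ U.delay D := by
  intro D' m v hv hb
  rw [offers_delay] at hv
  obtain ⟨v, hv, rfl⟩ := hv
  rw [delayM_delayM] at hb
  refine ⟨_, delayM_mem_offers hv, ?_⟩
  rw [delayM_delayM]
  exact hb.wider ((rel_wider_delayM ((SItv.Sub.refl _).add h) v).add (rel_wider_refl m))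

lemma delay_delay (D E : SItv) : ∀ U : RU, (U.delay E).delay D = U.delay (D + E)
  | .zero => rfl
  | .par U V => by simp [delay, delay_delay D E U, delay_delay D E V]
  | .act _ _ _ _ => by simp [delay, add_assoc]
  | .bang U => by simp [delay, delay_delay D E U]
  | .choice U V => by simp [delay, delay_delay D E U, delay_delay D E V]

lemma delay_zero : ∀ U : RU, U.delay 0 = U
  | .zero => rfl
  | .par U V => by simp [delay, delay_zero U, delay_zero V]
  | .act _ _ _ _ => by simp [delay]
  | .bang U => by simp [delay, delay_zero U]
  | .choice U V => by simp [delay, delay_zero U, delay_zero V]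

lemma act_le_act {α : Pol} {A B : SItv} {I J : SCap} (U : RU) (hA : B.Sub A) (hI : I.Le J) :
    act α A I U ≤ act α B J U := by
  rintro D m v (rfl | rfl) hb
  · exact ⟨0, zero_mem_offers _, hb⟩
  · refine ⟨_, Or.inr rfl, hb.wider (Multiset.Rel.add ?_ (rel_wider_refl m))⟩
    rw [delayM_singleton, delayM_singleton]
    exact Multiset.Rel.cons ⟨rfl, rfl, (SItv.Sub.refl D).add hA, hI⟩ .zero

/-- When the action fires, its continuation is released with delay `(D + A) ⊔ B` beside the other
actions. The quantification over delays and environments in the order is made for this situation. -/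
lemma act_mono (α : Pol) (A : SItv) (J : SCap) {U V : RU} (h : U ≤ V) :
    act α A J U ≤ act α A J V := by
  rintro D m v (rfl | rfl) hb
  · exact ⟨0, zero_mem_offers _, hb⟩
  · rw [delayM_singleton] at hb
    obtain ⟨r, rfl, hb⟩ := Bad.replace (U' := U) (R := {0}) rfl (fun B _ v hv n hb => by
      obtain ⟨u, hu, hb⟩ := h _ n v hv hb
      exact ⟨u, hu, 0, rfl, by rwa [zero_add]⟩) hb
    exact ⟨_, Or.inr rfl, by rwa [zero_add] at hb⟩

/-- When the guard meets a compatible partner, `V` is released with delay `A ⊔ B`, which lies inside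
`A + J_c` by `SCap.Compat.sup_sub`. Offering `V` from the start with the wider delay keeps every
error. Here `R` in `Bad.replace` consists of the delayed offers of `V`. -/
lemma act_par_delay_le (α : Pol) (A : SItv) (J : SCap) (U V : RU) :
    (act α A J U).par (V.delay (A + J.toItv)) ≤ act α A J (U.par V) := by
  rintro D m v (rfl | rfl) hb
  · exact ⟨0, zero_mem_offers _, hb⟩
  · rw [delayM_singleton] at hb
    obtain ⟨_, ⟨v, hv, rfl⟩, hb⟩ := Bad.replace (U' := U)
      (R := delayM (D + A + J.toItv) '' V.offers) ⟨0, V.zero_mem_offers, map_zero _⟩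
      (by
        rintro B hB _ ⟨u, hu, v, hv, rfl⟩ n hb
        refine ⟨u, hu, _, ⟨v, hv, rfl⟩, ?_⟩
        rw [map_add, add_assoc] at hb
        exact hb.wider ((rel_wider_refl _).add
          ((rel_wider_delayM hB.sup_sub v).add (rel_wider_refl n)))) hb
    refine ⟨_, ⟨_, Or.inr rfl, _, delayM_mem_offers hv, rfl⟩, ?_⟩
    rw [map_add, delayM_singleton, delayM_delayM, ← add_assoc, add_assoc, Multiset.singleton_add]
    exact hb

/-- An error of the reduct is one `Bad.comm` away from the redex. Reduction of usages is thereby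
part of the order, and contexts need not change during subject reduction. -/
lemma comm_le (A B : SItv) (I J : SCap) (U V : RU) :
    (act .inp A I U).par (act .out B J V) ≤ (U.par V).delay (A.sup B) := by
  intro D m w hw hb
  rw [offers_delay] at hw
  obtain ⟨_, ⟨u, hu, v, hv, rfl⟩, rfl⟩ := hw
  refine ⟨_, ⟨_, Or.inr rfl, _, Or.inr rfl, rfl⟩, ?_⟩
  rw [map_add, delayM_singleton, delayM_singleton, add_assoc, Multiset.singleton_add,
    Multiset.singleton_add]
  refine .comm _ _ _ _ _ _ _ _ _ hu hv ?_
  rwa [delayM_delayM, SItv.add_sup, map_add] at hb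

lemma offers_bang_par_self (U : RU) : (U.bang.par U).offers = U.bang.offers := by
  ext w
  constructor
  · rintro ⟨u, hu, v, hv, rfl⟩
    exact (AddSubmonoid.closure U.offers).add_mem hu (AddSubmonoid.subset_closure hv)
  · exact fun hw => ⟨w, hw, 0, U.zero_mem_offers, add_zero w⟩

lemma offers_bang_par (U V : RU) : (U.par V).bang.offers = (U.bang.par V.bang).offers := by
  ext w
  constructor
  · intro hw
    change w ∈ AddSubmonoid.closure _ at hw
    induction hw using AddSubmonoid.closure_induction with
    | mem w hw =>
      obtain ⟨u, hu, v, hv, rfl⟩ := hw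
      exact ⟨u, AddSubmonoid.subset_closure hu, v, AddSubmonoid.subset_closure hv, rfl⟩
    | zero => exact zero_mem_offers _
    | add w w' _ _ hw hw' =>
      obtain ⟨u, hu, v, hv, rfl⟩ := hw
      obtain ⟨u', hu', v', hv', rfl⟩ := hw'
      exact ⟨_, (AddSubmonoid.closure _).add_mem hu hu', _,
        (AddSubmonoid.closure _).add_mem hv hv', by abel⟩
  · rintro ⟨u, hu, v, hv, rfl⟩
    refine (AddSubmonoid.closure _).add_mem ?_ ?_
    · exact AddSubmonoid.closure_mono (t := (U.par V).offers) (fun u hu => ⟨u, hu, 0, V.zero_mem_offers, add_zero u⟩) hu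
    · exact AddSubmonoid.closure_mono (t := (U.par V).offers) (fun v hv => ⟨0, U.zero_mem_offers, v, hv, zero_add v⟩) hv

lemma offers_bang_bang (U : RU) : U.bang.bang.offers = U.bang.offers := by
  simp [offers]

lemma offers_bang_zero : (bang .zero).offers = RU.zero.offers := by
  ext w
  simp [offers, AddSubmonoid.mem_closure_singleton, eq_comm]

/-- No error is reachable. -/
def Safe (U : RU) : Prop := ∀ u ∈ U.offers, ¬ Bad u

lemma Safe.mono {U V : RU} (h : U ≤ V) (hU : U.Safe) : V.Safe := by
  intro v hv hb
  obtain ⟨u, hu, hb⟩ := h 0 0 v hv (by rwa [delayM_zero, add_zero])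
  exact hU u hu (by rwa [delayM_zero, add_zero] at hb)

lemma safe_delay_pt (p : ℕ) (U : RU) : (U.delay (SItv.pt p)).Safe ↔ U.Safe := by
  simp [Safe, offers_delay, bad_delayM_pt]

end RU

/-! ### The ordered monoid of usages. -/

/-- Semantic usages up to equivalence. -/
def SU : Type := Antisymmetrization RU (· ≤ ·)

namespace SU

noncomputable instance : PartialOrder SU :=
  inferInstanceAs (PartialOrder (Antisymmetrization RU (· ≤ ·)))

/-- The class of a usage. -/
def mk (U : RU) : SU := toAntisymmetrization (· ≤ ·) U

lemma mk_le_mk {U V : RU} : mk U ≤ mk V ↔ U ≤ V := Iff.rfl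

lemma mk_surj (x : SU) : ∃ U, mk U = x := Quotient.exists_rep x

lemma mk_eq {U V : RU} (h : U ≤ V) (h' : V ≤ U) : mk U = mk V := le_antisymm h h'

lemma mk_eq_of_offers {U V : RU} (h : U.offers = V.offers) : mk U = mk V :=
  mk_eq (RU.le_of_offers h.ge) (RU.le_of_offers h.le)

/-- Lift of a monotone operation. -/
def map (f : RU → RU) (hf : ∀ {U V : RU}, U ≤ V → f U ≤ f V) : SU → SU :=
  Quotient.map' f fun _ _ h => ⟨hf h.1, hf h.2⟩

noncomputable instance : Zero SU := ⟨mk .zero⟩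

noncomputable instance : Add SU :=
  ⟨Quotient.map₂ RU.par fun _ _ h _ _ h' => ⟨RU.par_le_par h.1 h'.1, RU.par_le_par h.2 h'.2⟩⟩

noncomputable instance : AddCommMonoid SU where
  add_assoc x y z := by
    obtain ⟨U, rfl⟩ := mk_surj x
    obtain ⟨V, rfl⟩ := mk_surj y
    obtain ⟨W, rfl⟩ := mk_surj z
    refine mk_eq_of_offers (Set.ext fun w => ?_)
    constructor
    · rintro ⟨_, ⟨u, hu, v, hv, rfl⟩, w, hw, rfl⟩
      exact ⟨u, hu, _, ⟨v, hv, w, hw, rfl⟩, (add_assoc _ _ _).symm⟩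
    · rintro ⟨u, hu, _, ⟨v, hv, w, hw, rfl⟩, rfl⟩
      exact ⟨_, ⟨u, hu, v, hv, rfl⟩, w, hw, add_assoc _ _ _⟩
  zero_add x := by
    obtain ⟨U, rfl⟩ := mk_surj x
    refine mk_eq_of_offers (Set.ext fun w => ?_)
    simp [RU.offers]
  add_zero x := by
    obtain ⟨U, rfl⟩ := mk_surj x
    refine mk_eq_of_offers (Set.ext fun w => ?_)
    simp [RU.offers]
  add_comm x y := by
    obtain ⟨U, rfl⟩ := mk_surj x
    obtain ⟨V, rfl⟩ := mk_surj y
    exact mk_eq (RU.le_par_comm U V) (RU.le_par_comm V U)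
  nsmul := nsmulRec

instance : IsOrderedAddMonoid SU where
  add_le_add_left x y h z := by
    obtain ⟨U, rfl⟩ := mk_surj x
    obtain ⟨V, rfl⟩ := mk_surj y
    obtain ⟨W, rfl⟩ := mk_surj z
    exact RU.par_le_par_left h W

lemma le_zero (x : SU) : x ≤ 0 := by
  obtain ⟨U, rfl⟩ := mk_surj x
  exact RU.le_zero U

lemma add_le_left (x y : SU) : x + y ≤ x := by
  simpa using add_le_add (le_refl x) (le_zero y)

lemma add_le_right (x y : SU) : x + y ≤ y := by
  simpa using add_le_add (le_zero x) (le_refl y)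

/-- `↑^D U` -/
def delay (D : SItv) : SU →+ SU where
  toFun := map (RU.delay D) (RU.delay_le_delay D)
  map_zero' := rfl
  map_add' x y := by
    obtain ⟨U, rfl⟩ := mk_surj x
    obtain ⟨V, rfl⟩ := mk_surj y
    rfl

lemma mk_delay (D : SItv) (U : RU) : mk (U.delay D) = delay D (mk U) := rfl

lemma delay_mono (D : SItv) {x y : SU} (h : x ≤ y) : delay D x ≤ delay D y := by
  obtain ⟨U, rfl⟩ := mk_surj x
  obtain ⟨V, rfl⟩ := mk_surj y
  exact RU.delay_le_delay D h

lemma delay_le_of_sub {D E : SItv} (h : D.Sub E) (x : SU) : delay E x ≤ delay D x := by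
  obtain ⟨U, rfl⟩ := mk_surj x
  exact RU.delay_le_of_sub h U

lemma delay_delay (D E : SItv) (x : SU) : delay D (delay E x) = delay (D + E) x := by
  obtain ⟨U, rfl⟩ := mk_surj x
  exact congrArg mk (RU.delay_delay D E U)

lemma delay_zero (x : SU) : delay 0 x = x := by
  obtain ⟨U, rfl⟩ := mk_surj x
  exact congrArg mk (RU.delay_zero U)

/-- `!U` -/
def bang : SU →+ SU where
  toFun := map RU.bang RU.bang_le_bang
  map_zero' := mk_eq_of_offers RU.offers_bang_zero
  map_add' x y := by
    obtain ⟨U, rfl⟩ := mk_surj x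
    obtain ⟨V, rfl⟩ := mk_surj y
    exact mk_eq_of_offers (RU.offers_bang_par U V)

lemma bang_mono {x y : SU} (h : x ≤ y) : bang x ≤ bang y := by
  obtain ⟨U, rfl⟩ := mk_surj x
  obtain ⟨V, rfl⟩ := mk_surj y
  exact RU.bang_le_bang h

lemma bang_unfold (x : SU) : bang x = bang x + x := by
  obtain ⟨U, rfl⟩ := mk_surj x
  exact mk_eq_of_offers (RU.offers_bang_par_self U).symm

lemma bang_bang (x : SU) : bang (bang x) = bang x := by
  obtain ⟨U, rfl⟩ := mk_surj x
  exact mk_eq_of_offers (RU.offers_bang_bang U)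

lemma delay_bang (D : SItv) (x : SU) : delay D (bang x) = bang (delay D x) := by
  obtain ⟨U, rfl⟩ := mk_surj x
  rfl

/-- `α^A_J.U` -/
def act (α : Pol) (A : SItv) (J : SCap) : SU → SU := map (RU.act α A J) (RU.act_mono α A J)

lemma act_mono (α : Pol) (A : SItv) (J : SCap) {x y : SU} (h : x ≤ y) :
    act α A J x ≤ act α A J y := by
  obtain ⟨U, rfl⟩ := mk_surj x
  obtain ⟨V, rfl⟩ := mk_surj y
  exact RU.act_mono α A J h

lemma delay_act (D : SItv) (α : Pol) (A : SItv) (J : SCap) (x : SU) :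
    delay D (act α A J x) = act α (D + A) J x := by
  obtain ⟨U, rfl⟩ := mk_surj x
  rfl

lemma act_add_delay_le (α : Pol) (A : SItv) (J : SCap) (x y : SU) :
    act α A J x + delay (A + J.toItv) y ≤ act α A J (x + y) := by
  obtain ⟨U, rfl⟩ := mk_surj x
  obtain ⟨V, rfl⟩ := mk_surj y
  exact RU.act_par_delay_le α A J U V

lemma comm_le (A B : SItv) (I J : SCap) (x y : SU) :
    act .inp A I x + act .out B J y ≤ delay (A.sup B) (x + y) := by
  obtain ⟨U, rfl⟩ := mk_surj x
  obtain ⟨V, rfl⟩ := mk_surj y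
  exact RU.comm_le A B I J U V

/-- No error is reachable. -/
def Safe (x : SU) : Prop := ∃ U, mk U = x ∧ U.Safe

lemma safe_mk {U : RU} : (mk U).Safe ↔ U.Safe := by
  refine ⟨?_, fun h => ⟨U, rfl, h⟩⟩
  rintro ⟨V, h, hV⟩
  exact hV.mono (mk_le_mk.1 h.le)

lemma Safe.mono {x y : SU} (h : x ≤ y) (hx : x.Safe) : y.Safe := by
  obtain ⟨U, rfl⟩ := mk_surj x
  obtain ⟨V, rfl⟩ := mk_surj y
  exact safe_mk.2 ((safe_mk.1 hx).mono h)

lemma safe_zero : Safe 0 := ⟨.zero, rfl, fun _ hu => hu ▸ not_bad_zero⟩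

lemma safe_delay_pt (p : ℕ) (x : SU) : (delay (SItv.pt p) x).Safe ↔ x.Safe := by
  obtain ⟨U, rfl⟩ := mk_surj x
  rw [← mk_delay, safe_mk, safe_mk, RU.safe_delay_pt]

/-- Both actions can be offered together, and a disagreement would be an immediate error. -/
lemma Safe.agree {A B : SItv} {I J : SCap} {x y : SU}
    (h : (act .inp A I x + act .out B J y).Safe) : Agree A B I J := by
  obtain ⟨U, rfl⟩ := mk_surj x
  obtain ⟨V, rfl⟩ := mk_surj y
  by_contra hc
  refine safe_mk.1 h _ ⟨_, Or.inr rfl, _, Or.inr rfl, rfl⟩ ?_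
  rw [Multiset.singleton_add, ← Multiset.cons_zero]
  exact .error A B I J U V 0 hc

end SU

end PiUsage

namespace PiUsage

/-! ## Semantic typing

Only the upper bound of the complexity is recorded, and subsumption is built into each clause. -/

/-- Types at a fixed valuation, without the outermost usage. The index variables bound by a server
type become the arguments of families. -/
inductive Base : Type
  | nat (I J : ℕ∞)
  | chan (m : ℕ) (T : Fin m → Base) (V : Fin m → SU)
  | serv (k m : ℕ) (K : (Fin k → ℕ) → ℕ∞) (T : (Fin k → ℕ) → Fin m → Base)
      (V : (Fin k → ℕ) → Fin m → SU)

/-- Subtyping. -/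
inductive Base.Sub : Base → Base → Prop
  | refl (b : Base) : Sub b b
  | nat {I J I' J' : ℕ∞} : I' ≤ I → J ≤ J' → Sub (.nat I J) (.nat I' J')

lemma Base.Sub.trans {a b c : Base} (h : a.Sub b) (h' : b.Sub c) : a.Sub c := by
  cases h with
  | refl => exact h'
  | nat h1 h2 =>
    cases h' with
    | refl => exact .nat h1 h2
    | nat h3 h4 => exact .nat (h3.trans h1) (h2.trans h4)

/-- Together with the quotient `SU`, this turns mutual subtyping of argument types into equality.
For that reason channels and servers need no rule but `refl`. -/
lemma Base.Sub.antisymm {a b : Base} (h : a.Sub b) (h' : b.Sub a) : a = b := by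
  cases h with
  | refl => rfl
  | nat h1 h2 =>
    cases h' with
    | refl => rfl
    | nat h3 h4 => rw [le_antisymm h1 h3, le_antisymm h2 h4]

/-- The extension of a context by the entries of a tuple. -/
def extend {X : Type*} {m : ℕ} (T : Fin m → X) (f : ℕ → X) : ℕ → X :=
  fun i => if h : i < m then T ⟨i, h⟩ else f (i - m)

lemma extend_lt {X : Type*} {m : ℕ} (T : Fin m → X) (f : ℕ → X) {i : ℕ} (h : i < m) :
    extend T f i = T ⟨i, h⟩ := dif_pos h

lemma extend_add {X : Type*} {m : ℕ} (T : Fin m → X) (f : ℕ → X) (i : ℕ) :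
    extend T f (i + m) = f i := by
  simp [extend]

lemma extend_le_extend {X : Type*} [LE X] {m : ℕ} {T T' : Fin m → X} {f f' : ℕ → X} (h : T ≤ T')
    (h' : f ≤ f') : extend T f ≤ extend T' f' := by
  intro i
  unfold extend
  split_ifs
  · exact h _
  · exact h' _

/-- Every position below a binder is a bound variable or comes from a free one. -/
lemma lt_or_exists_add (i k : ℕ) : i < k ∨ ∃ j, i = j + k := by
  rcases lt_or_ge i k with h | h
  · exact Or.inl h
  · exact Or.inr ⟨i - k, by omega⟩

/-- Typing of expressions. -/
def ETy (B : ℕ → Base) : Expr → Base → Prop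
  | .var x, b => (B x).Sub b
  -- The upper end is free, since every element of `ℕ∞` is at least `0`.
  | .zero, .nat I _ => I ≤ 0
  | .succ e, .nat I J => ∃ I' J', ETy B e (.nat I' J') ∧ I ≤ I' + 1 ∧ J' + 1 ≤ J
  | _, _ => False

/-- Typing of tuples. -/
def TupTy (B : ℕ → Base) (u : ℕ → SU) (es : List Expr) {m : ℕ} (T : Fin m → Base)
    (V : Fin m → SU) : Prop :=
  es.length = m ∧ (∀ (j : Fin m) (e : Expr), es[(j : ℕ)]? = some e → ETy B e (T j)) ∧
    -- Each component that is literally `x` consumes its usage `V j` from `x`; the other components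
    -- consume nothing of `x`.
    ∀ x, u x ≤ ∑ j : Fin m, open Classical in if es[(j : ℕ)]? = some (.var x) then V j else 0

/-- The usages required by a communication prefix on `a`. -/
noncomputable def pre (α : Pol) (J : SCap) (a : ℕ) (u : ℕ → SU) : ℕ → SU :=
  fun x => if x = a then SU.act α 0 J (u x) else SU.delay J.toItv (u x)

/-- The types of the tuples sent on a name, and the complexity of the process they trigger. -/
inductive Sends {m : ℕ} : Base → (Fin m → Base) → (Fin m → SU) → ℕ∞ → Prop
  -- The continuation of a channel input is charged to the receiver, hence `0`; the body of a server
  -- is charged to the sender.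
  | chan (T V) : Sends (.chan m T V) T V 0
  | serv (k K T V) (ι : Fin k → ℕ) : Sends (.serv k m K T V) (T ι) (V ι) (K ι)

/-- Semantic typing of processes. -/
def Sem : Proc → (ℕ → Base) → (ℕ → SU) → ℕ∞ → Prop
  | .nil, _, _, _ => True
  | .par P Q, B, u, K => ∃ u₁ u₂, Sem P B u₁ K ∧ Sem Q B u₂ K ∧ u ≤ u₁ + u₂
  -- The bound is arbitrary: a server costs nothing by itself, and `K₀ ι` is paid by its callers
  -- through `Sends`.
  | .rep a m P, B, u, _ => ∃ k K₀ T V J u₁, B a = .serv k m K₀ T V ∧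
      (∀ ι, Sem P (extend (T ι) B) (extend (V ι) u₁) (K₀ ι)) ∧
      u ≤ fun x => SU.bang (pre .inp J a u₁ x)
  | .inp a m P, B, u, K => ∃ T V J u₁ K₁, B a = .chan m T V ∧
      Sem P (extend T B) (extend V u₁) K₁ ∧ u ≤ pre .inp J a u₁ ∧ SCap.seq J K₁ ≤ K
  | .out a es P, B, u, K => ∃ (m : ℕ) (T : Fin m → Base) (V : Fin m → SU), ∃ J u₁ u₂ K₁ K₂,
      Sends (B a) T V K₂ ∧ TupTy B u₂ es T V ∧ Sem P B u₁ K₁ ∧ u ≤ pre .out J a (u₁ + u₂) ∧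
      SCap.seq J (max K₁ K₂) ≤ K
  | .nu P, B, u, K => ∃ (b : Base) (U : SU), U.Safe ∧
      Sem P (extend (m := 1) (fun _ => b) B) (extend (m := 1) (fun _ => U) u) K
  | .tick P, B, u, K => ∃ u₁ K₁, Sem P B u₁ K₁ ∧ (u ≤ fun x => SU.delay (.pt 1) (u₁ x)) ∧
      K₁ + 1 ≤ K
  -- A branch is typed only if the interval allows it; this is the value at `ρ` of the constraint
  -- added to `Φ`.
  | .case e P Q, B, u, K => ∃ I J, ETy B e (.nat I J) ∧ (I ≤ 0 → Sem P B u K) ∧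
      (1 ≤ J → Sem Q (extend (m := 1) (fun _ => .nat (I - 1) (J - 1)) B)
        (extend (m := 1) (fun _ => 0) u) K)
  | .ann n P, B, u, K => ∃ u₁ K₁, Sem P B u₁ K₁ ∧ (u ≤ fun x => SU.delay (.pt n) (u₁ x)) ∧
      K₁ + n ≤ K

lemma Sem.localComplexity_le : ∀ {P : Proc} {B : ℕ → Base} {u : ℕ → SU} {K : ℕ∞},
    Sem P B u K → (P.localComplexity : ℕ∞) ≤ K
  | .par P Q, _, _, _, ⟨_, _, h1, h2, _⟩ => by
    rw [Proc.localComplexity, (Nat.mono_cast (α := ℕ∞)).map_max]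
    exact max_le h1.localComplexity_le h2.localComplexity_le
  | .nu P, _, _, _, ⟨_, _, _, h⟩ => h.localComplexity_le (P := P)
  | .ann n P, _, _, _, ⟨_, _, h, _, hK⟩ => by
    rw [Proc.localComplexity, Nat.cast_add, add_comm]
    exact (add_le_add h.localComplexity_le le_rfl).trans hK
  | .nil, _, _, _, _ | .rep .., _, _, _, _ | .inp .., _, _, _, _ | .out .., _, _, _, _
  | .tick _, _, _, _, _ | .case .., _, _, _, _ => by simp [Proc.localComplexity]

/-! ### Substitution -/

/-- The usages required after a substitution, where `F x` is the set of variables replaced by the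
variable `x`. -/
noncomputable def push (F : ℕ → Finset ℕ) (u : ℕ → SU) : ℕ → SU := fun x => ∑ i ∈ F x, u i

/-- `F x` is the set of variables replaced by `x`. -/
def IsFiber (F : ℕ → Finset ℕ) (σ : ℕ → Expr) : Prop := ∀ i x, i ∈ F x ↔ σ i = .var x

lemma push_mono (F : ℕ → Finset ℕ) {u v : ℕ → SU} (h : u ≤ v) : push F u ≤ push F v :=
  fun _ => Finset.sum_le_sum fun i _ => h i

lemma push_add (F : ℕ → Finset ℕ) (u v : ℕ → SU) : push F (u + v) = push F u + push F v :=
  funext fun _ => Finset.sum_add_distrib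

lemma push_comp (F : ℕ → Finset ℕ) (f : SU →+ SU) (u : ℕ → SU) :
    push F (fun x => f (u x)) = fun x => f (push F u x) :=
  funext fun _ => (map_sum f _ _).symm

/-- The substitution may identify several names with `b`. Among them `a` carries the action and the
others are merely delayed; `SU.act_add_delay_le` moves these under the action. The guard axiom of
subusage is indispensable here. -/
lemma push_pre_le {F : ℕ → Finset ℕ} {σ : ℕ → Expr} (hF : IsFiber F σ) {a b : ℕ}
    (hab : σ a = .var b) (α : Pol) (J : SCap) (u : ℕ → SU) :
    push F (pre α J a u) ≤ pre α J b (push F u) := by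
  intro x
  have hd : ∀ s : Finset ℕ, a ∉ s →
      ∑ i ∈ s, pre α J a u i = SU.delay J.toItv (∑ i ∈ s, u i) := by
    intro s hs
    rw [map_sum]
    refine Finset.sum_congr rfl fun i hi => if_neg ?_
    rintro rfl
    exact hs hi
  by_cases hx : x = b
  · subst hx
    have ha : a ∈ F x := (hF a x).2 hab
    unfold push
    rw [← Finset.add_sum_erase _ _ ha, hd _ (Finset.notMem_erase a _), pre, pre, if_pos rfl,
      if_pos rfl, ← Finset.add_sum_erase (F x) u ha]
    have := SU.act_add_delay_le α 0 J (u a) (∑ i ∈ (F x).erase a, u i)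
    rwa [zero_add] at this
  · have ha : a ∉ F x := by
      rw [hF, hab]
      simpa using fun h => hx h.symm
    unfold push
    rw [hd _ ha, pre, if_neg hx]

/-- The fibers of a lifted substitution. -/
def liftFiber (k : ℕ) (F : ℕ → Finset ℕ) : ℕ → Finset ℕ :=
  fun x => if x < k then {x} else (F (x - k)).map (addRightEmbedding k)

lemma Expr.rename_eq_var {f : ℕ → ℕ} {e : Expr} {x : ℕ} :
    e.rename f = .var x ↔ ∃ y, e = .var y ∧ f y = x := by
  cases e <;> simp [Expr.rename]

lemma IsFiber.lift {F : ℕ → Finset ℕ} {σ : ℕ → Expr} (h : IsFiber F σ) (k : ℕ) :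
    IsFiber (liftFiber k F) (liftSub k σ) := by
  intro i x
  rcases lt_or_exists_add x k with hx | ⟨x, rfl⟩ <;>
    rcases lt_or_exists_add i k with hi | ⟨i, rfl⟩
  · simp [liftFiber, liftSub, hi, hx]
  · simp only [liftFiber, liftSub, hx, if_true, Finset.mem_singleton]
    constructor
    · omega
    · rintro h
      rw [if_neg (by omega), Expr.rename_eq_var] at h
      obtain ⟨y, -, h⟩ := h
      omega
  · simp only [liftFiber, liftSub, hi, if_true, Expr.var.injEq]
    rw [if_neg (by omega)]
    simp only [Finset.mem_map, addRightEmbedding_apply]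
    constructor
    · rintro ⟨a, -, h⟩
      omega
    · omega
  · simp [liftFiber, liftSub, Expr.rename_eq_var, h i]

lemma push_extend (F : ℕ → Finset ℕ) {k : ℕ} (V : Fin k → SU) (u : ℕ → SU) :
    push (liftFiber k F) (extend V u) = extend V (push F u) := by
  funext x
  rcases lt_or_exists_add x k with hx | ⟨x, rfl⟩
  · simp [push, liftFiber, hx]
    simp [extend, hx]
  · simp [push, liftFiber, extend_add]

/-- Semantic well-typedness of substitutions. -/
def SubstTy (B' : ℕ → Base) (σ : ℕ → Expr) (B : ℕ → Base) : Prop := ∀ i, ETy B' (σ i) (B i)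

lemma ETy.sub {B : ℕ → Base} {e : Expr} {b b' : Base} (h : ETy B e b) (hb : b.Sub b') :
    ETy B e b' := by
  cases hb with
  | refl => exact h
  | nat h1 h2 =>
    cases e with
    | var x => exact Base.Sub.trans h (.nat h1 h2)
    | zero => exact h1.trans h
    | succ e =>
      obtain ⟨I, J, h, hI, hJ⟩ := h
      exact ⟨I, J, h, h1.trans hI, hJ.trans h2⟩

lemma ETy.rename {B B' : ℕ → Base} {f : ℕ → ℕ} (hf : ∀ x, B' (f x) = B x) :
    ∀ {e : Expr} {b : Base}, ETy B e b → ETy B' (e.rename f) b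
  | .var x, b, h => by
    change (B' (f x)).Sub b
    rw [hf]
    exact h
  | .zero, .nat _ _, h => h
  | .succ _, .nat _ _, ⟨I, J, h, h'⟩ => ⟨I, J, h.rename hf, h'⟩

lemma ETy.subst {B B' : ℕ → Base} {σ : ℕ → Expr} (hσ : SubstTy B' σ B) :
    ∀ {e : Expr} {b : Base}, ETy B e b → ETy B' (e.subst σ) b
  | .var x, _, h => (hσ x).sub h
  | .zero, .nat _ _, h => h
  | .succ _, .nat _ _, ⟨I, J, h, h'⟩ => ⟨I, J, h.subst hσ, h'⟩

lemma SubstTy.lift {B B' : ℕ → Base} {σ : ℕ → Expr} (hσ : SubstTy B' σ B) {k : ℕ}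
    (T : Fin k → Base) : SubstTy (extend T B') (liftSub k σ) (extend T B) := by
  intro i
  rcases lt_or_exists_add i k with hi | ⟨i, rfl⟩
  · simp only [liftSub, hi, if_true]
    change Base.Sub (extend T B' i) _
    rw [extend_lt _ _ hi, extend_lt _ _ hi]
    exact .refl _
  · simp only [liftSub, extend_add]
    rw [if_neg (by omega), Nat.add_sub_cancel]
    exact (hσ i).rename fun x => extend_add T B' x

/-- Only variables inhabit channel and server types, and `Base.Sub` is equality at such types. -/
lemma SubstTy.exists_var {B B' : ℕ → Base} {σ : ℕ → Expr} (hσ : SubstTy B' σ B) {a : ℕ}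
    (ha : ∀ I J, B a ≠ .nat I J) : ∃ b, σ a = .var b ∧ B' b = B a := by
  have h := hσ a
  cases hb : B a with
  | nat I J => exact (ha I J hb).elim
  | chan m T V =>
    rw [hb] at h
    cases he : σ a with
    | var b =>
      rw [he] at h
      refine ⟨b, rfl, ?_⟩
      generalize hc : B' b = c
      change (B' b).Sub _ at h
      rw [hc] at h
      cases h
      rfl
    | zero => rw [he] at h; exact h.elim
    | succ e => rw [he] at h; exact h.elim
  | serv k m K T V =>
    rw [hb] at h
    cases he : σ a with
    | var b =>
      rw [he] at h
      refine ⟨b, rfl, ?_⟩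
      generalize hc : B' b = c
      change (B' b).Sub _ at h
      rw [hc] at h
      cases h
      rfl
    | zero => rw [he] at h; exact h.elim
    | succ e => rw [he] at h; exact h.elim

lemma Sends.ne_nat {m : ℕ} {b : Base} {T : Fin m → Base} {V : Fin m → SU} {K : ℕ∞}
    (h : Sends b T V K) (I J : ℕ∞) : b ≠ .nat I J := by
  cases h <;> simp

lemma Expr.subst_eq_var {σ : ℕ → Expr} {e : Expr} {x : ℕ} :
    e.subst σ = .var x ↔ ∃ i, e = .var i ∧ σ i = .var x := by
  cases e <;> simp [Expr.subst]

lemma TupTy.subst {B B' : ℕ → Base} {F : ℕ → Finset ℕ} {σ : ℕ → Expr} (hF : IsFiber F σ)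
    (hσ : SubstTy B' σ B) {u : ℕ → SU} {es : List Expr} {m : ℕ} {T : Fin m → Base}
    {V : Fin m → SU} (h : TupTy B u es T V) :
    TupTy B' (push F u) (es.map (Expr.subst σ)) T V := by
  classical
  obtain ⟨h1, h2, h3⟩ := h
  refine ⟨by simpa using h1, ?_, ?_⟩
  · intro j e he
    rw [List.getElem?_map, Option.map_eq_some_iff] at he
    obtain ⟨e, he, rfl⟩ := he
    exact (h2 j e he).subst hσ
  · intro x
    refine (Finset.sum_le_sum fun i _ => h3 i).trans ?_
    -- With the sums exchanged, a component that becomes `x` comes from exactly one variable of the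
    -- fiber and pays `V j` once. The remaining terms are bounded by `0`, the greatest usage.
    rw [Finset.sum_comm]
    refine Finset.sum_le_sum fun j _ => ?_
    split_ifs with hj
    · rw [List.getElem?_map, Option.map_eq_some_iff] at hj
      obtain ⟨e, he, hx⟩ := hj
      obtain ⟨i, rfl, hi⟩ := Expr.subst_eq_var.1 hx
      rw [he, Finset.sum_eq_single_of_mem i ((hF i x).2 hi)]
      · simp
      · intro i' _ hne
        simp [hne.symm]
    · exact SU.le_zero _

/-- Substitution lemma, with subsumption. -/
lemma Sem.subst {P : Proc} : ∀ {B B' : ℕ → Base} {F : ℕ → Finset ℕ} {σ : ℕ → Expr}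
    {u u' : ℕ → SU} {K K' : ℕ∞}, IsFiber F σ → SubstTy B' σ B → u' ≤ push F u → K ≤ K' →
    Sem P B u K → Sem (P.subst σ) B' u' K' := by
  induction P with
  | nil => intros; trivial
  | par P Q ihP ihQ =>
    rintro B B' F σ u u' K K' hF hσ hu hK ⟨u₁, u₂, h1, h2, h⟩
    exact ⟨push F u₁, push F u₂, ihP hF hσ le_rfl hK h1, ihQ hF hσ le_rfl hK h2,
      (hu.trans (push_mono F h)).trans_eq (push_add F u₁ u₂)⟩
  | rep a m P ih =>
    rintro B B' F σ u u' K K' hF hσ hu hK ⟨k, K₀, T, V, J, u₁, ha, h, h'⟩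
    obtain ⟨b, hb, hb'⟩ := hσ.exists_var (a := a) (by simp [ha])
    refine ⟨k, K₀, T, V, J, push F u₁, ?_, fun ι => ih (hF.lift m) (hσ.lift _)
      (push_extend F _ _).ge le_rfl (h ι), ?_⟩
    · rw [hb]
      exact hb'.trans ha
    · rw [hb]
      refine (hu.trans (push_mono F h')).trans ?_
      rw [push_comp]
      exact fun x => SU.bang_mono (push_pre_le hF hb _ _ _ x)
  | inp a m P ih =>
    rintro B B' F σ u u' K K' hF hσ hu hK ⟨T, V, J, u₁, K₁, ha, h, h', hK'⟩
    obtain ⟨b, hb, hb'⟩ := hσ.exists_var (a := a) (by simp [ha])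
    refine ⟨T, V, J, push F u₁, K₁, ?_, ih (hF.lift m) (hσ.lift _)
      (push_extend F _ _).ge le_rfl h, ?_, hK'.trans hK⟩
    · rw [hb]
      exact hb'.trans ha
    · rw [hb]
      exact (hu.trans (push_mono F h')).trans (push_pre_le hF hb _ _ _)
  | out a es P ih =>
    rintro B B' F σ u u' K K' hF hσ hu hK ⟨m, T, V, J, u₁, u₂, K₁, K₂, ha, ht, h, h', hK'⟩
    obtain ⟨b, hb, hb'⟩ := hσ.exists_var ha.ne_nat
    refine ⟨m, T, V, J, push F u₁, push F u₂, K₁, K₂, ?_, ht.subst hF hσ,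
      ih hF hσ le_rfl le_rfl h, ?_, hK'.trans hK⟩
    · rw [hb]
      exact hb'.symm ▸ ha
    · rw [hb, ← push_add]
      exact (hu.trans (push_mono F h')).trans (push_pre_le hF hb _ _ _)
  | nu P ih =>
    rintro B B' F σ u u' K K' hF hσ hu hK ⟨b, U, hU, h⟩
    refine ⟨b, U, hU, ih (hF.lift 1) (hσ.lift _) ?_ hK h⟩
    rw [push_extend]
    exact extend_le_extend le_rfl hu
  | tick P ih =>
    rintro B B' F σ u u' K K' hF hσ hu hK ⟨u₁, K₁, h, h', hK'⟩
    exact ⟨push F u₁, K₁, ih hF hσ le_rfl le_rfl h,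
      (hu.trans (push_mono F h')).trans_eq (push_comp F _ _), hK'.trans hK⟩
  | case e P Q ihP ihQ =>
    rintro B B' F σ u u' K K' hF hσ hu hK ⟨I, J, he, h1, h2⟩
    refine ⟨I, J, he.subst hσ, fun hI => ihP hF hσ hu hK (h1 hI),
      fun hJ => ihQ (hF.lift 1) (hσ.lift _) ?_ hK (h2 hJ)⟩
    rw [push_extend]
    exact extend_le_extend le_rfl hu
  | ann n P ih =>
    rintro B B' F σ u u' K K' hF hσ hu hK ⟨u₁, K₁, h, h', hK'⟩
    exact ⟨push F u₁, K₁, ih hF hσ le_rfl le_rfl h,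
      (hu.trans (push_mono F h')).trans_eq (push_comp F _ _), hK'.trans hK⟩

lemma liftSub_var_comp (k : ℕ) (f : ℕ → ℕ) :
    liftSub k (fun i => .var (f i)) = fun i => .var (liftRen k f i) := by
  funext i
  simp only [liftSub, liftRen, Expr.rename]
  split_ifs <;> rfl

lemma Expr.rename_eq_subst (f : ℕ → ℕ) : ∀ e : Expr, e.rename f = e.subst fun i => .var (f i)
  | .var _ => rfl
  | .zero => rfl
  | .succ e => congrArg Expr.succ (e.rename_eq_subst f)

lemma Proc.rename_eq_subst (P : Proc) : ∀ f : ℕ → ℕ, P.rename f = P.subst fun i => .var (f i) := by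
  induction P <;> intro f <;>
    simp_all [Proc.rename, Proc.subst, liftSub_var_comp, Expr.name, Expr.rename_eq_subst]

lemma liftRen_id (k : ℕ) : liftRen k (fun i => i) = fun i => i := by
  funext i
  simp only [liftRen]
  split_ifs <;> omega

lemma Expr.rename_id : ∀ e : Expr, e.rename (fun i => i) = e
  | .var _ => rfl
  | .zero => rfl
  | .succ e => congrArg Expr.succ e.rename_id

lemma Proc.rename_id (P : Proc) : P.rename (fun i => i) = P := by
  have h : Expr.rename (fun i => i) = id := funext Expr.rename_id
  induction P <;> simp_all [Proc.rename, liftRen_id]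

/-- Subsumption. -/
lemma Sem.mono {P : Proc} {B B' : ℕ → Base} {u u' : ℕ → SU} {K K' : ℕ∞}
    (hB : ∀ i, (B' i).Sub (B i)) (hu : u' ≤ u) (hK : K ≤ K') (h : Sem P B u K) :
    Sem P B' u' K' := by
  -- Subsumption is the substitution lemma for the identity, whose fibers are singletons.
  have := h.subst (F := fun x => {x}) (σ := .var) (B' := B') (u' := u') (K' := K')
    (fun _ _ => by simp) hB (fun x => by simpa [push] using hu x) hK
  rwa [← Proc.rename_eq_subst, Proc.rename_id] at this

lemma Sem.mono_right {P : Proc} {B : ℕ → Base} {u u' : ℕ → SU} {K K' : ℕ∞} (hu : u' ≤ u)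
    (hK : K ≤ K') (h : Sem P B u K) : Sem P B u' K' :=
  h.mono (fun _ => .refl _) hu hK

/-! ### Renaming -/

lemma extend_comp_liftRen {X : Type*} {k : ℕ} (T : Fin k → X) (B : ℕ → X) (f : ℕ → ℕ) :
    (fun i => extend T B (liftRen k f i)) = extend T (fun i => B (f i)) := by
  funext i
  rcases lt_or_exists_add i k with hi | ⟨i, rfl⟩
  · simp [liftRen, hi, extend]
  · simp [liftRen, extend_add]

lemma liftRen_injective {f : ℕ → ℕ} (hf : f.Injective) (k : ℕ) : (liftRen k f).Injective := by
  intro i j h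
  simp only [liftRen] at h
  split_ifs at h
  · exact h
  · omega
  · omega
  · have := hf (Nat.add_right_cancel h)
    omega

lemma ETy.of_rename {B : ℕ → Base} {f : ℕ → ℕ} :
    ∀ {e : Expr} {b : Base}, ETy B (e.rename f) b → ETy (fun i => B (f i)) e b
  | .var _, _, h => h
  | .zero, .nat _ _, h => h
  | .succ _, .nat _ _, ⟨I, J, h, h'⟩ => ⟨I, J, h.of_rename, h'⟩

lemma pre_comp {f : ℕ → ℕ} (hf : f.Injective) (α : Pol) (J : SCap) (a : ℕ) (u : ℕ → SU) :
    (fun i => pre α J (f a) u (f i)) = pre α J a (fun i => u (f i)) := by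
  funext i
  simp [pre, hf.eq_iff]

lemma TupTy.of_rename {B : ℕ → Base} {f : ℕ → ℕ} (hf : f.Injective) {u : ℕ → SU}
    {es : List Expr} {m : ℕ} {T : Fin m → Base} {V : Fin m → SU}
    (h : TupTy B u (es.map (Expr.rename f)) T V) :
    TupTy (fun i => B (f i)) (fun i => u (f i)) es T V := by
  obtain ⟨h1, h2, h3⟩ := h
  refine ⟨by simpa using h1, fun j e he => ?_, fun x => (h3 (f x)).trans_eq ?_⟩
  · exact (h2 j _ (by rw [List.getElem?_map, he]; rfl)).of_rename
  · refine Finset.sum_congr rfl fun j _ => ?_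
    congr 1
    rw [List.getElem?_map, eq_iff_iff, Option.map_eq_some_iff]
    constructor
    · rintro ⟨e, he, he'⟩
      obtain ⟨y, rfl, hy⟩ := Expr.rename_eq_var.1 he'
      rw [he, hf hy]
    · exact fun h => ⟨_, h, rfl⟩

/-- Injectivity keeps names apart, so the context can be read back along `f`; its entries outside
the range of `f` are forgotten. -/
lemma Sem.of_rename {P : Proc} : ∀ {B : ℕ → Base} {f : ℕ → ℕ} {u : ℕ → SU} {K : ℕ∞},
    f.Injective → Sem (P.rename f) B u K → Sem P (fun i => B (f i)) (fun i => u (f i)) K := by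
  induction P with
  | nil => intros; trivial
  | par P Q ihP ihQ =>
    rintro B f u K hf ⟨u₁, u₂, h1, h2, h⟩
    exact ⟨fun i => u₁ (f i), fun i => u₂ (f i), ihP hf h1, ihQ hf h2, fun i => h (f i)⟩
  | rep a m P ih =>
    rintro B f u K hf ⟨k, K₀, T, V, J, u₁, ha, h, h'⟩
    refine ⟨k, K₀, T, V, J, fun i => u₁ (f i), ha, fun ι => ?_, fun i => (h' (f i)).trans_eq ?_⟩
    · rw [← extend_comp_liftRen _ B, ← extend_comp_liftRen _ u₁]
      exact ih (liftRen_injective hf m) (h ι)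
    · rw [← pre_comp hf]
  | inp a m P ih =>
    rintro B f u K hf ⟨T, V, J, u₁, K₁, ha, h, h', hK⟩
    refine ⟨T, V, J, fun i => u₁ (f i), K₁, ha, ?_, fun i => (h' (f i)).trans_eq ?_, hK⟩
    · rw [← extend_comp_liftRen _ B, ← extend_comp_liftRen _ u₁]
      exact ih (liftRen_injective hf m) h
    · rw [← pre_comp hf]
  | out a es P ih =>
    rintro B f u K hf ⟨m, T, V, J, u₁, u₂, K₁, K₂, ha, ht, h, h', hK⟩
    refine ⟨m, T, V, J, fun i => u₁ (f i), fun i => u₂ (f i), K₁, K₂, ha, ht.of_rename hf, ih hf h,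
      fun i => (h' (f i)).trans_eq ?_, hK⟩
    exact congrFun (pre_comp hf _ _ a (u₁ + u₂)) i
  | nu P ih =>
    rintro B f u K hf ⟨b, U, hU, h⟩
    refine ⟨b, U, hU, ?_⟩
    rw [← extend_comp_liftRen _ B, ← extend_comp_liftRen _ u]
    exact ih (liftRen_injective hf 1) h
  | tick P ih =>
    rintro B f u K hf ⟨u₁, K₁, h, h', hK⟩
    exact ⟨fun i => u₁ (f i), K₁, ih hf h, fun i => h' (f i), hK⟩
  | case e P Q ihP ihQ =>
    rintro B f u K hf ⟨I, J, he, h1, h2⟩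
    refine ⟨I, J, he.of_rename, fun hI => ihP hf (h1 hI), fun hJ => ?_⟩
    rw [← extend_comp_liftRen _ B, ← extend_comp_liftRen _ u]
    exact ihQ (liftRen_injective hf 1) (h2 hJ)
  | ann n P ih =>
    rintro B f u K hf ⟨u₁, K₁, h, h', hK⟩
    exact ⟨fun i => u₁ (f i), K₁, ih hf h, fun i => h' (f i), hK⟩

/-- The converse is the substitution lemma: fibers have at most one element, and an empty fiber
gives the empty sum `0`, which dominates every usage. -/
lemma sem_rename_iff {P : Proc} {B : ℕ → Base} {f : ℕ → ℕ} {u : ℕ → SU} {K : ℕ∞}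
    (hf : f.Injective) :
    Sem (P.rename f) B u K ↔ Sem P (fun i => B (f i)) (fun i => u (f i)) K := by
  classical
  refine ⟨Sem.of_rename hf, fun h => ?_⟩
  rw [Proc.rename_eq_subst]
  refine h.subst (F := fun x => if h : ∃ i, f i = x then {h.choose} else ∅) ?_
    (fun i => .refl _) ?_ le_rfl
  · intro i x
    dsimp only
    split_ifs with hx
    · rw [Finset.mem_singleton, Expr.var.injEq]
      constructor
      · rintro rfl
        exact hx.choose_spec
      · exact fun hi => hf (hi.trans hx.choose_spec.symm)
    · simpa using fun hi => hx ⟨i, hi⟩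
  · intro x
    dsimp only [push]
    split_ifs with hx
    · rw [Finset.sum_singleton, hx.choose_spec]
    · exact SU.le_zero _

end PiUsage

namespace PiUsage

/-! ### Congruence -/

@[simp] lemma extend_one_zero {X : Type*} (T : Fin 1 → X) (B : ℕ → X) : extend T B 0 = T 0 := rfl

@[simp] lemma extend_one_succ {X : Type*} (T : Fin 1 → X) (B : ℕ → X) (i : ℕ) :
    extend T B (i + 1) = B i := rfl

lemma extend_swapRen {X : Type*} (b c : X) (B : ℕ → X) :
    (fun i => extend (m := 1) (fun _ => b) (extend (m := 1) (fun _ => c) B) (swapRen i)) =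
      extend (m := 1) (fun _ => c) (extend (m := 1) (fun _ => b) B) := by
  funext i
  match i with
  | 0 | 1 | i + 2 => rfl

lemma swapRen_injective : swapRen.Injective :=
  Function.LeftInverse.injective (g := swapRen) fun i => match i with
    | 0 | 1 | _ + 2 => rfl

lemma extend_one_add {m : ℕ} (U V : Fin m → SU) (u v : ℕ → SU) :
    extend (U + V) (u + v) = extend U u + extend V v := by
  funext i
  simp only [extend, Pi.add_apply]
  split_ifs <;> rfl

lemma sem_nu_swap (P : Proc) : Sem (.nu (.nu P)) = Sem (.nu (.nu (P.rename swapRen))) := by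
  funext B u K
  simp only [Sem, eq_iff_iff, sem_rename_iff swapRen_injective, extend_swapRen]
  constructor <;>
  · rintro ⟨b, U, hU, c, V, hV, h⟩
    exact ⟨c, V, hV, b, U, hU, h⟩

lemma sem_nu_par (P Q : Proc) :
    Sem (.nu (.par P (Q.rename (· + 1)))) = Sem (.par (.nu P) Q) := by
  funext B u K
  simp only [Sem, eq_iff_iff, sem_rename_iff (add_left_injective 1), extend_one_succ]
  constructor
  · rintro ⟨b, U, hU, u₁, u₂, h1, h2, h⟩
    -- The hidden usage is replaced by the share `u₁ 0` of `P`, which is larger and therefore still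
    -- safe.
    refine ⟨fun i => u₁ (i + 1), fun i => u₂ (i + 1), ⟨b, u₁ 0, ?_, ?_⟩, h2, fun i => h (i + 1)⟩
    · exact hU.mono ((h 0).trans (SU.add_le_left _ _))
    · convert h1 using 1
      funext i
      cases i <;> rfl
  · rintro ⟨u₁, u₂, ⟨b, U, hU, h1⟩, h2, h⟩
    -- The process `Q` receives usage `0` at the new name.
    refine ⟨b, U, hU, _, extend (m := 1) 0 u₂, h1, h2, ?_⟩
    rw [← extend_one_add]
    exact extend_le_extend (le_of_eq (add_zero _).symm) h

/-- Crossing the restriction shifts the hidden usage by the finite `m`, which preserves and reflects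
safety. -/
lemma sem_ann_nu (m : ℕ) (P : Proc) : Sem (.ann m (.nu P)) = Sem (.nu (.ann m P)) := by
  funext B u K
  simp only [Sem, eq_iff_iff]
  constructor
  · rintro ⟨u₁, K₁, ⟨b, U, hU, h⟩, h', hK⟩
    refine ⟨b, SU.delay (.pt m) U, (SU.safe_delay_pt m U).2 hU, _, K₁, h, fun i => ?_, hK⟩
    cases i with
    | zero => exact le_rfl
    | succ i => exact h' i
  · rintro ⟨b, U, hU, u₁, K₁, h, h', hK⟩
    refine ⟨fun i => u₁ (i + 1), K₁, ⟨b, u₁ 0, ?_, ?_⟩, fun i => h' (i + 1), hK⟩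
    · exact (SU.safe_delay_pt m _).1 (hU.mono (h' 0))
    · convert h using 1
      funext i
      cases i <;> rfl

lemma sem_ann_ann (m n : ℕ) (P : Proc) : Sem (.ann m (.ann n P)) = Sem (.ann (m + n) P) := by
  funext B u K
  simp only [Sem, eq_iff_iff]
  constructor
  · rintro ⟨u₁, K₁, ⟨u₂, K₂, h, h1, hK1⟩, h2, hK2⟩
    refine ⟨u₂, K₂, h, fun i => ?_, ?_⟩
    · refine (h2 i).trans ((SU.delay_mono _ (h1 i)).trans_eq ?_)
      rw [SU.delay_delay, SItv.pt_add]
    · rw [Nat.cast_add, add_comm (m : ℕ∞), ← add_assoc]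
      exact (add_le_add hK1 le_rfl).trans hK2
  · rintro ⟨u₁, K₁, h, h', hK⟩
    refine ⟨_, _, ⟨u₁, K₁, h, le_rfl, le_rfl⟩, fun i => ?_, ?_⟩
    · simp only [SU.delay_delay, SItv.pt_add]
      exact h' i
    · rwa [add_assoc, add_comm (n : ℕ∞), ← Nat.cast_add]

lemma sem_ann_par (m : ℕ) (P Q : Proc) :
    Sem (.ann m (.par P Q)) = Sem (.par (.ann m P) (.ann m Q)) := by
  funext B u K
  simp only [Sem, eq_iff_iff]
  constructor
  · rintro ⟨u', K', ⟨u₁, u₂, h1, h2, h⟩, h', hK⟩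
    refine ⟨_, _, ⟨u₁, K', h1, le_rfl, hK⟩, ⟨u₂, K', h2, le_rfl, hK⟩, fun i => ?_⟩
    exact (h' i).trans ((SU.delay_mono _ (h i)).trans_eq (map_add _ _ _))
  · rintro ⟨v₁, v₂, ⟨u₁, K₁, h1, hv1, hK1⟩, ⟨u₂, K₂, h2, hv2, hK2⟩, h⟩
    refine ⟨u₁ + u₂, max K₁ K₂, ⟨u₁, u₂, h1.mono_right le_rfl (le_max_left _ _),
      h2.mono_right le_rfl (le_max_right _ _), le_rfl⟩, fun i => ?_, ?_⟩
    · exact (h i).trans ((add_le_add (hv1 i) (hv2 i)).trans_eq (map_add _ _ _).symm)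
    · rw [← max_add_add_right]
      exact max_le hK1 hK2

lemma sem_par_comm (P Q : Proc) : Sem (.par P Q) = Sem (.par Q P) := by
  funext B u K
  simp only [Sem, eq_iff_iff]
  constructor <;>
  · rintro ⟨u₁, u₂, h1, h2, h⟩
    exact ⟨u₂, u₁, h2, h1, h.trans_eq (add_comm _ _)⟩

/-- Congruent processes have the same semantic types. -/
lemma Proc.Congr.sem_eq {P Q : Proc} (h : Proc.Congr P Q) : Sem P = Sem Q := by
  induction h with
  | refl => rfl
  | symm _ ih => exact ih.symm
  | trans _ _ ih1 ih2 => exact ih1.trans ih2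
  | par_congr _ _ ih1 ih2 => funext B u K; simp only [Sem, ih1, ih2]
  | rep_congr a k _ ih => funext B u K; simp only [Sem, ih]
  | inp_congr a k _ ih => funext B u K; simp only [Sem, ih]
  | out_congr a es _ ih => funext B u K; simp only [Sem, ih]
  | nu_congr _ ih => funext B u K; simp only [Sem, ih]
  | tick_congr _ ih => funext B u K; simp only [Sem, ih]
  | case_congr e _ _ ih1 ih2 => funext B u K; simp only [Sem, ih1, ih2]
  | ann_congr m _ ih => funext B u K; simp only [Sem, ih]
  | par_nil P =>
    funext B u K
    simp only [Sem, eq_iff_iff]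
    constructor
    · rintro ⟨u₁, u₂, h1, -, h⟩
      exact h1.mono_right (h.trans fun i => SU.add_le_left _ _) le_rfl
    · exact fun h => ⟨u, 0, h, trivial, (add_zero u).ge⟩
  | par_comm P Q => exact sem_par_comm P Q
  | par_assoc P Q R =>
    funext B u K
    simp only [Sem, eq_iff_iff]
    constructor
    · rintro ⟨u₁, _, h1, ⟨u₂, u₃, h2, h3, h'⟩, h⟩
      refine ⟨_, u₃, ⟨u₁, u₂, h1, h2, le_rfl⟩, h3, h.trans ?_⟩
      rw [add_assoc]
      exact add_le_add le_rfl h'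
    · rintro ⟨_, u₃, ⟨u₁, u₂, h1, h2, h'⟩, h3, h⟩
      refine ⟨u₁, _, h1, ⟨u₂, u₃, h2, h3, le_rfl⟩, h.trans ?_⟩
      rw [← add_assoc]
      exact add_le_add h' le_rfl
  | nu_swap P => exact sem_nu_swap P
  | nu_par P Q => exact sem_nu_par P Q
  | ann_zero P =>
    funext B u K
    simp only [Sem, eq_iff_iff, SItv.pt_zero, SU.delay_zero, Nat.cast_zero, add_zero]
    constructor
    · rintro ⟨u₁, K₁, h, h', hK⟩
      exact h.mono_right h' hK
    · exact fun h => ⟨u, K, h, le_rfl, le_rfl⟩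
  | ann_par m P Q => exact sem_ann_par m P Q
  | ann_nu m P => exact sem_ann_nu m P
  | ann_ann m n P => exact sem_ann_ann m n P

/-! ### Subject reduction -/

/-- The fibers of the substitution of a tuple. -/
noncomputable def instFiber (es : List Expr) : ℕ → Finset ℕ := fun x => open Classical in
  -- The variable `x` is reached from its own copy, shifted past the tuple, and from each position
  -- at which it is passed.
  insert (x + es.length) ((Finset.range es.length).filter fun i => es[i]? = some (.var x))

lemma isFiber_instSub (es : List Expr) : IsFiber (instFiber es) (instSub es) := by
  intro i x
  rcases lt_or_exists_add i es.length with hi | ⟨i, rfl⟩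
  · have : i ≠ x + es.length := by omega
    simp [instFiber, instSub, hi, this]
  · simp [instFiber, instSub]

lemma push_extend_instFiber {m : ℕ} (es : List Expr) (hm : es.length = m) (V : Fin m → SU)
    (u : ℕ → SU) (x : ℕ) : push (instFiber es) (extend V u) x =
      u x + ∑ j : Fin m, open Classical in if es[(j : ℕ)]? = some (.var x) then V j else 0 := by
  classical
  subst hm
  unfold push instFiber
  rw [Finset.sum_insert (by simp), extend_add, Finset.sum_filter, Finset.sum_range]
  congr 1
  refine Finset.sum_congr rfl fun j _ => ?_
  split_ifs
  · exact extend_lt V u j.2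
  · rfl

lemma TupTy.substTy {B : ℕ → Base} {u : ℕ → SU} {es : List Expr} {m : ℕ} {T : Fin m → Base}
    {V : Fin m → SU} (h : TupTy B u es T V) : SubstTy B (instSub es) (extend T B) := by
  obtain ⟨rfl, h, -⟩ := h
  intro i
  rcases lt_or_exists_add i es.length with hi | ⟨i, rfl⟩
  · rw [extend_lt _ _ hi]
    refine h ⟨i, hi⟩ _ ?_
    simp [instSub, hi]
  · rw [extend_add]
    simp only [instSub, List.getElem?_eq_none (Nat.le_add_left _ _), Nat.add_sub_cancel]
    exact .refl _

/-- Typing of the substitution of a tuple. -/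
lemma Sem.inst {P : Proc} {B : ℕ → Base} {u v : ℕ → SU} {K : ℕ∞} {es : List Expr} {m : ℕ}
    {T : Fin m → Base} {V : Fin m → SU} (h : Sem P (extend T B) (extend V u) K)
    (ht : TupTy B v es T V) : Sem (P.subst (instSub es)) B (u + v) K := by
  refine h.subst (isFiber_instSub es) ht.substTy (fun x => ?_) le_rfl
  rw [push_extend_instFiber es ht.1]
  exact add_le_add le_rfl (ht.2.2 x)

/-- The times of two actions that agree. -/
lemma Agree.pt {n m : ℕ} {I J : SCap} (h : Agree (.pt n) (.pt m) I J) :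
    (SItv.sup (.pt n) (.pt m)).Sub (SItv.pt n + I.toItv) ∧
      (SItv.sup (.pt n) (.pt m)).Sub (SItv.pt m + J.toItv) := by
  refine ⟨h.1.sup_sub, ?_⟩
  have hs : SItv.sup (.pt n) (.pt m) = SItv.sup (.pt m) (.pt n) := by
    ext <;> simp [SItv.sup, max_comm]
  rw [hs]
  exact h.2.sup_sub

/-- A capacity with infinite lower end is compatible with no finite time, so the exceptional value
of `J_c;K` cannot occur at a communication. -/
lemma SCap.Compat.seq_eq {n m : ℕ} {I : SCap} (h : I.Compat (.pt n) (.pt m)) (K : ℕ∞) :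
    I.seq K = I.toItv.hi + K := by
  cases I with
  | upTo J => rfl
  | itv A =>
    simp only [SCap.seq, SCap.toItv]
    rw [if_neg]
    intro hA
    have := h.1
    simp [hA, SItv.pt] at this

/-- Compatibility bounds the wait: `max n m` is at most `n` plus the upper capacity, which `J_c;K`
already counts. -/
lemma SCap.Compat.add_max_le {n m : ℕ} {I : SCap} {K K' : ℕ∞} (h : I.Compat (.pt n) (.pt m))
    (hK : I.seq K + n ≤ K') : K + (max n m : ℕ) ≤ K' := by
  rw [h.seq_eq] at hK
  refine le_trans ?_ hK
  have := h.sup_sub.2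
  rw [SItv.pt_sup] at this
  calc K + (max n m : ℕ) ≤ K + (n + I.toItv.hi) := add_le_add le_rfl this
    _ = _ := by ring

/-- The usages before a communication on `a` can be replaced by those of the reduct. -/
lemma pre_comm_le {n m a : ℕ} {I J : SCap} {u v w : ℕ → SU} (hw : ∀ x, (w x).Safe)
    (h : w ≤ fun x => SU.delay (.pt n) (pre .inp I a u x) + SU.delay (.pt m) (pre .out J a v x)) :
    Agree (.pt n) (.pt m) I J ∧ w ≤ fun x => SU.delay (.pt (max m n)) (u x + v x) := by
  have ha : w a ≤ SU.act .inp (.pt n) I (u a) + SU.act .out (.pt m) J (v a) := by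
    have := h a
    simpa only [pre, if_true, SU.delay_act, add_zero] using this
  -- Safety of the usage of `a` forces the two ends to agree.
  have hc : Agree (.pt n) (.pt m) I J := ((hw a).mono ha).agree
  refine ⟨hc, fun x => ?_⟩
  rw [max_comm, ← SItv.pt_sup]
  by_cases hx : x = a
  · subst hx
    exact ha.trans (SU.comm_le _ _ _ _ _ _)
  -- On other names each side was delayed by its time plus its capacity, an interval that contains
  -- the communication time.
  · refine (h x).trans ?_
    simp only [pre, if_neg hx, SU.delay_delay, map_add]
    exact add_le_add (SU.delay_le_of_sub hc.pt.1 _) (SU.delay_le_of_sub hc.pt.2 _)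

/-- Typing of the reduct of a communication. -/
lemma sem_comm {P Q : Proc} {B : ℕ → Base} {n m a r : ℕ} {I J : SCap} {u v₁ v₂ w : ℕ → SU}
    {K K₁ K₂ : ℕ∞} {es : List Expr} {T : Fin r → Base} {V : Fin r → SU} (hw : ∀ x, (w x).Safe)
    (hP : Sem P (extend T B) (extend V u) K₁) (ht : TupTy B v₂ es T V) (hQ : Sem Q B v₁ K₂)
    (h : w ≤ fun x =>
      SU.delay (.pt n) (pre .inp I a u x) + SU.delay (.pt m) (pre .out J a (v₁ + v₂) x))
    (hK₁ : Agree (.pt n) (.pt m) I J → K₁ + (max m n : ℕ) ≤ K)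
    (hK₂ : Agree (.pt n) (.pt m) I J → K₂ + (max m n : ℕ) ≤ K) :
    Sem (.ann (max m n) (.par (P.subst (instSub es)) Q)) B w K := by
  obtain ⟨hc, hw'⟩ := pre_comm_le hw h
  refine ⟨u + v₂ + v₁, max K₁ K₂, ⟨u + v₂, v₁, (hP.inst ht).mono_right le_rfl (le_max_left _ _),
    hQ.mono_right le_rfl (le_max_right _ _), le_rfl⟩, fun x => (hw' x).trans_eq ?_, ?_⟩
  · simp only [Pi.add_apply]
    rw [add_assoc, add_comm (v₂ x)]
  · rw [← max_add_add_right]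
    exact max_le (hK₁ hc) (hK₂ hc)

lemma ETy.pred {B : ℕ → Base} {e : Expr} {I J : ℕ∞} (h : ETy B (.succ e) (.nat I J)) :
    1 ≤ J ∧ ETy B e (.nat (I - 1) (J - 1)) := by
  obtain ⟨I', J', h, hI, hJ⟩ := h
  refine ⟨le_trans le_add_self hJ, h.sub (.nat (tsub_le_iff_right.2 hI) ?_)⟩
  exact ENat.le_sub_of_add_le_right (by simp) hJ

/-- Subject reduction: because the order on usages is closed under reduction, the context does not
change. -/
lemma Proc.Red.sem {P Q : Proc} (h : Proc.Red P Q) : ∀ {B : ℕ → Base} {u : ℕ → SU} {K : ℕ∞},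
    (∀ x, (u x).Safe) → Sem P B u K → Sem Q B u K := by
  induction h with
  | comm n m a k P es Q hes _ =>
    rintro B u K hu ⟨w₁, w₂, ⟨y₁, L₁, ⟨T, V, I, u₁, K₁, ha, hP, hy₁, hL₁⟩, hw₁, hK₁⟩,
      ⟨y₂, L₂, ⟨r, T', V', J, v₁, v₂, K₂, K₃, hs, ht, hQ, hy₂, hL₂⟩, hw₂, hK₂⟩, hw⟩
    obtain rfl : r = k := ht.1.symm.trans hes
    rw [ha] at hs
    cases hs
    refine sem_comm (n := n) (m := m) (a := a) (I := I) (J := J) hu hP ht hQ (fun x => ?_)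
      (fun hc => max_comm n m ▸ hc.1.add_max_le ((add_le_add hL₁ le_rfl).trans hK₁))
      fun hc => (add_le_add (le_max_left _ _) le_rfl).trans
        (hc.2.add_max_le ((add_le_add hL₂ le_rfl).trans hK₂))
    exact (hw x).trans (add_le_add ((hw₁ x).trans (SU.delay_mono _ (hy₁ x)))
      ((hw₂ x).trans (SU.delay_mono _ (hy₂ x))))
  | comm_rep n m a k P es Q hes _ =>
    rintro B u K hu ⟨w₁, w₂, ⟨y₁, L₁, ⟨k', K₀, T, V, I, u₁, ha, hP, hy₁⟩, hw₁, hK₁⟩,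
      ⟨y₂, L₂, ⟨r, T', V', J, v₁, v₂, K₂, K₃, hs, ht, hQ, hy₂, hL₂⟩, hw₂, hK₂⟩, hw⟩
    obtain rfl : r = k := ht.1.symm.trans hes
    rw [ha] at hs
    cases hs with
    | serv _ _ _ _ ι =>
    set w : ℕ → SU := fun x =>
      SU.delay (.pt n) (pre .inp I a u₁ x) + SU.delay (.pt m) (pre .out J a (v₁ + v₂) x) with hwdef
    set z : ℕ → SU := fun x => SU.delay (.pt n) (SU.bang (pre .inp I a u₁ x)) with hzdef
    -- One copy is unfolded from the replication: `z` stays with the server and `w` is spent by the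
    -- communication.
    have hle : u ≤ z + w := by
      intro x
      refine (hw x).trans ((add_le_add ((hw₁ x).trans (SU.delay_mono _ (hy₁ x)))
        ((hw₂ x).trans (SU.delay_mono _ (hy₂ x)))).trans_eq ?_)
      simp only [Pi.add_apply, hwdef, hzdef]
      conv_lhs => rw [SU.bang_unfold, map_add]
      rw [add_assoc]
    refine ⟨z, w, ⟨fun x => SU.bang (pre .inp I a u₁ x), L₁,
      ⟨k', K₀, T, V, I, u₁, ha, hP, le_rfl⟩, le_rfl, hK₁⟩, ?_, hle⟩
    refine sem_comm (n := n) (m := m) (a := a) (I := I) (J := J)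
      (fun x => (hu x).mono ((hle x).trans (SU.add_le_right _ _))) (hP ι) ht hQ le_rfl
      -- The sender pays for the server body: `K₀ ι` is the second entry of the maximum in its
      -- bound.
      (fun hc => (add_le_add (le_max_right _ _) le_rfl).trans
        (hc.2.add_max_le ((add_le_add hL₂ le_rfl).trans hK₂)))
      fun hc => (add_le_add (le_max_left _ _) le_rfl).trans
        (hc.2.add_max_le ((add_le_add hL₂ le_rfl).trans hK₂))
  -- The clauses of `tick.P` and `1 : P` coincide.
  | tick P => exact fun _ h => by simpa [Sem] using h
  | case_zero P Q =>
    rintro B u K _ ⟨I, J, he, h, -⟩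
    exact h he
  | case_succ e P Q _ =>
    rintro B u K _ ⟨I, J, he, -, h⟩
    obtain ⟨hJ, he⟩ := he.pred
    -- The predecessor has an integer type, so passing it requires usage `0`.
    have := (h hJ).inst (es := [e]) (v := 0) ⟨rfl, fun j e' he' => ?_, fun x => ?_⟩
    · rwa [add_zero] at this
    · obtain rfl : j = 0 := Subsingleton.elim _ _
      cases he'
      exact he
    · simp
  | par R _ ih =>
    rintro B u K hu ⟨u₁, u₂, h1, h2, h⟩
    exact ⟨u₁, u₂, ih (fun x => (hu x).mono ((h x).trans (SU.add_le_left _ _))) h1, h2, h⟩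
  | nu _ ih =>
    rintro B u K hu ⟨b, U, hU, h⟩
    refine ⟨b, U, hU, ih (fun x => ?_) h⟩
    cases x with
    | zero => exact hU
    | succ x => exact hu x
  | ann n _ ih =>
    rintro B u K hu ⟨u₁, K₁, h, h', hK⟩
    exact ⟨u₁, K₁, ih (fun x => (SU.safe_delay_pt n _).1 ((hu x).mono (h' x))) h, h', hK⟩
  | congr h1 _ h2 ih =>
    intro B u K hu h
    rw [h1.sem_eq] at h
    rw [← h2.sem_eq]
    exact ih hu h

/-- The semantic type of a process bounds its span. -/
lemma Sem.span_le {P : Proc} {B : ℕ → Base} {u : ℕ → SU} {K : ℕ∞} (hu : ∀ x, (u x).Safe)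
    (h : Sem P B u K) : P.span ≤ K := by
  refine sSup_le ?_
  rintro _ ⟨Q, hQ, rfl⟩
  refine Sem.localComplexity_le (B := B) (u := u) ?_
  induction hQ with
  | refl => exact h
  | tail _ hr ih => exact hr.sem hu ih

end PiUsage

namespace PiUsage

/-! ## Interpretation of indices and usages -/

variable {S : IndexSig} {n : ℕ}

lemma FinIdx.eval_subst {m : ℕ} (σ : Fin n → FinIdx S m) (ρ : Fin m → ℕ) (I : FinIdx S n) :
    (I.subst σ).eval ρ = I.eval fun i => (σ i).eval ρ := by
  induction I with
  | var i => rfl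
  | const c => rfl
  | op o I J hI hJ => simp only [FinIdx.subst, FinIdx.eval, hI, hJ]
  | app f args ih => simp only [FinIdx.subst, FinIdx.eval, ih]

lemma Idx.eval_subst {m : ℕ} (σ : Fin n → FinIdx S m) (ρ : Fin m → ℕ) (I : Idx S n) :
    (I.subst σ).eval ρ = I.eval fun i => (σ i).eval ρ := by
  cases I with
  | fin I => simp [Idx.subst, Idx.eval, FinIdx.eval_subst]
  | top => rfl

@[simp] lemma Idx.eval_const (ρ : Fin n → ℕ) (c : ℕ) : (Idx.const c : Idx S n).eval ρ = c := rfl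

@[simp] lemma Idx.eval_add (ρ : Fin n → ℕ) (I J : Idx S n) :
    (I.add J).eval ρ = I.eval ρ + J.eval ρ := by
  cases I <;> cases J <;> simp [Idx.add, Idx.eval, FinIdx.eval, BinOp.eval]

@[simp] lemma Idx.eval_max (ρ : Fin n → ℕ) (I J : Idx S n) :
    (I.max J).eval ρ = Max.max (I.eval ρ) (J.eval ρ) := by
  cases I <;> cases J <;>
    simp [Idx.max, Idx.eval, FinIdx.eval, BinOp.eval, (Nat.mono_cast (α := ℕ∞)).map_max]

@[simp] lemma Idx.eval_pred (ρ : Fin n → ℕ) (I : Idx S n) :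
    I.pred.eval ρ = I.eval ρ - 1 := by
  cases I <;> simp [Idx.pred, Idx.eval, FinIdx.eval, BinOp.eval]

/-! ### Intervals, capacities and usages at a valuation. -/

/-- Well-formedness under a valuation. -/
def Itv.WFAt (ρ : Fin n → ℕ) (A : Itv S n) : Prop := A.lo.eval ρ ≤ A.hi.eval ρ

def Cap.WFAt (ρ : Fin n → ℕ) : Cap S n → Prop
  | .upTo _ => True
  | .itv A => A.WFAt ρ

def Usage.WFAt (ρ : Fin n → ℕ) : Usage S n → Prop
  | .zero => True
  | .par U V => U.WFAt ρ ∧ V.WFAt ρ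
  | .act _ A J U => A.WFAt ρ ∧ J.WFAt ρ ∧ U.WFAt ρ
  | .bang U => U.WFAt ρ
  | .choice U V => U.WFAt ρ ∧ V.WFAt ρ

lemma Itv.WF.at {Φ : Constraints S n} {A : Itv S n} (h : A.WF Φ) {ρ : Fin n → ℕ} (hρ : Φ.Sat ρ) :
    A.WFAt ρ := h ρ hρ

lemma Cap.WF.at {Φ : Constraints S n} {ρ : Fin n → ℕ} (hρ : Φ.Sat ρ) :
    ∀ {J : Cap S n}, J.WF Φ → J.WFAt ρ
  | .upTo _, _ => trivial
  | .itv _, h => h ρ hρ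

lemma Usage.WF.at {Φ : Constraints S n} {ρ : Fin n → ℕ} (hρ : Φ.Sat ρ) :
    ∀ {U : Usage S n}, U.WF Φ → U.WFAt ρ
  | .zero, _ => trivial
  | .par _ _, h => ⟨Usage.WF.at hρ h.1, Usage.WF.at hρ h.2⟩
  | .act _ _ _ _, h => ⟨h.1.at hρ, Cap.WF.at hρ h.2.1, Usage.WF.at hρ h.2.2⟩
  | .bang U, h => Usage.WF.at (U := U) hρ h
  | .choice _ _, h => ⟨Usage.WF.at hρ h.1, Usage.WF.at hρ h.2⟩

/-- The value of an interval; the upper bound of an ill-formed one is raised. -/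
noncomputable def Itv.val (ρ : Fin n → ℕ) (A : Itv S n) : SItv :=
  ⟨A.lo.eval ρ, Max.max (A.lo.eval ρ) (A.hi.eval ρ), le_max_left _ _⟩

noncomputable def Cap.val (ρ : Fin n → ℕ) : Cap S n → SCap
  | .upTo J => .upTo (J.eval ρ)
  | .itv A => .itv (A.val ρ)

noncomputable def Usage.raw (ρ : Fin n → ℕ) : Usage S n → RU
  | .zero => .zero
  | .par U V => .par (U.raw ρ) (V.raw ρ)
  | .act α A J U => .act α (A.val ρ) (J.val ρ) (U.raw ρ)
  | .bang U => .bang (U.raw ρ)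
  | .choice U V => .choice (U.raw ρ) (V.raw ρ)

/-- The interpretation of a usage. -/
noncomputable def Usage.val (ρ : Fin n → ℕ) (U : Usage S n) : SU := .mk (U.raw ρ)

@[simp] lemma Itv.val_lo (ρ : Fin n → ℕ) (A : Itv S n) : (A.val ρ).lo = A.lo.eval ρ := rfl

lemma Itv.WFAt.val_hi {ρ : Fin n → ℕ} {A : Itv S n} (h : A.WFAt ρ) :
    (A.val ρ).hi = A.hi.eval ρ := max_eq_right h

lemma Itv.WFAt.add {ρ : Fin n → ℕ} {A B : Itv S n} (hA : A.WFAt ρ) (hB : B.WFAt ρ) :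
    (A.add B).WFAt ρ := by
  simpa [Itv.WFAt, Itv.add] using add_le_add hA hB

lemma Itv.WFAt.sup {ρ : Fin n → ℕ} {A B : Itv S n} (hA : A.WFAt ρ) (hB : B.WFAt ρ) :
    (A.sup B).WFAt ρ := by
  simpa only [Itv.WFAt, Itv.sup, Idx.eval_max] using max_le_max hA hB

lemma Itv.wfAt_point (ρ : Fin n → ℕ) (c : ℕ) : (Itv.point c : Itv S n).WFAt ρ :=
  le_refl (c : ℕ∞)

lemma Itv.val_point (ρ : Fin n → ℕ) (c : ℕ) : (Itv.point c : Itv S n).val ρ = .pt c := by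
  ext <;> simp [Itv.val, Itv.point, SItv.pt]

lemma Itv.val_add {ρ : Fin n → ℕ} {A B : Itv S n} (hA : A.WFAt ρ) (hB : B.WFAt ρ) :
    (A.add B).val ρ = A.val ρ + B.val ρ := by
  ext
  · simp [Itv.add]
  · rw [(hA.add hB).val_hi, SItv.add_hi, hA.val_hi, hB.val_hi]
    simp [Itv.add]

lemma Itv.val_sup {ρ : Fin n → ℕ} {A B : Itv S n} (hA : A.WFAt ρ) (hB : B.WFAt ρ) :
    (A.sup B).val ρ = (A.val ρ).sup (B.val ρ) := by
  ext
  · simp [Itv.sup, SItv.sup]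
  · rw [(hA.sup hB).val_hi, SItv.sup]
    simp only [hA.val_hi, hB.val_hi]
    simp [Itv.sup]

lemma Itv.WFAt.addCap {ρ : Fin n → ℕ} {A : Itv S n} {J : Cap S n} (hA : A.WFAt ρ)
    (hJ : J.WFAt ρ) : (A.addCap J).WFAt ρ := by
  cases J with
  | upTo J =>
    simp only [Itv.WFAt, Itv.addCap, Idx.eval_add]
    exact hA.trans le_self_add
  | itv B => exact hA.add hJ

lemma Itv.val_addCap {ρ : Fin n → ℕ} {A : Itv S n} {J : Cap S n} (hA : A.WFAt ρ)
    (hJ : J.WFAt ρ) : (A.addCap J).val ρ = A.val ρ + (J.val ρ).toItv := by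
  cases J with
  | upTo J =>
    ext
    · simp [Itv.addCap, Cap.val, SCap.toItv]
    · rw [(hA.addCap (J := .upTo J) hJ).val_hi, SItv.add_hi, hA.val_hi]
      simp [Itv.addCap, Cap.val, SCap.toItv]
  | itv B => exact Itv.val_add hA hJ

lemma Itv.Subset.sub {ρ : Fin n → ℕ} {A B : Itv S n} (hA : A.WFAt ρ) (hB : B.WFAt ρ)
    (h : A.Subset ρ B) : (A.val ρ).Sub (B.val ρ) :=
  ⟨h.1, by rw [hA.val_hi, hB.val_hi]; exact h.2⟩

lemma Cap.Le.le {ρ : Fin n → ℕ} {I J : Cap S n} (hI : I.WFAt ρ) (hJ : J.WFAt ρ)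
    (h : I.Le ρ J) : (I.val ρ).Le (J.val ρ) := by
  cases I with
  | upTo I =>
    cases J with
    | upTo J => exact h
    | itv B => exact h.elim
  | itv A =>
    cases J with
    | upTo J =>
      change (A.val ρ).hi ≤ _
      rw [Itv.WFAt.val_hi hI]
      exact h
    | itv B => exact Itv.Subset.sub hI hJ h

lemma subset_oplus_iff {ρ : Fin n → ℕ} {A B : Itv S n} {J : Cap S n} (hA : A.WFAt ρ)
    (hB : B.WFAt ρ) (hJ : J.WFAt ρ) :
    B.Subset ρ (A.oplus J) ↔ (J.val ρ).Compat (A.val ρ) (B.val ρ) := by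
  cases J with
  | upTo J => simp [Itv.Subset, Itv.oplus, Cap.val, SCap.Compat, hB.val_hi]
  | itv C => simp [Itv.Subset, Itv.oplus, Cap.val, SCap.Compat, hA.val_hi, hB.val_hi,
      Itv.WFAt.val_hi (A := C) hJ]

lemma Cap.hi_seq {ρ : Fin n → ℕ} {J : Cap S n} (hJ : J.WFAt ρ) (K : Itv S n) :
    (J.seq K).hi.eval ρ = (J.val ρ).seq (K.hi.eval ρ) := by
  match J with
  | .upTo J => simp [Cap.seq, Cap.val, SCap.seq]
  | .itv ⟨.top, J⟩ =>
    simp only [Cap.seq, Cap.val, SCap.seq, Itv.point, Idx.eval_const]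
    exact (if_pos rfl).symm
  | .itv ⟨.fin I, J⟩ =>
    simp only [Cap.seq, Cap.val, SCap.seq, Idx.eval_add, Itv.WFAt.val_hi (A := ⟨.fin I, J⟩) hJ]
    rw [if_neg (by simp [Idx.eval])]

section Delay

variable {ρ : Fin n → ℕ}

lemma Usage.WFAt.delay {A : Itv S n} (hA : A.WFAt ρ) :
    ∀ {U : Usage S n}, U.WFAt ρ → (U.delay A).WFAt ρ
  | .zero, _ => trivial
  | .par _ _, h => ⟨Usage.WFAt.delay hA h.1, Usage.WFAt.delay hA h.2⟩
  | .act _ _ _ _, h => ⟨hA.add h.1, h.2⟩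
  | .bang U, h => Usage.WFAt.delay (U := U) hA h
  | .choice _ _, h => ⟨Usage.WFAt.delay hA h.1, Usage.WFAt.delay hA h.2⟩

lemma Usage.WFAt.delayCap {J : Cap S n} (hJ : J.WFAt ρ) :
    ∀ {U : Usage S n}, U.WFAt ρ → (U.delayCap J).WFAt ρ
  | .zero, _ => trivial
  | .par _ _, h => ⟨Usage.WFAt.delayCap hJ h.1, Usage.WFAt.delayCap hJ h.2⟩
  | .act _ _ _ _, h => ⟨h.1.addCap hJ, h.2⟩
  | .bang U, h => Usage.WFAt.delayCap (U := U) hJ h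
  | .choice _ _, h => ⟨Usage.WFAt.delayCap hJ h.1, Usage.WFAt.delayCap hJ h.2⟩

lemma Usage.raw_delay {A : Itv S n} (hA : A.WFAt ρ) :
    ∀ {U : Usage S n}, U.WFAt ρ → (U.delay A).raw ρ = (U.raw ρ).delay (A.val ρ)
  | .zero, _ => rfl
  | .par _ _, h => congrArg₂ RU.par (Usage.raw_delay hA h.1) (Usage.raw_delay hA h.2)
  | .act α _ J U, h => congrArg (RU.act α · (J.val ρ) (U.raw ρ)) (Itv.val_add hA h.1)
  | .bang U, h => congrArg RU.bang (Usage.raw_delay (U := U) hA h)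
  | .choice _ _, h => congrArg₂ RU.choice (Usage.raw_delay hA h.1) (Usage.raw_delay hA h.2)

lemma Usage.raw_delayCap {J : Cap S n} (hJ : J.WFAt ρ) :
    ∀ {U : Usage S n}, U.WFAt ρ → (U.delayCap J).raw ρ = (U.raw ρ).delay (J.val ρ).toItv
  | .zero, _ => rfl
  | .par _ _, h => congrArg₂ RU.par (Usage.raw_delayCap hJ h.1) (Usage.raw_delayCap hJ h.2)
  | .act α _ J' U, h => congrArg (RU.act α · (J'.val ρ) (U.raw ρ))
      ((Itv.val_addCap h.1 hJ).trans (add_comm _ _))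
  | .bang U, h => congrArg RU.bang (Usage.raw_delayCap (U := U) hJ h)
  | .choice _ _, h => congrArg₂ RU.choice (Usage.raw_delayCap hJ h.1) (Usage.raw_delayCap hJ h.2)

end Delay

section Subst

variable {m : ℕ} (σ : Fin n → FinIdx S m) (ρ : Fin m → ℕ)

lemma Itv.val_subst (A : Itv S n) : (A.subst σ).val ρ = A.val fun i => (σ i).eval ρ := by
  simp [Itv.val, Itv.subst, Idx.eval_subst]

lemma Cap.val_subst (J : Cap S n) : (J.subst σ).val ρ = J.val fun i => (σ i).eval ρ := by
  cases J <;> simp [Cap.val, Cap.subst, Idx.eval_subst, Itv.val_subst]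

lemma Usage.raw_subst (U : Usage S n) : (U.subst σ).raw ρ = U.raw fun i => (σ i).eval ρ := by
  induction U <;> simp_all [Usage.raw, Usage.subst, Cap.val_subst, Itv.val_subst]

lemma Itv.wfAt_subst (A : Itv S n) : (A.subst σ).WFAt ρ ↔ A.WFAt fun i => (σ i).eval ρ := by
  simp [Itv.WFAt, Itv.subst, Idx.eval_subst]

lemma Cap.wfAt_subst (J : Cap S n) : (J.subst σ).WFAt ρ ↔ J.WFAt fun i => (σ i).eval ρ := by
  cases J <;> simp [Cap.WFAt, Cap.subst, Itv.wfAt_subst]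

lemma Usage.wfAt_subst (U : Usage S n) : (U.subst σ).WFAt ρ ↔ U.WFAt fun i => (σ i).eval ρ := by
  induction U <;> simp_all [Usage.WFAt, Usage.subst, Cap.wfAt_subst, Itv.wfAt_subst]

end Subst

lemma Usage.Congr.wfAt_iff {ρ : Fin n → ℕ} {U V : Usage S n} (h : Usage.Congr U V) :
    U.WFAt ρ ↔ V.WFAt ρ := by
  induction h <;> simp_all [Usage.WFAt, and_assoc, and_comm]

lemma Usage.Congr.val_eq {ρ : Fin n → ℕ} {U V : Usage S n} (h : Usage.Congr U V) :
    U.val ρ = V.val ρ := by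
  induction h with
  | refl => rfl
  | symm _ ih => exact ih.symm
  | trans _ _ ih1 ih2 => exact ih1.trans ih2
  | par_congr _ _ ih1 ih2 => exact congrArg₂ (· + ·) ih1 ih2
  | act_congr α A J _ ih => exact congrArg (SU.act α (A.val ρ) (J.val ρ)) ih
  | bang_congr _ ih => exact congrArg SU.bang ih
  | choice_congr _ _ ih1 ih2 =>
    exact SU.mk_eq (RU.choice_le_choice (SU.mk_le_mk.1 ih1.le) (SU.mk_le_mk.1 ih2.le))
      (RU.choice_le_choice (SU.mk_le_mk.1 ih1.ge) (SU.mk_le_mk.1 ih2.ge))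
  | par_zero U => exact add_zero (U.val ρ)
  | par_comm U V => exact add_comm (U.val ρ) (V.val ρ)
  | par_assoc U V W => exact (add_assoc (U.val ρ) (V.val ρ) (W.val ρ)).symm
  | bang_zero => exact map_zero SU.bang
  | bang_unfold U => exact SU.bang_unfold (U.val ρ)
  | bang_par U V => exact map_add SU.bang (U.val ρ) (V.val ρ)
  | bang_bang U => exact SU.bang_bang (U.val ρ)

/-- Soundness of subusage. -/
lemma SubUsage.val_le {Φ : Constraints S n} {ρ : Fin n → ℕ} (hρ : Φ.Sat ρ) {U V : Usage S n}
    (h : SubUsage Φ U V) : U.WFAt ρ → V.WFAt ρ ∧ U.val ρ ≤ V.val ρ := by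
  induction h with
  | zero U => exact fun _ => ⟨trivial, SU.le_zero _⟩
  | choice_left U V => exact fun h => ⟨h.1, RU.le_of_offers fun _ => Or.inl⟩
  | choice_right U V => exact fun h => ⟨h.2, RU.le_of_offers fun _ => Or.inr⟩
  | choice_congr_left V _ ih =>
    exact fun h => ⟨⟨(ih h.1).1, h.2⟩, RU.choice_le_choice (ih h.1).2 le_rfl⟩
  | choice_congr_right U _ ih =>
    exact fun h => ⟨⟨h.1, (ih h.2).1⟩, RU.choice_le_choice le_rfl (ih h.2).2⟩
  | par_congr V _ ih =>
    exact fun h => ⟨⟨(ih h.1).1, h.2⟩, RU.par_le_par (ih h.1).2 le_rfl⟩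
  | bang_congr _ ih => exact fun h => ⟨(ih h).1, RU.bang_le_bang (ih h).2⟩
  | congr h1 _ h2 ih =>
    intro h
    have := ih (h1.wfAt_iff.1 h)
    exact ⟨h2.wfAt_iff.2 this.1, h1.val_eq.trans_le (this.2.trans_eq h2.val_eq.symm)⟩
  | trans _ _ ih1 ih2 =>
    exact fun h => ⟨(ih2 (ih1 h).1).1, (ih1 h).2.trans (ih2 (ih1 h).1).2⟩
  | act_congr α A J _ ih =>
    exact fun h => ⟨⟨h.1, h.2.1, (ih h.2.2).1⟩, RU.act_mono _ _ _ (ih h.2.2).2⟩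
  | act α A B I J U hB hJ h1 h2 =>
    -- The new intervals must be well formed for their values to be the intended ones, since
    -- `Itv.val` raises the upper end of an ill-formed interval.
    exact fun h => ⟨⟨hB.at hρ, Cap.WF.at hρ hJ, h.2.2⟩, RU.act_le_act _
      ((h1 ρ hρ).sub (hB.at hρ) h.1) ((h2 ρ hρ).le h.2.1 (Cap.WF.at hρ hJ))⟩
  | guard α A J U V hV =>
    refine fun h => ⟨⟨h.1.1, h.1.2.1, h.1.2.2, Usage.WF.at hρ hV⟩, ?_⟩
    refine le_trans (le_of_eq ?_) (SU.act_add_delay_le α (A.val ρ) (J.val ρ) (U.val ρ) (V.val ρ))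
    rw [← Itv.val_addCap h.1.1 h.1.2.1, Usage.val, Usage.raw,
      Usage.raw_delay (h.1.1.addCap h.1.2.1) (Usage.WF.at hρ hV)]
    rfl

/-! ### Reliability -/

/-- Reachability of usages up to congruence. -/
def Usage.Reach (Φ : Constraints S n) : Usage S n → Usage S n → Prop :=
  Relation.ReflTransGen fun U V => Usage.Congr U V ∨ Usage.Red Φ U (some V)

section Reach

variable {Φ : Constraints S n}

/-- A congruence step is absorbed by the reduction or by the error that follows it. -/
lemma Usage.Reliable.reach {U V : Usage S n} (h : U.Reliable Φ) (hr : Usage.Reach Φ U V) :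
    V.Reliable Φ := by
  induction hr with
  | refl => exact h
  | tail _ hs ih =>
    intro W hW
    rcases hs with hc | hs
    · rcases Relation.ReflTransGen.cases_head hW with rfl | ⟨X, hX, hW⟩
      · exact fun he => ih _ .refl (.congr_error hc he)
      · exact ih W (.head (.congr hc hX (.refl _)) hW)
    · exact ih W (.head hs hW)

lemma Usage.Congr.reach {U V : Usage S n} (h : Usage.Congr U V) : Usage.Reach Φ U V :=
  .single (Or.inl h)

lemma Usage.Reach.trans {U V W : Usage S n} (h : Usage.Reach Φ U V) (h' : Usage.Reach Φ V W) :
    Usage.Reach Φ U W := Relation.ReflTransGen.trans h h'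

lemma Usage.Reach.par_left {U U' : Usage S n} (h : Usage.Reach Φ U U') (V : Usage S n) :
    Usage.Reach Φ (.par U V) (.par U' V) := by
  induction h with
  | refl => exact .refl
  | tail _ hs ih =>
    refine ih.tail ?_
    rcases hs with hs | hs
    · exact Or.inl (.par_congr hs (.refl _))
    · exact Or.inr (.par V hs)

lemma Usage.Reach.par {U U' V V' : Usage S n} (h : Usage.Reach Φ U U')
    (h' : Usage.Reach Φ V V') : Usage.Reach Φ (.par U V) (.par U' V') :=
  (h.par_left V).trans <| (Usage.Congr.par_comm _ _).reach.trans <|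
    (h'.par_left U').trans (Usage.Congr.par_comm _ _).reach

end Reach

/-- Syntactic outermost actions. -/
structure Action (S : IndexSig) (n : ℕ) where
  pol : Pol
  ob : Itv S n
  cap : Cap S n
  cont : Usage S n

def Action.toUsage (a : Action S n) : Usage S n := .act a.pol a.ob a.cap a.cont

noncomputable def Action.val (ρ : Fin n → ℕ) (a : Action S n) : Atom :=
  ⟨a.pol, a.ob.val ρ, a.cap.val ρ, a.cont.raw ρ⟩

/-- Parallel composition of actions. -/
def parActions : List (Action S n) → Usage S n
  | [] => .zero
  | a :: L => .par a.toUsage (parActions L)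

lemma Usage.Congr.par_left_comm (U V W : Usage S n) :
    Usage.Congr (.par U (.par V W)) (.par V (.par U W)) :=
  (Usage.Congr.par_assoc U V W).trans <|
    (Usage.Congr.par_congr (.par_comm U V) (.refl W)).trans (Usage.Congr.par_assoc V U W).symm

lemma Usage.Congr.zero_par (U : Usage S n) : Usage.Congr (.par .zero U) U :=
  (Usage.Congr.par_comm _ _).trans (.par_zero U)

lemma Usage.Congr.par_par_par_comm (U V W X : Usage S n) :
    Usage.Congr (.par (.par U V) (.par W X)) (.par (.par U W) (.par V X)) :=
  (Usage.Congr.par_assoc U V _).symm.trans <|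
    (Usage.Congr.par_congr (.refl U) (.par_left_comm V W X)).trans (Usage.Congr.par_assoc U W _)

lemma congr_parActions_append (L L' : List (Action S n)) :
    Usage.Congr (.par (parActions L) (parActions L')) (parActions (L ++ L')) := by
  induction L with
  | nil => exact .zero_par _
  | cons a L ih => exact (Usage.Congr.par_assoc _ _ _).symm.trans (.par_congr (.refl _) ih)

lemma congr_parActions_perm {L L' : List (Action S n)} (h : L.Perm L') :
    Usage.Congr (parActions L) (parActions L') := by
  induction h with
  | nil => exact .refl _
  | cons a _ ih => exact .par_congr (.refl _) ih
  | swap a b L => exact .par_left_comm _ _ _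
  | trans _ _ ih1 ih2 => exact ih1.trans ih2

/-- `U` can exhibit the actions `L`. -/
def Exhibits (Φ : Constraints S n) (ρ : Fin n → ℕ) (U : Usage S n) (u : Multiset Atom) : Prop :=
  ∃ (L : List (Action S n)) (R : Usage S n), Usage.Reach Φ U (.par (parActions L) R) ∧
    (L : Multiset (Action S n)).map (Action.val ρ) = u ∧ ∀ a ∈ L, a.toUsage.WFAt ρ

section Exhibits

variable {Φ : Constraints S n} {ρ : Fin n → ℕ}

lemma Exhibits.of_reach {U V : Usage S n} {u : Multiset Atom} (h : Usage.Reach Φ U V)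
    (hV : Exhibits Φ ρ V u) : Exhibits Φ ρ U u := by
  obtain ⟨L, R, h', hL⟩ := hV
  exact ⟨L, R, h.trans h', hL⟩

lemma exhibits_zero (U : Usage S n) : Exhibits Φ ρ U 0 :=
  ⟨[], U, (Usage.Congr.zero_par U).symm.reach, rfl, by simp⟩

lemma Exhibits.par {U V : Usage S n} {u v : Multiset Atom} (hU : Exhibits Φ ρ U u)
    (hV : Exhibits Φ ρ V v) : Exhibits Φ ρ (.par U V) (u + v) := by
  obtain ⟨L, R, h, rfl, hL⟩ := hU
  obtain ⟨L', R', h', rfl, hL'⟩ := hV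
  refine ⟨L ++ L', .par R R', (h.par h').trans ?_, ?_, ?_⟩
  · exact ((Usage.Congr.par_par_par_comm _ _ _ _).trans
      (.par_congr (congr_parActions_append L L') (.refl _))).reach
  · rw [← Multiset.coe_add, Multiset.map_add]
  · intro a ha
    rcases List.mem_append.1 ha with ha | ha
    · exact hL a ha
    · exact hL' a ha

/-- Choices are resolved by reductions, replications are unfolded by congruence, and withheld
actions stay in the remainder `R`. -/
lemma exhibits_of_mem_offers {U : Usage S n} : U.WFAt ρ →
    ∀ {u : Multiset Atom}, u ∈ (U.raw ρ).offers → Exhibits Φ ρ U u := by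
  induction U with
  | zero =>
    rintro - u rfl
    exact exhibits_zero _
  | par U V ihU ihV =>
    rintro hw _ ⟨u, hu, v, hv, rfl⟩
    exact (ihU hw.1 hu).par (ihV hw.2 hv)
  | act α A J U =>
    rintro hw u (rfl | rfl)
    · exact exhibits_zero _
    · refine ⟨[⟨α, A, J, U⟩], .zero, ?_, rfl, fun a ha => List.mem_singleton.1 ha ▸ hw⟩
      exact ((Usage.Congr.par_zero _).trans (Usage.Congr.par_zero _)).symm.reach
  | bang U ih =>
    intro hw u hu
    change u ∈ AddSubmonoid.closure _ at hu
    induction hu using AddSubmonoid.closure_induction with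
    | mem u hu =>
      refine Exhibits.of_reach (Usage.Congr.bang_unfold U).reach ?_
      rw [← zero_add u]
      exact (exhibits_zero _).par (ih hw hu)
    | zero => exact exhibits_zero _
    | add u v _ _ hu hv =>
      -- The congruence used is `!U ≡ !U | !U`, obtained through `!!U`.
      refine Exhibits.of_reach (Usage.Congr.reach ?_) (hu.par hv)
      exact (Usage.Congr.bang_bang U).symm.trans ((Usage.Congr.bang_unfold _).trans
        (.par_congr (.bang_bang U) (.refl _)))
  | choice U V ihU ihV =>
    rintro hw u (hu | hu)
    · exact Exhibits.of_reach (.single (Or.inr (.choice_left U V))) (ihU hw.1 hu)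
    · exact Exhibits.of_reach (.single (Or.inr (.choice_right U V))) (ihV hw.2 hu)

lemma exists_perm_of_map_eq_cons {L : List (Action S n)} {a : Atom} {m : Multiset Atom}
    (h : (L : Multiset (Action S n)).map (Action.val ρ) = a ::ₘ m) :
    ∃ b L', L.Perm (b :: L') ∧ b.val ρ = a ∧
      (L' : Multiset (Action S n)).map (Action.val ρ) = m := by
  classical
  obtain ⟨b, hb, h1, h2⟩ := (Multiset.map_eq_cons _ _ _ _).2 h
  exact ⟨b, L.erase b, List.perm_cons_erase hb, h1, h2⟩

/-- The communications in the derivation of `Bad` are replayed by reductions of `U`, with the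
exhibited actions as syntactic counterparts of the atoms. -/
lemma Bad.not_reliable (hρ : Φ.Sat ρ) {m : Multiset Atom} (h : Bad m) :
    ∀ {U : Usage S n}, Exhibits Φ ρ U m → ¬ U.Reliable Φ := by
  have key : ∀ (A B : SItv) (I J : SCap) (C D : RU) (m : Multiset Atom) (U : Usage S n),
      Exhibits Φ ρ U (⟨.inp, A, I, C⟩ ::ₘ ⟨.out, B, J, D⟩ ::ₘ m) → U.Reliable Φ →
      Agree A B I J ∧ ∀ x ∈ C.offers, ∀ y ∈ D.offers, ∃ V : Usage S n, V.Reliable Φ ∧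
        Exhibits Φ ρ V (delayM (A.sup B) x + delayM (A.sup B) y + m) := by
    rintro A B I J C D m U ⟨L, R, hU, hL, hw⟩ hr
    obtain ⟨⟨_, A, I, C⟩, L₁, hp, h1, hL₁⟩ := exists_perm_of_map_eq_cons hL
    obtain ⟨⟨_, B, J, D⟩, L₂, hp', h2, rfl⟩ := exists_perm_of_map_eq_cons hL₁
    cases h1
    cases h2
    have hp2 := hp.trans (hp'.cons _)
    have hw' := fun a ha => hw a (hp2.mem_iff.2 ha)
    obtain ⟨hA, hI, hC⟩ := hw' _ List.mem_cons_self
    obtain ⟨hB, hJ, hD⟩ := hw' _ (List.mem_cons_of_mem _ List.mem_cons_self)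
    have hc : Usage.Congr (.par (parActions L) R)
        (.par (.par (.act .inp A I C) (.act .out B J D)) (.par (parActions L₂) R)) :=
      (Usage.Congr.par_congr ((congr_parActions_perm hp2).trans (.par_assoc _ _ _))
        (.refl R)).trans (Usage.Congr.par_assoc _ _ _).symm
    have hr' := hr.reach (hU.trans hc.reach)
    -- Reduction tests agreement at all valuations satisfying `Φ`. A failed test produces an error,
    -- against reliability; a passed test holds in particular at `ρ` and permits the reduction.
    by_cases he : Entails Φ fun ρ => B.Subset ρ (A.oplus I) ∧ A.Subset ρ (B.oplus J)
    · refine ⟨⟨(subset_oplus_iff hA hB hI).1 (he ρ hρ).1,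
        (subset_oplus_iff hB hA hJ).1 (he ρ hρ).2⟩, fun x hx y hy => ?_⟩
      have hred : Usage.Red Φ (.par (.act .inp A I C) (.act .out B J D))
          (some ((Usage.par C D).delay (A.sup B))) :=
        .comm A B I J C D (fun ρ h => (he ρ h).1) fun ρ h => (he ρ h).2
      refine ⟨_, hr'.reach (.single (Or.inr (.par _ hred))), Exhibits.par ?_
        ⟨L₂, R, .refl, rfl, fun a ha => hw' a (by simp [ha])⟩⟩
      refine exhibits_of_mem_offers (Usage.WFAt.delay (hA.sup hB) (U := .par C D) ⟨hC, hD⟩) ?_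
      rw [Usage.raw_delay (hA.sup hB) (U := .par C D) ⟨hC, hD⟩, Itv.val_sup hA hB, ← map_add]
      exact RU.delayM_mem_offers ⟨x, hx, y, hy, rfl⟩
    · exact (hr' _ .refl (.par_error _ (.comm_error A B I J C D he))).elim
  induction h with
  | error A B I J C D m h => exact fun hU hr => h (key _ _ _ _ _ _ _ _ hU hr).1
  | comm A B I J C D x y m hx hy _ ih =>
    intro U hU hr
    obtain ⟨V, hV, hV'⟩ := (key _ _ _ _ _ _ _ _ hU hr).2 x hx y hy
    exact ih hV' hV

/-- Reliable usages are interpreted by safe semantic usages. -/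
lemma Usage.Reliable.safe_val (hρ : Φ.Sat ρ) {U : Usage S n} (h : U.Reliable Φ)
    (hU : U.WFAt ρ) : (U.val ρ).Safe :=
  SU.safe_mk.2 fun _ hu hb => hb.not_reliable hρ (exhibits_of_mem_offers hU hu) h

end Exhibits

end PiUsage

namespace PiUsage

/-! ## Interpretation of types and soundness of typing -/

variable {S : IndexSig} {n : ℕ}

/-- The usage of a type. -/
noncomputable def Ty.usage {n : ℕ} (ρ : Fin n → ℕ) : Ty S n → SU
  -- As `0` is the greatest usage, integer variables can be used without restriction.
  | .nat _ _ => 0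
  | .chan _ _ U => U.val ρ
  | .serv _ _ _ _ U => U.val ρ

/-- The interpretation of a type without its usage. -/
noncomputable def Ty.base : {n : ℕ} → (Fin n → ℕ) → Ty S n → Base
  | _, ρ, .nat I J => .nat (I.eval ρ) (J.eval ρ)
  | _, ρ, .chan m T _ => .chan m (fun j => (T j).base ρ) (fun j => (T j).usage ρ)
  -- Only the upper end of `K` is kept, as a function of the values `ι` of the bound index
  -- variables.
  | _, ρ, .serv k m K T _ => .serv k m (fun ι => K.hi.eval (Fin.append ρ ι))
      (fun ι j => (T j).base (Fin.append ρ ι)) (fun ι j => (T j).usage (Fin.append ρ ι))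

/-- Well-formedness of the usages of a type under a valuation. -/
def Ty.WFAt : {n : ℕ} → (Fin n → ℕ) → Ty S n → Prop
  | _, _, .nat _ _ => True
  | _, ρ, .chan _ T U => (∀ j, (T j).WFAt ρ) ∧ U.WFAt ρ
  | _, ρ, .serv _ _ _ T U => (∀ ι j, (T j).WFAt (Fin.append ρ ι)) ∧ U.WFAt ρ

lemma eval_wk {k : ℕ} (ρ : Fin n → ℕ) (ι : Fin k → ℕ) :
    (fun i => (wk (S := S) k i).eval (Fin.append ρ ι)) = ρ := by
  funext i
  simp [wk, FinIdx.eval]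

lemma eval_inst {k : ℕ} (ρ : Fin n → ℕ) (Is : Fin k → FinIdx S n) :
    (fun i => (inst Is i).eval ρ) = Fin.append ρ fun j => (Is j).eval ρ := by
  funext i
  refine Fin.addCases (fun i => ?_) (fun i => ?_) i <;> simp [inst, FinIdx.eval]

lemma eval_liftIdx {m k : ℕ} (σ : Fin n → FinIdx S m) (ρ : Fin m → ℕ) (ι : Fin k → ℕ) :
    (fun i => (liftIdx k σ i).eval (Fin.append ρ ι)) =
      Fin.append (fun i => (σ i).eval ρ) ι := by
  funext i
  refine Fin.addCases (fun i => ?_) (fun i => ?_) i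
  · simp [liftIdx, FinIdx.eval_subst, eval_wk]
  · simp [liftIdx, FinIdx.eval]

lemma Constraints.Sat.weaken {Φ : Constraints S n} {ρ : Fin n → ℕ} (h : Φ.Sat ρ) {k : ℕ}
    (ι : Fin k → ℕ) : (Φ.weaken k).Sat (Fin.append ρ ι) := by
  intro C hC
  obtain ⟨C', hC', rfl⟩ := List.mem_map.1 hC
  simpa only [Idx.eval_subst, eval_wk] using h C' hC'

lemma Ty.usage_subst {m : ℕ} (σ : Fin n → FinIdx S m) (ρ : Fin m → ℕ) (T : Ty S n) :
    (T.subst σ).usage ρ = T.usage fun i => (σ i).eval ρ := by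
  cases T <;> simp [Ty.subst, Ty.usage, Usage.val, Usage.raw_subst]

lemma Ty.base_subst {n : ℕ} (T : Ty S n) : ∀ {m : ℕ} (σ : Fin n → FinIdx S m) (ρ : Fin m → ℕ),
    (T.subst σ).base ρ = T.base fun i => (σ i).eval ρ := by
  induction T with
  | nat I J => intros; simp [Ty.subst, Ty.base, Idx.eval_subst]
  | chan r T U ih => intros; simp only [Ty.subst, Ty.base, ih, Ty.usage_subst]
  | serv k r K T U ih =>
    intros
    simp only [Ty.subst, Ty.base, ih, Ty.usage_subst, eval_liftIdx, Itv.subst, Idx.eval_subst]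

lemma Ty.wfAt_subst {n : ℕ} (T : Ty S n) : ∀ {m : ℕ} (σ : Fin n → FinIdx S m) (ρ : Fin m → ℕ),
    (T.subst σ).WFAt ρ ↔ T.WFAt fun i => (σ i).eval ρ := by
  induction T with
  | nat I J => intros; exact Iff.rfl
  | chan r T U ih => intros; simp only [Ty.subst, Ty.WFAt, ih, Usage.wfAt_subst]
  | serv k r K T U ih =>
    intros
    simp only [Ty.subst, Ty.WFAt, ih, eval_liftIdx, Usage.wfAt_subst]

lemma Ty.WF.at {n : ℕ} {T : Ty S n} : ∀ {Φ : Constraints S n}, T.WF Φ →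
    ∀ {ρ : Fin n → ℕ}, Φ.Sat ρ → T.WFAt ρ := by
  induction T with
  | nat I J => intros; trivial
  | chan r T U ih => exact fun h _ hρ => ⟨fun j => ih j (h.1 j) hρ, h.2.at hρ⟩
  | serv k r K T U ih =>
    exact fun h _ hρ => ⟨fun ι j => ih j (h.2.1 j) (hρ.weaken ι), h.2.2.at hρ⟩

/-- Soundness of subtyping. -/
lemma SubTy.sound {n : ℕ} {Φ : Constraints S n} {T T' : Ty S n} (h : SubTy Φ T T') :
    ∀ {ρ : Fin n → ℕ}, Φ.Sat ρ → T.WFAt ρ →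
      T'.WFAt ρ ∧ (T.base ρ).Sub (T'.base ρ) ∧ T.usage ρ ≤ T'.usage ρ := by
  induction h with
  | nat h1 h2 => exact fun hρ _ => ⟨trivial, .nat (h1 _ hρ) (h2 _ hρ), le_rfl⟩
  | @chan _ m _ T T' _ _ _ _ hU ih1 ih2 =>
    intro ρ hρ hw
    have h1 := fun j => ih1 j hρ (hw.1 j)
    have h2 := fun j => ih2 j hρ (h1 j).1
    have hU := hU.val_le hρ hw.2
    refine ⟨⟨fun j => (h1 j).1, hU.1⟩, ?_, hU.2⟩
    -- Subtyping of the arguments in both directions becomes equality of their interpretations.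
    have hb : (fun j => (T j).base ρ) = fun j => (T' j).base ρ :=
      funext fun j => (h1 j).2.1.antisymm (h2 j).2.1
    have hu : (fun j => (T j).usage ρ) = fun j => (T' j).usage ρ :=
      funext fun j => le_antisymm (h1 j).2.2 (h2 j).2.2
    rw [Ty.base, Ty.base, hb, hu]
    exact .refl _
  | @serv _ k m _ K K' T T' _ _ _ _ hK hU ih1 ih2 =>
    intro ρ hρ hw
    have h1 := fun ι j => ih1 j (hρ.weaken ι) (hw.1 ι j)
    have h2 := fun ι j => ih2 j (hρ.weaken ι) (h1 ι j).1
    have hU := hU.val_le hρ hw.2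
    refine ⟨⟨fun ι j => (h1 ι j).1, hU.1⟩, ?_, hU.2⟩
    have hb : (fun ι j => (T j).base (Fin.append ρ ι)) = fun ι j => (T' j).base (Fin.append ρ ι) :=
      funext fun ι => funext fun j => (h1 ι j).2.1.antisymm (h2 ι j).2.1
    have hu : (fun ι j => (T j).usage (Fin.append ρ ι)) =
        fun ι j => (T' j).usage (Fin.append ρ ι) :=
      funext fun ι => funext fun j => le_antisymm (h1 ι j).2.2 (h2 ι j).2.2
    have hK : (fun ι : Fin k → ℕ => K.hi.eval (Fin.append ρ ι)) =
        fun ι => K'.hi.eval (Fin.append ρ ι) := funext fun ι => (hK _ (hρ.weaken ι)).2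
    rw [Ty.base, Ty.base, hb, hu, hK]
    exact .refl _

lemma Ty.base_mapUsage (ρ : Fin n → ℕ) (f : Usage S n → Usage S n) (T : Ty S n) :
    (T.mapUsage f).base ρ = T.base ρ := by
  cases T <;> rfl

lemma Ty.wfAt_mapUsage {ρ : Fin n → ℕ} {f : Usage S n → Usage S n}
    (hf : ∀ {U}, U.WFAt ρ → (f U).WFAt ρ) {T : Ty S n} (hT : T.WFAt ρ) : (T.mapUsage f).WFAt ρ := by
  cases T with
  | nat I J => trivial
  | chan m T U => exact ⟨hT.1, hf hT.2⟩
  | serv k m K T U => exact ⟨hT.1, hf hT.2⟩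

lemma Ty.usage_mapUsage {ρ : Fin n → ℕ} {f : Usage S n → Usage S n} {g : SU →+ SU}
    (hf : ∀ {U}, U.WFAt ρ → (f U).val ρ = g (U.val ρ)) {T : Ty S n} (hT : T.WFAt ρ) :
    (T.mapUsage f).usage ρ = g (T.usage ρ) := by
  cases T with
  | nat I J => exact (map_zero g).symm
  | chan m T U => exact hf hT.2
  | serv k m K T U => exact hf hT.2

/-! ### Contexts -/

/-- The types of the variables, without their usages. -/
noncomputable def Ctx.base (ρ : Fin n → ℕ) (Γ : Ctx S n) : ℕ → Base :=
  fun x => (Γ[x]?.map (Ty.base ρ)).getD (.nat 0 0)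

/-- The usages of the variables. -/
noncomputable def Ctx.usage (ρ : Fin n → ℕ) (Γ : Ctx S n) : ℕ → SU :=
  -- Outside the context the usage is `0`, which is safe and fixed by the additive operations.
  fun x => (Γ[x]?.map (Ty.usage ρ)).getD 0

def Ctx.WFAt (ρ : Fin n → ℕ) (Γ : Ctx S n) : Prop := ∀ T ∈ Γ, T.WFAt ρ

variable {ρ : Fin n → ℕ} {Γ Δ Θ : Ctx S n}

lemma Ctx.base_of_getElem? {x : ℕ} {T : Ty S n} (h : Γ[x]? = some T) :
    Ctx.base ρ Γ x = T.base ρ := by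
  simp [Ctx.base, h]

lemma Ctx.usage_of_getElem? {x : ℕ} {T : Ty S n} (h : Γ[x]? = some T) :
    Ctx.usage ρ Γ x = T.usage ρ := by
  simp [Ctx.usage, h]

lemma getElem?_ofFn_append {X : Type*} {m : ℕ} (T : Fin m → X) (L : List X) (x : ℕ) :
    (List.ofFn T ++ L)[x]? = extend (fun j => some (T j)) (fun i => L[i]?) x := by
  rcases lt_or_exists_add x m with hx | ⟨x, rfl⟩
  · rw [List.getElem?_append_left (by simpa using hx), List.getElem?_ofFn, dif_pos hx,
      extend_lt _ _ hx]
  · rw [List.getElem?_append_right (by simp), extend_add]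
    simp

lemma Ctx.base_append {m : ℕ} (T : Fin m → Ty S n) :
    Ctx.base ρ (List.ofFn T ++ Γ) = extend (fun j => (T j).base ρ) (Ctx.base ρ Γ) := by
  funext x
  rw [Ctx.base, getElem?_ofFn_append]
  unfold extend
  split_ifs <;> rfl

lemma Ctx.usage_append {m : ℕ} (T : Fin m → Ty S n) :
    Ctx.usage ρ (List.ofFn T ++ Γ) = extend (fun j => (T j).usage ρ) (Ctx.usage ρ Γ) := by
  funext x
  rw [Ctx.usage, getElem?_ofFn_append]
  unfold extend
  split_ifs <;> rfl

lemma Ctx.base_cons (T : Ty S n) :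
    Ctx.base ρ (T :: Γ) = extend (m := 1) (fun _ => T.base ρ) (Ctx.base ρ Γ) := by
  funext x
  cases x <;> rfl

lemma Ctx.usage_cons (T : Ty S n) :
    Ctx.usage ρ (T :: Γ) = extend (m := 1) (fun _ => T.usage ρ) (Ctx.usage ρ Γ) := by
  funext x
  cases x <;> rfl

lemma Ctx.base_map {m : ℕ} {ρ' : Fin m → ℕ} {f : Ty S n → Ty S m}
    (hf : ∀ T ∈ Γ, (f T).base ρ' = T.base ρ) : Ctx.base ρ' (Γ.map f) = Ctx.base ρ Γ := by
  funext x
  simp only [Ctx.base, List.getElem?_map]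
  cases h : Γ[x]? with
  | none => rfl
  | some T => exact hf T (List.mem_of_getElem? h)

lemma Ctx.usage_map {m : ℕ} {ρ' : Fin m → ℕ} {f : Ty S n → Ty S m} {g : SU →+ SU}
    (hf : ∀ T ∈ Γ, (f T).usage ρ' = g (T.usage ρ)) :
    Ctx.usage ρ' (Γ.map f) = fun x => g (Ctx.usage ρ Γ x) := by
  funext x
  simp only [Ctx.usage, List.getElem?_map]
  cases h : Γ[x]? with
  | none => exact (map_zero g).symm
  | some T => exact hf T (List.mem_of_getElem? h)

lemma Ctx.base_set {a : ℕ} {T T' : Ty S n} (h : Γ[a]? = some T) (hT : T'.base ρ = T.base ρ) :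
    Ctx.base ρ (Γ.set a T') = Ctx.base ρ Γ := by
  funext x
  simp only [Ctx.base, List.getElem?_set]
  have ha : a < Γ.length := (List.getElem?_eq_some_iff.1 h).1
  split_ifs with hx
  · subst hx
    simp [h, hT]
  · rfl

lemma Ctx.usage_set {a : ℕ} {T T' : Ty S n} (h : Γ[a]? = some T) (x : ℕ) :
    Ctx.usage ρ (Γ.set a T') x = if x = a then T'.usage ρ else Ctx.usage ρ Γ x := by
  simp only [Ctx.usage, List.getElem?_set]
  have ha : a < Γ.length := (List.getElem?_eq_some_iff.1 h).1
  by_cases hx : a = x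
  · subst hx
    simp [ha]
  · simp [hx, Ne.symm hx]

lemma Ctx.WFAt.set {a : ℕ} {T : Ty S n} (h : Ctx.WFAt ρ Γ) (hT : T.WFAt ρ) :
    Ctx.WFAt ρ (Γ.set a T) := by
  intro T' hT'
  rcases List.mem_or_eq_of_mem_set hT' with h' | rfl
  · exact h T' h'
  · exact hT

lemma Ctx.WFAt.map {m : ℕ} {ρ' : Fin m → ℕ} {f : Ty S n → Ty S m} (h : Ctx.WFAt ρ Γ)
    (hf : ∀ {T}, T.WFAt ρ → (f T).WFAt ρ') : Ctx.WFAt ρ' (Γ.map f) := by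
  intro T hT
  obtain ⟨T', hT', rfl⟩ := List.mem_map.1 hT
  exact hf (h T' hT')

lemma Ctx.WFAt.of_getElem? (h : Ctx.WFAt ρ Γ) {x : ℕ} {T : Ty S n} (hx : Γ[x]? = some T) :
    T.WFAt ρ := h T (List.mem_of_getElem? hx)

lemma Ctx.WF.at {Φ : Constraints S n} (h : Γ.WF Φ) (hρ : Φ.Sat ρ) : Ctx.WFAt ρ Γ :=
  fun T hT => (h T hT).at hρ

lemma Ctx.Par.sound (h : Ctx.Par Γ Δ Θ) (ρ : Fin n → ℕ) : (Ctx.WFAt ρ Γ → Ctx.WFAt ρ Δ →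
    Ctx.WFAt ρ Θ) ∧ Ctx.base ρ Γ = Ctx.base ρ Θ ∧ Ctx.base ρ Δ = Ctx.base ρ Θ ∧
      Ctx.usage ρ Θ = Ctx.usage ρ Γ + Ctx.usage ρ Δ := by
  induction h with
  | nil => exact ⟨fun h _ => h, rfl, rfl, funext fun _ => (add_zero 0).symm⟩
  | @cons T T' T'' Γ Δ Θ hT _ ih =>
    have hT' : (T.WFAt ρ → T'.WFAt ρ → T''.WFAt ρ) ∧ T.base ρ = T''.base ρ ∧
        T'.base ρ = T''.base ρ ∧ T''.usage ρ = T.usage ρ + T'.usage ρ := by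
      cases hT with
      | nat => exact ⟨fun h _ => h, rfl, rfl, (add_zero _).symm⟩
      | chan => exact ⟨fun h h' => ⟨h.1, h.2, h'.2⟩, rfl, rfl, rfl⟩
      | serv => exact ⟨fun h h' => ⟨h.1, h.2, h'.2⟩, rfl, rfl, rfl⟩
    refine ⟨fun h h' => ?_, ?_, ?_, ?_⟩
    · simp only [Ctx.WFAt, List.forall_mem_cons] at h h' ⊢
      exact ⟨hT'.1 h.1 h'.1, ih.1 h.2 h'.2⟩
    · rw [Ctx.base_cons, Ctx.base_cons, hT'.2.1, ih.2.1]
    · rw [Ctx.base_cons, Ctx.base_cons, hT'.2.2.1, ih.2.2.1]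
    · rw [Ctx.usage_cons, Ctx.usage_cons, Ctx.usage_cons, hT'.2.2.2, ih.2.2.2, ← extend_one_add]
      rfl

lemma Ctx.Par.getElem? (h : Ctx.Par Γ Δ Θ) {a : ℕ} {T T' : Ty S n} (hT : Γ[a]? = some T)
    (hT' : Δ[a]? = some T') : ∃ T'', Θ[a]? = some T'' ∧ T.Par T' T'' := by
  induction h generalizing a with
  | nil => simp at hT
  | cons h _ ih =>
    cases a with
    | zero =>
      cases hT
      cases hT'
      exact ⟨_, rfl, h⟩
    | succ a => exact ih hT hT'

lemma SubCtx.sound {Φ : Constraints S n} (h : SubCtx Φ Γ Δ) (hρ : Φ.Sat ρ)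
    (hw : Ctx.WFAt ρ Γ) : (∀ x, (Ctx.base ρ Γ x).Sub (Ctx.base ρ Δ x)) ∧
      Ctx.usage ρ Γ ≤ Ctx.usage ρ Δ := by
  induction h with
  | nil => exact ⟨fun _ => .refl _, le_rfl⟩
  | cons hT _ ih =>
    simp only [Ctx.WFAt, List.forall_mem_cons] at hw
    have h1 := hT.sound hρ hw.1
    have h2 := ih hw.2
    rw [Ctx.base_cons, Ctx.base_cons, Ctx.usage_cons, Ctx.usage_cons]
    refine ⟨fun x => ?_, extend_le_extend (fun _ => h1.2.2) h2.2⟩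
    cases x with
    | zero => exact h1.2.1
    | succ x => exact h2.1 x

/-! ### Soundness of the typing of expressions -/

lemma Expr.subst_var (e : Expr) : e.subst .var = e :=
  (Expr.rename_eq_subst (fun i => i) e).symm.trans e.rename_id

lemma ETy.mono_ctx {B B' : ℕ → Base} (hB : ∀ i, (B' i).Sub (B i)) {e : Expr} {b : Base}
    (h : ETy B e b) : ETy B' e b := by
  have := h.subst (B' := B') (σ := .var) hB
  rwa [Expr.subst_var] at this

lemma ExprTyped.sound {Φ : Constraints S n} {e : Expr} {T : Ty S n} (h : ExprTyped Φ Γ e T)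
    (hρ : Φ.Sat ρ) : Ctx.WFAt ρ Γ ∧ T.WFAt ρ ∧ ETy (Ctx.base ρ Γ) e (T.base ρ) ∧
      ∀ x, e = .var x → Ctx.usage ρ Γ x ≤ T.usage ρ := by
  induction h with
  | @var Γ x T hw h =>
    refine ⟨Ctx.WF.at hw hρ, (hw T (List.mem_of_getElem? h)).at hρ, ?_, ?_⟩
    · change Base.Sub _ _
      rw [Ctx.base_of_getElem? h]
      exact .refl _
    · rintro _ ⟨⟩
      rw [Ctx.usage_of_getElem? h]
  | zero hw => exact ⟨Ctx.WF.at hw hρ, trivial, le_refl (0 : ℕ∞), by simp⟩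
  | succ _ ih =>
    refine ⟨ih.1, trivial, ⟨_, _, ih.2.2.1, ?_, ?_⟩, by simp⟩ <;> simp
  | sub hw _ hΓ hT ih =>
    obtain ⟨-, h2, h3, h4⟩ := ih
    have h5 := hT.sound hρ h2
    have h6 := SubCtx.sound hΓ hρ (Ctx.WF.at hw hρ)
    exact ⟨Ctx.WF.at hw hρ, h5.1, (h3.mono_ctx h6.1).sub h5.2.1,
      fun x hx => (h6.2 x).trans ((h4 x hx).trans h5.2.2)⟩

lemma TupleTyped.sound {Φ : Constraints S n} (hρ : Φ.Sat ρ) {m : ℕ} : ∀ {Γ : Ctx S n}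
    {es : List Expr} {T : Fin m → Ty S n}, TupleTyped Φ Γ es (List.ofFn T) → Ctx.WFAt ρ Γ ∧
      TupTy (Ctx.base ρ Γ) (Ctx.usage ρ Γ) es (fun j => (T j).base ρ) fun j => (T j).usage ρ := by
  classical
  induction m with
  | zero =>
    intro Γ es T h
    rw [List.ofFn_zero] at h
    cases h with
    | nil hw => exact ⟨Ctx.WF.at hw hρ, rfl, fun j => j.elim0, fun x => SU.le_zero _⟩
  | succ m ih =>
    intro Γ es T h
    rw [List.ofFn_succ] at h
    cases h with
    | @cons Γ Δ Θ e _ es _ he hes hp =>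
      obtain ⟨h1, h2, h3, h4⟩ := ih hes
      obtain ⟨h5, -, h6, h7⟩ := he.sound hρ
      obtain ⟨h8, h9, h10, h11⟩ := hp.sound ρ
      rw [h9] at h6
      rw [h10] at h3
      refine ⟨h8 h5 h1, by simpa using h2, fun j => ?_, fun x => ?_⟩
      · refine Fin.cases ?_ (fun j => ?_) j
        · rintro _ ⟨⟩
          exact h6
        · intro e he
          exact h3 j e (by simpa using he)
      · rw [h11, Fin.sum_univ_succ]
        refine add_le_add ?_ ((h4 x).trans_eq ?_)
        · split_ifs with hx
          · exact h7 x (by simpa using hx)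
          · exact SU.le_zero _
        · exact Finset.sum_congr rfl fun j _ => by congr 1

/-! ### Soundness of the typing of processes -/

lemma Ctx.delay_sound {A : Itv S n} (hA : A.WFAt ρ) (hΓ : Ctx.WFAt ρ Γ) :
    Ctx.WFAt ρ (Γ.map (Ty.delay A)) ∧ Ctx.base ρ (Γ.map (Ty.delay A)) = Ctx.base ρ Γ ∧
      Ctx.usage ρ (Γ.map (Ty.delay A)) = fun x => SU.delay (A.val ρ) (Ctx.usage ρ Γ x) :=
  ⟨hΓ.map (Ty.wfAt_mapUsage (Usage.WFAt.delay hA)), Ctx.base_map fun _ _ => Ty.base_mapUsage _ _ _,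
    Ctx.usage_map fun T hT => Ty.usage_mapUsage (f := Usage.delay A) (g := SU.delay _)
      (fun hU => congrArg SU.mk (Usage.raw_delay hA hU)) (hΓ T hT)⟩

lemma Ctx.delayCap_sound {J : Cap S n} (hJ : J.WFAt ρ) (hΓ : Ctx.WFAt ρ Γ) :
    Ctx.WFAt ρ (Γ.map (Ty.delayCap J)) ∧ Ctx.base ρ (Γ.map (Ty.delayCap J)) = Ctx.base ρ Γ ∧
      Ctx.usage ρ (Γ.map (Ty.delayCap J)) =
        fun x => SU.delay (J.val ρ).toItv (Ctx.usage ρ Γ x) :=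
  ⟨hΓ.map (Ty.wfAt_mapUsage (Usage.WFAt.delayCap hJ)),
    Ctx.base_map fun _ _ => Ty.base_mapUsage _ _ _,
    Ctx.usage_map fun T hT => Ty.usage_mapUsage (f := Usage.delayCap J) (g := SU.delay _)
      (fun hU => congrArg SU.mk (Usage.raw_delayCap hJ hU)) (hΓ T hT)⟩

lemma Ctx.bang_sound (hΓ : Ctx.WFAt ρ Γ) :
    Ctx.WFAt ρ (Γ.map Ty.bang) ∧ Ctx.base ρ (Γ.map Ty.bang) = Ctx.base ρ Γ ∧
      Ctx.usage ρ (Γ.map Ty.bang) = fun x => SU.bang (Ctx.usage ρ Γ x) :=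
  ⟨hΓ.map (Ty.wfAt_mapUsage (f := Usage.bang) fun h => h), Ctx.base_map fun _ _ => Ty.base_mapUsage _ _ _,
    Ctx.usage_map fun T hT => Ty.usage_mapUsage (f := Usage.bang) (g := SU.bang) (fun _ => rfl) (hΓ T hT)⟩

/-- The context of the conclusion of the rules for communication prefixes. -/
lemma Ctx.pre_sound {J : Cap S n} (hJ : J.WFAt ρ) (hΓ : Ctx.WFAt ρ Γ) {a : ℕ} {T T' : Ty S n}
    (ha : Γ[a]? = some T) (hb : T'.base ρ = T.base ρ) (hw : T.WFAt ρ → T'.WFAt ρ) {α : Pol}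
    (hu : T'.usage ρ = SU.act α 0 (J.val ρ) (T.usage ρ)) :
    Ctx.WFAt ρ ((Γ.map (Ty.delayCap J)).set a T') ∧
      Ctx.base ρ ((Γ.map (Ty.delayCap J)).set a T') = Ctx.base ρ Γ ∧
      Ctx.usage ρ ((Γ.map (Ty.delayCap J)).set a T') = pre α (J.val ρ) a (Ctx.usage ρ Γ) := by
  obtain ⟨h1, h2, h3⟩ := Ctx.delayCap_sound hJ hΓ
  have ha' : (Γ.map (Ty.delayCap J))[a]? = some (T.delayCap J) := by simp [ha]
  refine ⟨h1.set (hw (hΓ.of_getElem? ha)), ?_, ?_⟩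
  · rw [Ctx.base_set ha' (hb.trans (Ty.base_mapUsage _ _ _).symm), h2]
  · funext x
    rw [Ctx.usage_set ha', h3, pre]
    split_ifs with hx
    · rw [hu, hx, Ctx.usage_of_getElem? ha]
    · rfl

lemma Ctx.WFAt.of_append {L : Ctx S n} (h : Ctx.WFAt ρ (L ++ Γ)) : Ctx.WFAt ρ Γ :=
  fun T hT => h T (List.mem_append_right _ hT)

lemma Itv.val_point_zero (ρ : Fin n → ℕ) : (Itv.point 0 : Itv S n).val ρ = 0 := by
  rw [Itv.val_point, SItv.pt_zero]

lemma Usage.wfAt_act {α : Pol} {J : Cap S n} {U : Usage S n} (hJ : J.WFAt ρ) (hU : U.WFAt ρ) :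
    (Usage.act α (.point 0) J U).WFAt ρ := ⟨Itv.wfAt_point ρ 0, hJ, hU⟩

lemma Usage.val_act {α : Pol} {J : Cap S n} {U : Usage S n} :
    (Usage.act α (.point 0) J U).val ρ = SU.act α 0 (J.val ρ) (U.val ρ) := by
  rw [← Itv.val_point_zero (S := S) ρ]
  rfl

/-- Soundness of typing. -/
lemma Typed.sound {n : ℕ} {Φ : Constraints S n} {Γ : Ctx S n} {P : Proc} {K : Itv S n}
    (h : Typed Φ Γ P K) : ∀ {ρ : Fin n → ℕ}, Φ.Sat ρ → Ctx.WFAt ρ Γ ∧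
      Sem P (Ctx.base ρ Γ) (Ctx.usage ρ Γ) (K.hi.eval ρ) := by
  induction h with
  | nil hw => exact fun hρ => ⟨Ctx.WF.at hw hρ, trivial⟩
  | par _ _ hp ih1 ih2 =>
    intro ρ hρ
    obtain ⟨hw1, h1⟩ := ih1 hρ
    obtain ⟨hw2, h2⟩ := ih2 hρ
    obtain ⟨h3, h4, h5, h6⟩ := hp.sound ρ
    rw [h4] at h1
    rw [h5] at h2
    refine ⟨h3 hw1 hw2, _, _, h1.mono_right le_rfl ?_, h2.mono_right le_rfl ?_, h6.le⟩ <;>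
      simp [Itv.sup]
  | tick _ ih =>
    intro ρ hρ
    obtain ⟨hw, h⟩ := ih hρ
    obtain ⟨h1, h2, h3⟩ := Ctx.delay_sound (Itv.wfAt_point ρ 1) hw
    rw [h2, h3, Itv.val_point]
    exact ⟨h1, _, _, h, le_rfl, by simp [Itv.add, Itv.point]⟩
  | ann m _ ih =>
    intro ρ hρ
    obtain ⟨hw, h⟩ := ih hρ
    obtain ⟨h1, h2, h3⟩ := Ctx.delay_sound (Itv.wfAt_point ρ m) hw
    rw [h2, h3, Itv.val_point]
    exact ⟨h1, _, _, h, le_rfl, by simp [Itv.add, Itv.point]⟩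
  | @ich n Φ Γ a m T U J P K hJ ha _ ih =>
    intro ρ hρ
    obtain ⟨hw, h⟩ := ih hρ
    have hJ := Cap.WF.at hρ hJ
    obtain ⟨h1, h2, h3⟩ := Ctx.pre_sound (α := .inp) hJ hw.of_append ha
      (T' := .chan m T (.act .inp (.point 0) J U)) rfl
      (fun h => ⟨h.1, Usage.wfAt_act hJ h.2⟩) Usage.val_act
    rw [h2, h3, Cap.hi_seq hJ]
    rw [Ctx.base_append, Ctx.usage_append] at h
    exact ⟨h1, _, _, _, _, _, Ctx.base_of_getElem? ha, h, le_rfl, le_rfl⟩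
  | @iserv n Φ Γ a k m K T U J P hJ ha _ ih =>
    intro ρ hρ
    have hJ := Cap.WF.at hρ hJ
    have hsub : ∀ ι : Fin k → ℕ, ∀ T' : Ty S n,
        ((T'.subst (wk k)).WFAt (Fin.append ρ ι) ↔ T'.WFAt ρ) ∧
        (T'.subst (wk k)).base (Fin.append ρ ι) = T'.base ρ ∧
        (T'.subst (wk k)).usage (Fin.append ρ ι) = T'.usage ρ := by
      intro ι T'
      rw [Ty.wfAt_subst, Ty.base_subst, Ty.usage_subst, eval_wk]
      exact ⟨Iff.rfl, rfl, rfl⟩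
    -- Any values of the bound index variables will do, because `Γ` does not involve them.
    have hw : Ctx.WFAt ρ Γ := fun T' hT' => ((hsub (fun _ => 0) T').1).1
      ((ih (hρ.weaken _)).1.of_append _ (List.mem_map_of_mem hT'))
    obtain ⟨h1, h2, h3⟩ := Ctx.bang_sound hw
    obtain ⟨h4, h5, h6⟩ := Ctx.delayCap_sound hJ h1
    rw [List.map_map] at h4 h5 h6
    have ha' : (Γ.map (Ty.delayCap J ∘ Ty.bang))[a]? = some ((Ty.serv k m K T U).bang.delayCap J) := by
      rw [List.getElem?_map, ha]
      rfl
    have hb := Ctx.base_set (ρ := ρ) ha'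
      (T' := .serv k m K T (.bang (.act .inp (.point 0) J U))) rfl
    have hu := Ctx.usage_set (ρ := ρ) ha'
      (T' := .serv k m K T (.bang (.act .inp (.point 0) J U)))
    refine ⟨h4.set ?_, ?_⟩
    · have := hw.of_getElem? ha
      exact ⟨this.1, Usage.wfAt_act (α := .inp) hJ this.2⟩
    · change Sem _ (Ctx.base ρ ((Γ.map (Ty.delayCap J ∘ Ty.bang)).set a _))
        (Ctx.usage ρ ((Γ.map (Ty.delayCap J ∘ Ty.bang)).set a _)) _
      rw [hb, h5, h2]
      refine ⟨k, _, _, _, J.val ρ, Ctx.usage ρ Γ, Ctx.base_of_getElem? ha, fun ι => ?_,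
        fun x => ?_⟩
      · have := (ih (hρ.weaken ι)).2
        rw [Ctx.base_append, Ctx.usage_append, Ctx.base_map fun T' _ => (hsub ι T').2.1,
          Ctx.usage_map (g := AddMonoidHom.id SU) fun T' _ => (hsub ι T').2.2] at this
        exact this
      · rw [hu, h6, h3]
        simp only [pre]
        split_ifs with hx
        · rw [hx, Ctx.usage_of_getElem? ha]
          exact le_of_eq (congrArg SU.bang Usage.val_act)
        · rw [SU.delay_bang]
  | @och n Φ Γ Γ' Θ a m T U V J es P K hJ ha' ht ha _ hp ih =>
    intro ρ hρ
    have hJ := Cap.WF.at hρ hJ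
    obtain ⟨hw, h⟩ := ih hρ
    obtain ⟨hw', ht⟩ := ht.sound hρ
    obtain ⟨h3, h4, h5, h6⟩ := hp.sound ρ
    obtain ⟨_, haΘ, ⟨⟩⟩ := hp.getElem? ha ha'
    obtain ⟨h7, h8, h9⟩ := Ctx.pre_sound (α := .out) hJ (h3 hw hw') haΘ
      (T' := .chan m T (.act .out (.point 0) J (.par V U))) rfl
      (fun h => ⟨h.1, Usage.wfAt_act hJ h.2.symm⟩)
      (Usage.val_act.trans (congrArg _ (add_comm (V.val ρ) (U.val ρ))))
    rw [h8, h9, h6, Cap.hi_seq hJ]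
    rw [h4] at h
    rw [h5] at ht
    have hb := h4 ▸ Ctx.base_of_getElem? (ρ := ρ) ha
    refine ⟨h7, m, _, _, _, _, _, _, 0, hb ▸ .chan _ _, ht, h, le_rfl, ?_⟩
    simp
  | @oserv n Φ Γ Γ' Θ a k m K T U V J es P K' Is hJ ha' ht ha _ hp ih =>
    intro ρ hρ
    have hJ := Cap.WF.at hρ hJ
    obtain ⟨hw, h⟩ := ih hρ
    obtain ⟨hw', ht⟩ := ht.sound hρ
    simp only [Ty.base_subst, Ty.usage_subst, eval_inst] at ht
    obtain ⟨h3, h4, h5, h6⟩ := hp.sound ρ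
    obtain ⟨_, haΘ, ⟨⟩⟩ := hp.getElem? ha ha'
    obtain ⟨h7, h8, h9⟩ := Ctx.pre_sound (α := .out) hJ (h3 hw hw') haΘ
      (T' := .serv k m K T (.act .out (.point 0) J (.par V U))) rfl
      (fun h => ⟨h.1, Usage.wfAt_act hJ h.2.symm⟩)
      (Usage.val_act.trans (congrArg _ (add_comm (V.val ρ) (U.val ρ))))
    rw [h8, h9, h6, Cap.hi_seq hJ]
    rw [h4] at h
    rw [h5] at ht
    have hb := h4 ▸ Ctx.base_of_getElem? (ρ := ρ) ha
    -- The families of the server type are taken at the values of `Is`.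
    have hs := Sends.serv k (fun ι => K.hi.eval (Fin.append ρ ι))
      (fun ι j => (T j).base (Fin.append ρ ι)) (fun ι j => (T j).usage (Fin.append ρ ι))
      fun j => (Is j).eval ρ
    change Sends (Ty.base ρ (.serv k m K T U)) _ _ _ at hs
    rw [← hb] at hs
    refine ⟨h7, m, _, _, _, _, _, _, _, hs, ht, h, le_rfl, le_of_eq ?_⟩
    simp [Itv.sup, Itv.subst, Idx.eval_subst, eval_inst]
  | @case n Φ Γ e I J P Q K he _ _ ih1 ih2 =>
    intro ρ hρ
    obtain ⟨hw, -, he, -⟩ := he.sound hρ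
    refine ⟨hw, _, _, he, fun hI => ?_, fun hJ => ?_⟩
    · exact (ih1 (List.forall_mem_cons.2 ⟨hI, hρ⟩)).2
    · have := (ih2 (List.forall_mem_cons.2 ⟨hJ, hρ⟩)).2
      rw [Ctx.base_cons, Ctx.usage_cons] at this
      simpa only [Ty.base, Ty.usage, Idx.eval_pred] using this
  | @nu n Φ Γ T P K hT hr _ ih =>
    intro ρ hρ
    obtain ⟨hw, h⟩ := ih hρ
    rw [Ctx.base_cons, Ctx.usage_cons] at h
    simp only [Ctx.WFAt, List.forall_mem_cons] at hw
    refine ⟨hw.2, _, _, ?_, h⟩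
    cases T with
    | nat => exact SU.safe_zero
    | chan => exact Usage.Reliable.safe_val hρ hr hw.1.2
    | serv => exact Usage.Reliable.safe_val hρ hr hw.1.2
  | sub hw _ hΓ hK ih =>
    intro ρ hρ
    have hw := Ctx.WF.at hw hρ
    obtain ⟨h1, h2⟩ := SubCtx.sound hΓ hρ hw
    exact ⟨hw, (ih hρ).2.mono h1 h2 (hK ρ hρ).2⟩

end PiUsage

namespace PiUsage

/-! ## The lower bound -/

/-! ### Composition of substitutions -/

lemma Expr.subst_rename (f : ℕ → ℕ) (σ : ℕ → Expr) : ∀ e : Expr,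
    (e.subst σ).rename f = e.subst fun i => (σ i).rename f
  | .var _ => rfl
  | .zero => rfl
  | .succ e => congrArg Expr.succ (e.subst_rename f σ)

lemma Expr.rename_subst (f : ℕ → ℕ) (σ : ℕ → Expr) : ∀ e : Expr,
    (e.rename f).subst σ = e.subst fun i => σ (f i)
  | .var _ => rfl
  | .zero => rfl
  | .succ e => congrArg Expr.succ (e.rename_subst f σ)

lemma Expr.subst_subst (τ σ : ℕ → Expr) : ∀ e : Expr,
    (e.subst τ).subst σ = e.subst fun i => (τ i).subst σ
  | .var _ => rfl
  | .zero => rfl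
  | .succ e => congrArg Expr.succ (e.subst_subst τ σ)

lemma liftSub_subst_liftSub (k : ℕ) (τ σ : ℕ → Expr) :
    (fun i => (liftSub k τ i).subst (liftSub k σ)) = liftSub k fun i => (τ i).subst σ := by
  funext i
  rcases lt_or_exists_add i k with hi | ⟨i, rfl⟩
  · simp [liftSub, hi, Expr.subst]
  · simp [liftSub, Expr.rename_subst, Expr.subst_rename]

/-- Definedness matters because `Expr.name` has the default value `0` off the variables: without it
the two sides may communicate on different names. -/
lemma Proc.subst_subst {P : Proc} : ∀ {τ : ℕ → Expr} (σ : ℕ → Expr), P.SubstDefined τ →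
    (P.subst τ).subst σ = P.subst fun i => (τ i).subst σ := by
  induction P with
  | nil => intros; rfl
  | par P Q ihP ihQ => exact fun σ h => congrArg₂ Proc.par (ihP σ h.1) (ihQ σ h.2)
  | rep a k P ih =>
    rintro τ σ ⟨⟨b, hb⟩, h⟩
    simp only [Proc.subst, ih _ h, liftSub_subst_liftSub, hb]
    rfl
  | inp a k P ih =>
    rintro τ σ ⟨⟨b, hb⟩, h⟩
    simp only [Proc.subst, ih _ h, liftSub_subst_liftSub, hb]
    rfl
  | out a es P ih =>
    rintro τ σ ⟨⟨b, hb⟩, h⟩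
    simp only [Proc.subst, ih _ h, hb, List.map_map, Function.comp_def, Expr.subst_subst]
    rfl
  | nu P ih =>
    intro τ σ h
    simp only [Proc.subst, ih _ h, liftSub_subst_liftSub]
  | tick P ih => exact fun σ h => congrArg Proc.tick (ih σ h)
  | case e P Q ihP ihQ =>
    intro τ σ h
    simp only [Proc.subst, ihP _ h.1, ihQ _ h.2, liftSub_subst_liftSub, Expr.subst_subst]
  | ann n P ih => exact fun σ h => congrArg (Proc.ann n) (ih σ h)

lemma Expr.subst_eq_var_of_eq_var {τ σ : ℕ → Expr} {a b : ℕ} (hb : τ a = .var b)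
    (h : ∃ c, (τ a).subst σ = .var c) : ∃ c, σ (τ a).name = .var c := by
  rw [hb] at h ⊢
  exact h

lemma Proc.SubstDefined.of_comp {P : Proc} : ∀ {τ σ : ℕ → Expr}, P.SubstDefined τ →
    P.SubstDefined (fun i => (τ i).subst σ) → (P.subst τ).SubstDefined σ := by
  induction P with
  | nil => intros; trivial
  | par P Q ihP ihQ => exact fun h h' => ⟨ihP h.1 h'.1, ihQ h.2 h'.2⟩
  | rep a k P ih =>
    rintro τ σ ⟨⟨b, hb⟩, h⟩ ⟨h1, h'⟩
    exact ⟨Expr.subst_eq_var_of_eq_var hb h1, ih h (by rwa [liftSub_subst_liftSub])⟩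
  | inp a k P ih =>
    rintro τ σ ⟨⟨b, hb⟩, h⟩ ⟨h1, h'⟩
    exact ⟨Expr.subst_eq_var_of_eq_var hb h1, ih h (by rwa [liftSub_subst_liftSub])⟩
  | out a es P ih =>
    rintro τ σ ⟨⟨b, hb⟩, h⟩ ⟨h1, h'⟩
    exact ⟨Expr.subst_eq_var_of_eq_var hb h1, ih h h'⟩
  | nu P ih =>
    intro τ σ h h'
    exact ih (τ := liftSub 1 τ) (σ := liftSub 1 σ) h (by rw [liftSub_subst_liftSub]; exact h')
  | tick P ih => exact fun {τ σ} h h' => ih (τ := τ) (σ := σ) h h'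
  | case e P Q ihP ihQ =>
    exact fun h h' => ⟨ihP h.1 h'.1, ihQ h.2 (by rw [liftSub_subst_liftSub]; exact h'.2)⟩
  | ann n P ih => exact fun {τ σ} h h' => ih (τ := τ) (σ := σ) h h'

/-! ### Substitutions that respect names -/

variable {S : IndexSig} {n : ℕ}

/-- The variable `x` is a channel or server name. -/
def Ctx.IsName {n : ℕ} (Γ : Ctx S n) (x : ℕ) : Prop := ∃ T, Γ[x]? = some T ∧ ¬ T.IsNat

/-- The substitution replaces names by names. -/
def NameSub {n : ℕ} (Γ : Ctx S n) (σ : ℕ → Expr) : Prop := ∀ x, Γ.IsName x → ∃ b, σ x = .var b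

lemma Ctx.IsName.map {m : ℕ} {Γ : Ctx S n} {f : Ty S n → Ty S m}
    (hf : ∀ {T}, ¬ T.IsNat → ¬ (f T).IsNat) {x : ℕ} (h : Γ.IsName x) :
    Ctx.IsName (Γ.map f) x := by
  obtain ⟨T, h, hT⟩ := h
  exact ⟨f T, by simp [h], hf hT⟩

lemma Ty.not_isNat_mapUsage (f : Usage S n → Usage S n) {T : Ty S n} (h : ¬ T.IsNat) :
    ¬ (T.mapUsage f).IsNat := by
  cases T <;> exact h

lemma Ctx.IsName.set {Γ : Ctx S n} {x a : ℕ} {T : Ty S n} (hT : ¬ T.IsNat) (h : Γ.IsName x) :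
    Ctx.IsName (Γ.set a T) x := by
  obtain ⟨T', h, hT'⟩ := h
  have hx := (List.getElem?_eq_some_iff.1 h).1
  by_cases ha : a = x
  · subst ha
    exact ⟨T, by simp [hx], hT⟩
  · exact ⟨T', by simp [ha, h], hT'⟩

lemma Ctx.IsName.par {Γ Δ Θ : Ctx S n} (hp : Ctx.Par Γ Δ Θ) {x : ℕ}
    (h : Γ.IsName x ∨ Δ.IsName x) : Θ.IsName x := by
  induction hp generalizing x with
  | nil => simp [Ctx.IsName] at h
  | @cons T T' T'' Γ Δ Θ hT _ ih =>
    cases x with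
    | zero =>
      refine ⟨T'', rfl, ?_⟩
      rcases h with ⟨_, ⟨⟩, h⟩ | ⟨_, ⟨⟩, h⟩ <;> cases hT <;> exact h
    | succ x => exact ih h

lemma Ctx.IsName.of_sub {Φ : Constraints S n} {Γ Δ : Ctx S n} (hs : SubCtx Φ Γ Δ) {x : ℕ}
    (h : Δ.IsName x) : Γ.IsName x := by
  induction hs generalizing x with
  | nil => exact h
  | @cons T T' _ _ hT _ ih =>
    cases x with
    | zero =>
      obtain ⟨_, ⟨⟩, h⟩ := h
      refine ⟨T, rfl, ?_⟩
      cases hT with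
      | nat => exact h
      | chan => exact not_false
      | serv => exact not_false
    | succ x => exact ih h

lemma NameSub.append {m : ℕ} {Γ : Ctx S n} {σ : ℕ → Expr} (h : NameSub Γ σ) (T : Fin m → Ty S n) :
    NameSub (List.ofFn T ++ Γ) (liftSub m σ) := by
  rintro x ⟨T', hT, hT'⟩
  rcases lt_or_exists_add x m with hx | ⟨x, rfl⟩
  · exact ⟨x, by simp [liftSub, hx]⟩
  · rw [getElem?_ofFn_append, extend_add] at hT
    obtain ⟨b, hb⟩ := h x ⟨T', hT, hT'⟩
    exact ⟨b + m, by simp [liftSub, hb, Expr.rename]⟩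

lemma NameSub.cons {Γ : Ctx S n} {σ : ℕ → Expr} (h : NameSub Γ σ) (T : Ty S n) :
    NameSub (T :: Γ) (liftSub 1 σ) := h.append (m := 1) fun _ => T

/-- Substitutions that respect names are well defined on typed processes. -/
lemma Typed.substDefined {n : ℕ} {Φ : Constraints S n} {Γ : Ctx S n} {P : Proc} {K : Itv S n}
    (h : Typed Φ Γ P K) : ∀ {σ : ℕ → Expr}, NameSub Γ σ → P.SubstDefined σ := by
  induction h with
  | nil => intros; trivial
  | par _ _ hp ih1 ih2 =>
    exact fun hσ => ⟨ih1 fun x hx => hσ x (.par hp (Or.inl hx)),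
      ih2 fun x hx => hσ x (.par hp (Or.inr hx))⟩
  | tick _ ih => exact fun {σ} hσ => ih (σ := σ) fun x hx => hσ x (hx.map (Ty.not_isNat_mapUsage _))
  | ann _ _ ih =>
    exact fun {σ} hσ => ih (σ := σ) fun x hx => hσ x (hx.map (Ty.not_isNat_mapUsage _))
  | ich _ ha _ ih =>
    intro σ hσ
    have h : NameSub _ σ := fun x hx =>
      hσ x ((hx.map (Ty.not_isNat_mapUsage _)).set not_false)
    exact ⟨h _ ⟨_, ha, not_false⟩, ih (h.append _)⟩
  | @iserv n Φ Γ a k m K T U J P _ ha _ ih =>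
    intro σ hσ
    have h : NameSub Γ σ := fun x hx =>
      hσ x ((hx.map fun hT => Ty.not_isNat_mapUsage _ (Ty.not_isNat_mapUsage _ hT)).set not_false)
    refine ⟨h _ ⟨_, ha, not_false⟩, ih (NameSub.append (fun x hx => h x ?_) _)⟩
    obtain ⟨T', hT, hT'⟩ := hx
    rw [List.getElem?_map, Option.map_eq_some_iff] at hT
    obtain ⟨T', hT, rfl⟩ := hT
    refine ⟨T', hT, ?_⟩
    cases T' <;> exact hT'
  | och _ _ _ ha _ hp ih =>
    intro σ hσ
    have h : NameSub _ σ := fun x hx =>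
      hσ x (((Ctx.IsName.par hp (Or.inl hx)).map (Ty.not_isNat_mapUsage _)).set not_false)
    exact ⟨h _ ⟨_, ha, not_false⟩, ih h⟩
  | oserv _ _ _ _ ha _ hp ih =>
    intro σ hσ
    have h : NameSub _ σ := fun x hx =>
      hσ x (((Ctx.IsName.par hp (Or.inl hx)).map (Ty.not_isNat_mapUsage _)).set not_false)
    exact ⟨h _ ⟨_, ha, not_false⟩, ih h⟩
  | case _ _ _ ih1 ih2 => exact fun hσ => ⟨ih1 hσ, ih2 (hσ.cons _)⟩
  | nu _ _ _ ih => exact fun hσ => ih (hσ.cons _)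
  | sub _ _ hs _ ih => exact fun hσ => ih fun x hx => hσ x (hx.of_sub hs)

/-! ### Substitutions of numerals -/

/-- Numerals. -/
def Expr.num : ℕ → Expr
  | 0 => .zero
  | k + 1 => .succ (.num k)

lemma Expr.num_rename (f : ℕ → ℕ) : ∀ k, (Expr.num k).rename f = .num k
  | 0 => rfl
  | k + 1 => congrArg Expr.succ (Expr.num_rename f k)

/-- An expression that can be substituted for a variable of the given type: a numeral in the
interval, or a name. -/
def Ty.Fits {n : ℕ} (ρ : Fin n → ℕ) : Ty S n → Expr → Prop
  | .nat I J, e => ∃ k : ℕ, e = .num k ∧ I.eval ρ ≤ k ∧ k ≤ J.eval ρ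
  | _, e => ∃ b, e = .var b

/-- A substitution that fits the context. -/
def Ctx.Fits {n : ℕ} (ρ : Fin n → ℕ) (Γ : Ctx S n) (σ : ℕ → Expr) : Prop :=
  ∀ (x : ℕ) (T : Ty S n), Γ[x]? = some T → T.Fits ρ (σ x)

section Fits

variable {ρ : Fin n → ℕ} {Γ Δ Θ : Ctx S n} {σ : ℕ → Expr}

lemma Ctx.Fits.nameSub (h : Ctx.Fits ρ Γ σ) : NameSub Γ σ := by
  rintro x ⟨T, hx, hT⟩
  have := h x T hx
  cases T with
  | nat => exact (hT trivial).elim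
  | chan => exact this
  | serv => exact this

lemma Ctx.Fits.of_map_delay {A : Itv S n} (h : Ctx.Fits ρ (Γ.map (Ty.delay A)) σ) :
    Ctx.Fits ρ Γ σ := by
  intro x T hx
  have := h x (T.delay A) (by simp [hx])
  cases T <;> exact this

lemma Ctx.Fits.of_par (hp : Ctx.Par Γ Δ Θ) (h : Ctx.Fits ρ Θ σ) :
    Ctx.Fits ρ Γ σ ∧ Ctx.Fits ρ Δ σ := by
  induction hp generalizing σ with
  | nil => exact ⟨h, h⟩
  | cons hT _ ih =>
    have h0 := h 0 _ rfl
    have h1 := ih (σ := fun x => σ (x + 1)) fun x T hx => h (x + 1) T hx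
    constructor <;> intro x T hx <;> cases x with
    | zero => cases hx; cases hT <;> exact h0
    | succ x => first | exact h1.1 x T hx | exact h1.2 x T hx

lemma SubTy.fits {Φ : Constraints S n} {T T' : Ty S n} (h : SubTy Φ T T') (hρ : Φ.Sat ρ)
    {e : Expr} (he : T.Fits ρ e) : T'.Fits ρ e := by
  cases h with
  | nat h1 h2 =>
    obtain ⟨k, rfl, hI, hJ⟩ := he
    exact ⟨k, rfl, (h1 ρ hρ).trans hI, hJ.trans (h2 ρ hρ)⟩
  | chan => exact he
  | serv => exact he

lemma Ctx.Fits.of_sub {Φ : Constraints S n} (hs : SubCtx Φ Γ Δ) (hρ : Φ.Sat ρ)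
    (h : Ctx.Fits ρ Γ σ) : Ctx.Fits ρ Δ σ := by
  induction hs generalizing σ with
  | nil => exact h
  | cons hT _ ih =>
    intro x T hx
    cases x with
    | zero => cases hx; exact hT.fits hρ (h 0 _ rfl)
    | succ x => exact ih (σ := fun x => σ (x + 1)) (fun x T hx => h (x + 1) T hx) x T hx

/-- A fitting substitution turns an integer expression into a numeral of its interval, so a pattern
matching on it is never stuck. -/
lemma ExprTyped.fits {Φ : Constraints S n} {e : Expr} {T : Ty S n} (h : ExprTyped Φ Γ e T)
    (hρ : Φ.Sat ρ) (hσ : Ctx.Fits ρ Γ σ) : T.Fits ρ (e.subst σ) := by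
  induction h with
  | var _ hx => exact hσ _ _ hx
  | zero => exact ⟨0, rfl, le_rfl, le_rfl⟩
  | succ _ ih =>
    obtain ⟨k, hk, hI, hJ⟩ := ih hσ
    refine ⟨k + 1, congrArg Expr.succ hk, ?_, ?_⟩
    · rw [Idx.eval_add, Nat.cast_add]
      exact add_le_add hI le_rfl
    · rw [Idx.eval_add, Nat.cast_add]
      exact add_le_add hJ le_rfl
  | sub _ _ hs hT ih => exact hT.fits hρ (ih (hσ.of_sub hs hρ))

lemma Ctx.Fits.cons {T : Ty S n} {e : Expr} (he : T.Fits ρ e) (hσ : Ctx.Fits ρ Γ σ) :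
    Ctx.Fits ρ (T :: Γ) (extend (m := 1) (fun _ => e) σ) := by
  intro x T' hx
  cases x with
  | zero => cases hx; exact he
  | succ x => exact hσ x T' hx

lemma Ty.Fits.rename {T : Ty S n} {e : Expr} (he : T.Fits ρ e) (f : ℕ → ℕ) :
    T.Fits ρ (e.rename f) := by
  cases T with
  | nat =>
    obtain ⟨k, rfl, h⟩ := he
    exact ⟨k, Expr.num_rename f k, h⟩
  | chan =>
    obtain ⟨b, rfl⟩ := he
    exact ⟨f b, rfl⟩
  | serv =>
    obtain ⟨b, rfl⟩ := he
    exact ⟨f b, rfl⟩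

lemma Ctx.Fits.lift {T : Ty S n} (hT : ¬ T.IsNat) (hσ : Ctx.Fits ρ Γ σ) :
    Ctx.Fits ρ (T :: Γ) (liftSub 1 σ) := by
  intro x T' hx
  cases x with
  | zero =>
    cases hx
    cases T with
    | nat => exact (hT trivial).elim
    | chan => exact ⟨0, rfl⟩
    | serv => exact ⟨0, rfl⟩
  | succ x => exact (hσ x T' hx).rename _

end Fits

/-- Prefixes contribute nothing to the lower bound, so no communication has to be executed to reach
it. -/
lemma Cap.lo_seq (ρ : Fin n → ℕ) (J : Cap S n) (K : Itv S n) : (J.seq K).lo.eval ρ = 0 := by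
  match J with
  | .upTo _ | .itv ⟨.top, _⟩ | .itv ⟨.fin _, _⟩ => rfl

lemma Proc.red_par_left {P P' : Proc} (Q : Proc) (h : Relation.ReflTransGen Proc.Red P P') :
    Relation.ReflTransGen Proc.Red (.par P Q) (.par P' Q) :=
  h.lift (Proc.par · Q) fun _ _ h => .par Q h

lemma Proc.red_par_right {Q Q' : Proc} (P : Proc) (h : Relation.ReflTransGen Proc.Red Q Q') :
    Relation.ReflTransGen Proc.Red (.par P Q) (.par P Q') :=
  h.lift (Proc.par P) fun _ _ h => .congr (.par_comm _ _) (.par P h) (.par_comm _ _)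

/-- Once its integer variables are replaced by numerals, a typed process reaches the lower bound by
executing its ticks and pattern matchings. -/
lemma Typed.exists_lo_le {n : ℕ} {Φ : Constraints S n} {Γ : Ctx S n} {P : Proc} {K : Itv S n}
    (h : Typed Φ Γ P K) : ∀ {ρ : Fin n → ℕ} {σ : ℕ → Expr}, Φ.Sat ρ → Ctx.Fits ρ Γ σ →
      ∃ Q, Relation.ReflTransGen Proc.Red (P.subst σ) Q ∧
        K.lo.eval ρ ≤ (Q.localComplexity : ℕ∞) := by
  induction h with
  | nil => exact fun _ _ => ⟨_, .refl, zero_le⟩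
  | par _ _ hp ih1 ih2 =>
    intro ρ σ hρ hσ
    obtain ⟨Q₁, h1, h1'⟩ := ih1 hρ (hσ.of_par hp).1
    obtain ⟨Q₂, h2, h2'⟩ := ih2 hρ (hσ.of_par hp).2
    refine ⟨.par Q₁ Q₂, (Proc.red_par_left _ h1).trans (Proc.red_par_right _ h2), ?_⟩
    rw [Proc.localComplexity, (Nat.mono_cast (α := ℕ∞)).map_max]
    simpa only [Itv.sup, Idx.eval_max] using max_le_max h1' h2'
  | tick _ ih =>
    intro ρ σ hρ hσ
    obtain ⟨Q, h, h'⟩ := ih hρ hσ.of_map_delay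
    refine ⟨.ann 1 Q, .head (.tick _) (h.lift (Proc.ann 1) fun _ _ h => .ann 1 h), ?_⟩
    rw [Proc.localComplexity, Nat.cast_add, add_comm]
    rw [Itv.add, Idx.eval_add]
    exact add_le_add h' le_rfl
  | ann m _ ih =>
    intro ρ σ hρ hσ
    obtain ⟨Q, h, h'⟩ := ih hρ hσ.of_map_delay
    refine ⟨.ann m Q, h.lift (Proc.ann m) fun _ _ h => .ann m h, ?_⟩
    rw [Proc.localComplexity, Nat.cast_add, add_comm]
    rw [Itv.add, Idx.eval_add]
    exact add_le_add h' le_rfl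
  | ich => exact fun _ _ => ⟨_, .refl, by rw [Cap.lo_seq]; exact zero_le⟩
  | iserv => exact fun _ _ => ⟨_, .refl, zero_le⟩
  | och => exact fun _ _ => ⟨_, .refl, by rw [Cap.lo_seq]; exact zero_le⟩
  | oserv => exact fun _ _ => ⟨_, .refl, by rw [Cap.lo_seq]; exact zero_le⟩
  | @case n Φ Γ e I J P Q K he hP hQ ih1 ih2 =>
    intro ρ σ hρ hσ
    obtain ⟨k, hk, hI, hJ⟩ := he.fits hρ hσ
    -- The numeral decides the branch, and its membership in the interval yields the constraint of
    -- that branch.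
    cases k with
    | zero =>
      obtain ⟨R, h, h'⟩ := ih1 (List.forall_mem_cons.2 ⟨by simpa using hI, hρ⟩) hσ
      refine ⟨R, .head ?_ h, h'⟩
      rw [Proc.subst, hk]
      exact .case_zero _ _
    | succ k =>
      have hσ' : Ctx.Fits ρ (.nat I.pred J.pred :: Γ) (extend (m := 1) (fun _ => .num k) σ) := by
        refine Ctx.Fits.cons ⟨k, rfl, ?_, ?_⟩ hσ
        · rw [Idx.eval_pred]
          exact tsub_le_iff_right.2 (by simpa using hI)
        · rw [Idx.eval_pred]
          exact ENat.le_sub_of_add_le_right (by simp) (by simpa using hJ)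
      -- Applying `σ` and then passing the predecessor is a single fitting substitution, to which
      -- the induction hypothesis applies.
      have hcomp : (fun i => (liftSub 1 σ i).subst (instSub [.num k])) =
          extend (m := 1) (fun _ => .num k) σ := by
        funext i
        cases i with
        | zero => rfl
        | succ i =>
          simp only [liftSub, Nat.add_sub_cancel, extend_one_succ]
          rw [if_neg (by omega), Expr.rename_subst]
          exact Expr.subst_var _
      have hd := hQ.substDefined (hσ.nameSub.cons _)
      obtain ⟨R, h, h'⟩ := ih2 (List.forall_mem_cons.2
        ⟨le_trans (by simp [Idx.eval, Idx.const, FinIdx.eval]) hJ, hρ⟩) hσ'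
      refine ⟨R, .head ?_ h, h'⟩
      rw [Proc.subst, hk, ← hcomp, ← Proc.subst_subst _ hd]
      refine .case_succ _ _ _ (hd.of_comp ?_)
      rw [hcomp]
      exact hQ.substDefined hσ'.nameSub
  | nu hT _ _ ih =>
    intro ρ σ hρ hσ
    obtain ⟨Q, h, h'⟩ := ih hρ (hσ.lift hT)
    exact ⟨.nu Q, h.lift Proc.nu fun _ _ h => .nu h, h'⟩
  | sub _ _ hs hK ih =>
    intro ρ σ hρ hσ
    obtain ⟨Q, h, h'⟩ := ih hρ (hσ.of_sub hs hρ)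
    exact ⟨Q, h, (hK ρ hρ).1.trans h'⟩

end PiUsage

/-! ### Conclusion: both bounds on the span. -/

theorem theoremt (S : IndexSig) (n : ℕ) (Φ : Constraints S n) (Γ : Ctx S n) (P : Proc)
    (I J : Idx S n) (hP : Typed Φ Γ P ⟨I, J⟩) (hΓ : ∀ T ∈ Γ, T.Reliable Φ) :
    (Entails Φ fun ρ => J.eval ρ ≥ P.span) ∧
      ((∀ T ∈ Γ, ¬ T.IsNat) → Entails Φ fun ρ => I.eval ρ ≤ P.span) := by
  refine ⟨fun ρ hρ => ?_, fun hΓ' ρ hρ => ?_⟩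
  · obtain ⟨hw, h⟩ := hP.sound hρ
    refine h.span_le fun x => ?_
    cases hx : Γ[x]? with
    | none =>
      rw [Ctx.usage, hx]
      exact SU.safe_zero
    | some T =>
      have hT := List.mem_of_getElem? hx
      rw [Ctx.usage_of_getElem? hx]
      cases T with
      | nat => exact SU.safe_zero
      | chan => exact Usage.Reliable.safe_val hρ (hΓ _ hT) (hw _ hT).2
      | serv => exact Usage.Reliable.safe_val hρ (hΓ _ hT) (hw _ hT).2
  -- Every entry of `Γ` is a name, so no numeral is needed and the identity substitution fits.
  · obtain ⟨Q, h, h'⟩ := hP.exists_lo_le (σ := .var) hρ fun x T hx => by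
      have hT := hΓ' T (List.mem_of_getElem? hx)
      cases T with
      | nat => exact (hT trivial).elim
      | chan => exact ⟨x, rfl⟩
      | serv => exact ⟨x, rfl⟩
    rw [← Proc.rename_eq_subst (f := fun i => i), Proc.rename_id] at h
    exact h'.trans (le_sSup ⟨Q, h, rfl⟩)
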